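/- Let $D=x\partial_x$ and $\mathcal A=\partial_x(x^3+x^2)\partial_x^3$ on $(0,\infty)$. For $\alpha\in\mathbb R$ and $k\in\mathbb N_0$ put $$(v,w)_\alpha=\int_0^\infty x^{-2\alpha}\,v\,w\,\frac{dx}{x},\qquad |w|_{k,\alpha}^2=\sum_{j=0}^k (D^jw,D^jw)_\alpha ,$$ with derivatives in the sense of distributions and the value $\infty$ if some $D^jw$, $j\le k$, is not a locally integrable function. For a function $u$ of $(t,x)$ write $\tilde u=(D-1)u$ and $\check u=(D-2)(D-1)u$. Let $$\tilde{\mathcal A}=x^{-1}D^2(D-2)^2+x^{-2}D(D-1)(D-2)(D-3),\qquad \check{\mathcal A}=x^{-1}D^2(D-2)(D-3)+x^{-2}D(D-1)(D-3)(D-4),$$ so that $(D-1)\mathcal A=\tilde{\mathcal A}(D-1)$ and $(D-2)\tilde{\mathcal A}=\check{\mathcal A}(D-2)$. The coercivity range of $L\in\{\tilde{\mathcal A},\check{\mathcal A}\}$ is the set of all $\alpha\in\mathbb R$ for which there is $c>0$ with $$(Lw,w)_\alpha\ \ge\ c\left(|w|_{2,\alpha+\frac12}^2+|w|_{2,\alpha+1}^2\right)\qquad\text{for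 all } w\in C_c^\infty((0,\infty)).$$ For $T\in(0,\infty]$, $f$ locally integrable on $(0,T)\times(0,\infty)$ and $u^{(0)}$ locally integrable on $(0,\infty)$, consider the linear problem $$\partial_t u+\mathcal A u=f \ \text{ in } (0,T)\times(0,\infty),\qquad u=0 \ \text{ at } x=0,\qquad u=u^{(0)} \ \text{ at } t=0. \tag{1}$$ A solution is a locally integrable $u:(0,T)\times(0,\infty)\to\mathbb R$ that satisfies the equation in the sense of distributions, with $\operatorname{ess\,lim}_{x\searrow0}u(t,x)=0$ for almost every $t\in(0,T)$, and $u(t,\cdot)\to u^{(0)}$ in the sense of distributions on $(0,\infty)$ as $t\searrow 0$ (essential limit in $t$). **Proposition.** Let $T\in(0,\infty]$ and let $u$ be a solution of (1) with $u^{(0)}\equiv0$ and $f\equiv0$ such that one of the following holds: (a) $\int_0^T\big(|\tilde u|_{4,\tilde\alpha+\frac12}^2+|\tilde u|_{4,\tilde\alpha+1}^2\big)\,dt<\infty$ for some $\tilde\alpha$ in the coercivity range of $\tilde{\mathcal A}$; (b) $\int_0^T\big(|\check u|_{4,\check\alpha+\frac12}^2+|\check u|_{4,\check\alpha+1}^2\big)\,dt<\infty$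 for some $\check\alpha$ in the coercivity range of $\check{\mathcal A}$. Then $u=0$ almost everywhere in $(0,T)\times(0,\infty)$. Here $\tilde\alpha\in(0,1)$ is sufficient for $\tilde\alpha$ to be in the coercivity range of $\tilde{\mathcal A}$, and $\check\alpha\in\left(1-\sqrt{5/6},\,3/2\right)$ is sufficient for $\check\alpha$ to be in the coercivity range of $\check{\mathcal A}$. In particular, solutions of (1) with given $f$ and $u^{(0)}$ are unique: two solutions with the same data that both satisfy (a) with the same $\tilde\alpha$, or both satisfy (b) with the same $\check\alpha$, coincide almost everywhere. -/

import Mathlib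

open Set Filter Topology MeasureTheory
open scoped ENNReal ContDiff

noncomputable section

namespace ThinFilm

/-! ### One-variable notions on the half line (0, ∞) -/

/-- Smooth test functions with compact support in the open half line `(0, ∞)`. -/
def IsTest (w : ℝ → ℝ) : Prop :=
  ContDiff ℝ ∞ w ∧ HasCompactSupport w ∧ tsupport w ⊆ Ioi 0

/-- The operator `D - γ`, where `D = x ∂ₓ` is the logarithmic derivative. -/
def shiftD (γ : ℝ) (w : ℝ → ℝ) : ℝ → ℝ := fun x => x * deriv w x - γ * w x

/-- The weighted inner product `(v, w)_α = ∫₀^∞ x^(-2α) v w dx/x`. -/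
def wInner (α : ℝ) (v w : ℝ → ℝ) : ℝ :=
  ∫ x in Ioi (0 : ℝ), x ^ (-2 * α) * v x * w x / x

/-- The squared norm `|w|_{k,α}² = ∑_{j ≤ k} (D^j w, D^j w)_α` of a smooth function `w`. -/
def wNormSq (k : ℕ) (α : ℝ) (w : ℝ → ℝ) : ℝ :=
  ∑ j ∈ Finset.range (k + 1), wInner α ((shiftD 0)^[j] w) ((shiftD 0)^[j] w)

/-- `Ã = x⁻¹ p̃(D) + x⁻² q̃(D)`, `p̃(ζ) = ζ² (ζ-2)²`, `q̃(ζ) = ζ (ζ-1) (ζ-2) (ζ-3)`. -/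
def opTilde (w : ℝ → ℝ) : ℝ → ℝ := fun x =>
  x⁻¹ * shiftD 0 (shiftD 0 (shiftD 2 (shiftD 2 w))) x
    + (x ^ 2)⁻¹ * shiftD 0 (shiftD 1 (shiftD 2 (shiftD 3 w))) x

/-- `Ǎ = x⁻¹ p̌(D) + x⁻² q̌(D)`, `p̌(ζ) = ζ² (ζ-2) (ζ-3)`, `q̌(ζ) = ζ (ζ-1) (ζ-3) (ζ-4)`. -/
def opCheck (w : ℝ → ℝ) : ℝ → ℝ := fun x =>
  x⁻¹ * shiftD 0 (shiftD 0 (shiftD 2 (shiftD 3 w))) x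
    + (x ^ 2)⁻¹ * shiftD 0 (shiftD 1 (shiftD 3 (shiftD 4 w))) x

/-- The coercivity range of `L`: all `α` such that, with a constant `c > 0`,
`(L w, w)_α ≥ c (|w|_{2,α+1/2}² + |w|_{2,α+1}²)`. The estimate is required on the test functions,
which are dense with respect to the norms on the right; on those both sides are classical. -/
def coercivityRange (L : (ℝ → ℝ) → ℝ → ℝ) : Set ℝ :=
  {α | ∃ c : ℝ, 0 < c ∧ ∀ w : ℝ → ℝ, IsTest w →
    c * (wNormSq 2 (α + 1 / 2) w + wNormSq 2 (α + 1) w) ≤ wInner α (L w) w}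

/-! ### Space-time notions on (0, T) × (0, ∞); points are pairs (t, x) -/

/-- The domain `(0, T) × (0, ∞)`, where `T = ⊤` is allowed. -/
def domain (T : EReal) : Set (ℝ × ℝ) := {p | 0 < p.1 ∧ (p.1 : EReal) < T ∧ 0 < p.2}

/-- Smooth test functions with compact support in the open set `(0, T) × (0, ∞)`. -/
def IsTestOn (T : EReal) (φ : ℝ × ℝ → ℝ) : Prop :=
  ContDiff ℝ ∞ φ ∧ HasCompactSupport φ ∧ tsupport φ ⊆ domain T

/-- The partial derivative `∂ₜ φ`. -/
def dt (φ : ℝ × ℝ → ℝ) : ℝ × ℝ → ℝ := fun p => deriv (fun s => φ (s, p.2)) p.1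

/-- The partial derivative `∂ₓ φ`. -/
def dx (φ : ℝ × ℝ → ℝ) : ℝ × ℝ → ℝ := fun p => deriv (fun y => φ (p.1, y)) p.2

/-- The formal adjoint `φ ↦ -∂ₓ(x φ) - γ φ` of `D - γ = x ∂ₓ - γ` with respect to `dx dt`. -/
def adjD (γ : ℝ) (φ : ℝ × ℝ → ℝ) : ℝ × ℝ → ℝ :=
  fun p => -dx (fun q => q.2 * φ q) p - γ * φ p

/-- The formal adjoint `φ ↦ ∂ₓ³((x³ + x²) ∂ₓ φ)` of `A = ∂ₓ (x³ + x²) ∂ₓ³`. -/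
def adjA (φ : ℝ × ℝ → ℝ) : ℝ × ℝ → ℝ :=
  dx (dx (dx (fun q => (q.2 ^ 3 + q.2 ^ 2) * dx φ q)))

/-- `w` is locally integrable and `w = L v` in the sense of distributions on `(0, T) × (0, ∞)`,
where `L` is the differential operator with formal adjoint `Ladj`. -/
def IsWeakImage (T : EReal) (Ladj : (ℝ × ℝ → ℝ) → ℝ × ℝ → ℝ) (v w : ℝ × ℝ → ℝ) : Prop :=
  LocallyIntegrableOn w (domain T) ∧
    ∀ φ : ℝ × ℝ → ℝ, IsTestOn T φ →
      ∫ p in domain T, w p * φ p = ∫ p in domain T, v p * Ladj φ p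

/-- `ũ = (D - 1) u` in the sense of distributions. -/
def IsTilde (T : EReal) (u ut : ℝ × ℝ → ℝ) : Prop := IsWeakImage T (adjD 1) u ut

/-- `ǔ = (D - 2) (D - 1) u` in the sense of distributions. -/
def IsCheck (T : EReal) (u uc : ℝ × ℝ → ℝ) : Prop :=
  IsWeakImage T (fun φ => adjD 1 (adjD 2 φ)) u uc

/-- `W 0, …, W k` are `w, D w, …, D^k w`, with `D` understood in the sense of distributions. -/
def IsWeakChain (T : EReal) (k : ℕ) (w : ℝ × ℝ → ℝ) (W : ℕ → ℝ × ℝ → ℝ) : Prop :=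
  W 0 = w ∧ ∀ j < k, IsWeakImage T (adjD 0) (W j) (W (j + 1))

/-- The quantity `∫₀^T |w(t)|_{k,α}² dt ∈ [0, ∞]`. The derivatives `D^j w` are weak ones, which are
unique almost everywhere; the infimum, being `∞` over the empty set, makes the value `∞` if
they do not all exist as locally integrable functions. -/
def timeNormSq (T : EReal) (k : ℕ) (α : ℝ) (w : ℝ × ℝ → ℝ) : ℝ≥0∞ :=
  ⨅ (W : ℕ → ℝ × ℝ → ℝ) (_ : IsWeakChain T k w W),
    ∑ j ∈ Finset.range (k + 1),
      ∫⁻ p in domain T, ENNReal.ofReal (p.2 ^ (-2 * α) * (W j p) ^ 2 / p.2)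

/-- `ũ = (D - 1) u` satisfies `∫₀^T (|ũ|_{4,α+1/2}² + |ũ|_{4,α+1}²) dt < ∞`. -/
def TildeBound (T : EReal) (α : ℝ) (u : ℝ × ℝ → ℝ) : Prop :=
  ∃ ut : ℝ × ℝ → ℝ, IsTilde T u ut ∧
    timeNormSq T 4 (α + 1 / 2) ut + timeNormSq T 4 (α + 1) ut < ⊤

/-- `ǔ = (D - 2) (D - 1) u` satisfies `∫₀^T (|ǔ|_{4,α+1/2}² + |ǔ|_{4,α+1}²) dt < ∞`. -/
def CheckBound (T : EReal) (α : ℝ) (u : ℝ × ℝ → ℝ) : Prop :=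
  ∃ uc : ℝ × ℝ → ℝ, IsCheck T u uc ∧
    timeNormSq T 4 (α + 1 / 2) uc + timeNormSq T 4 (α + 1) uc < ⊤

/-- `u` is a locally integrable distributional solution on `(0, T) × (0, ∞)` of
`∂ₜ u + A u = f`, `u = 0` at `x = 0`, `u = u₀` at `t = 0`. The filters `ae volume ⊓ 𝓝[>] 0` express
essential limits, so that nothing depends on the values of `u` on null sets. -/
structure IsSolution (T : EReal) (f : ℝ × ℝ → ℝ) (u₀ : ℝ → ℝ) (u : ℝ × ℝ → ℝ) : Prop where
  locallyIntegrable : LocallyIntegrableOn u (domain T)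
  /-- The equation holds in the sense of distributions. -/
  equation : ∀ φ : ℝ × ℝ → ℝ, IsTestOn T φ →
    ∫ p in domain T, u p * (-dt φ p + adjA φ p) = ∫ p in domain T, f p * φ p
  /-- `u(t, ·) → 0` as `x ↘ 0`, for almost every `t`. -/
  boundary : ∀ᵐ t : ℝ, 0 < t → (t : EReal) < T →
    Tendsto (fun x => u (t, x)) (ae volume ⊓ 𝓝[>] 0) (𝓝 0)
  /-- `u(t, ·) → u₀` in the sense of distributions on `(0, ∞)` as `t ↘ 0`. -/
  initial : ∀ ψ : ℝ → ℝ, IsTest ψ →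
    Tendsto (fun t => ∫ x in Ioi (0 : ℝ), u (t, x) * ψ x) (ae volume ⊓ 𝓝[>] 0)
      (𝓝 (∫ x in Ioi (0 : ℝ), u₀ x * ψ x))

end ThinFilm

end

open ThinFilm

/-! Let r(ζ) = ζ - 1 or r(ζ) = (ζ - 1)(ζ - 2), and w = r(D)u. Since r(D) intertwines 𝒜 with an
operator L = x⁻¹p(D) + x⁻²q(D), the function w solves ∂ₜw + Lw = 0 with initial value zero. Pairing
with w in (·,·)_α gives ½(w(t), w(t))_α = -∫₀ᵗ (Lw, w)_α ds, which is nonpositive by coercivity, so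
w = 0. Moreover 𝒜 itself factors through r(D); hence ∂ₜu = -𝒜u = 0, and u keeps its initial value 0.
It remains to justify this for distributional solutions.

All operators are moved to test functions. There D becomes E = `adjLog`, and the rule x⁻¹P(E) = P(E
- 1)x⁻¹ (`invMul_mul_aeval`) turns the intertwining and the factorization into polynomial identities
(`intertwines_aeval`). Products η(t)ψ(x) suffice as space-time tests, because they determine a
locally integrable function (`ae_eq_zero_of_pair_eq_zero`).

The energy identity is proved pointwise in x. By `IsEnergyChain.ae_eq_primitive`, w(t, x) = -∫₀ᵗ
Lw(s, x) ds for almost every (t, x). For fixed x this primitive is absolutely continuous in t, so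
its square can be differentiated; the result is integrated in x by Fubini (`ae_primitive_eq_zero`).
The density of (Lw, w)_α is integrable in (t, x) because the factors x⁻¹ and x⁻² produce exactly the
weights α + 1/2 and α + 1, in which w, …, D⁴w are square integrable.

Coercivity is given on test functions only. Integration by parts (`Quartic.integral_comb_mul`)
writes (Lw, w)_α as a quadratic form in w, Dw, D²w alone. Its sign therefore extends by
mollification and by cut-offs in log x (`NonnegOnTests.integral_nonneg`), and it applies to almost
every time slice of w.

In the variables v_j = D^j(x^(-β)w) the form of p(D) is diagonal, with coefficients 1, -p''(β)/2 and
p(β). An explicit weight is thus admissible as soon as p'' < 0 < p at α + 1/2 and q'' < 0 < q at α +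
1. -/

/-! ### Weak derivatives on an interval -/

namespace ThinFilm

/-- Smooth functions on the line with compact support in `U`. -/
def IsTestIn (U : Set ℝ) (η : ℝ → ℝ) : Prop :=
  ContDiff ℝ ∞ η ∧ HasCompactSupport η ∧ tsupport η ⊆ U

namespace IsTestIn

variable {U : Set ℝ} {η ζ : ℝ → ℝ}

theorem continuous (h : IsTestIn U η) : Continuous η := h.1.continuous

theorem differentiable (h : IsTestIn U η) : Differentiable ℝ η := h.1.differentiable (by simp)

theorem differentiate (h : IsTestIn U η) : IsTestIn U (deriv η) :=
  ⟨(contDiff_infty_iff_deriv.1 h.1).2, h.2.1.deriv, tsupport_deriv_subset.trans h.2.2⟩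

theorem of_tsupport_subset (h : IsTestIn U η) (hζ : ContDiff ℝ ∞ ζ) (hs : tsupport ζ ⊆ tsupport η) :
    IsTestIn U ζ :=
  ⟨hζ, h.2.1.of_isClosed_subset (isClosed_tsupport _) hs, hs.trans h.2.2⟩

theorem zero : IsTestIn U (0 : ℝ → ℝ) :=
  ⟨contDiff_const, HasCompactSupport.zero, by simp [tsupport]⟩

theorem add (h : IsTestIn U η) (h' : IsTestIn U ζ) : IsTestIn U (η + ζ) :=
  ⟨h.1.add h'.1, h.2.1.add h'.2.1, (tsupport_add η ζ).trans (union_subset h.2.2 h'.2.2)⟩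

theorem smul_left {a : ℝ → ℝ} (h : IsTestIn U η) (ha : ContDiff ℝ ∞ a) :
    IsTestIn U (fun x => a x * η x) :=
  h.of_tsupport_subset (ha.mul h.1) (tsupport_mul_subset_right)

theorem const_mul (c : ℝ) (h : IsTestIn U η) : IsTestIn U (fun x => c * η x) :=
  h.smul_left contDiff_const

theorem sub (h : IsTestIn U η) (h' : IsTestIn U ζ) : IsTestIn U (fun x => η x - ζ x) := by
  have := h.add (h'.const_mul (-1))
  convert this using 1
  ext x; simp [sub_eq_add_neg]

theorem integrable_mul {F : ℝ → ℝ} (h : IsTestIn U η) (hF : LocallyIntegrableOn F U) :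
    Integrable (fun x => F x * η x) := by
  have h1 : IntegrableOn (fun x => F x * η x) (tsupport η) :=
    (hF.integrableOn_compact_subset h.2.2 h.2.1).mul_continuousOn h.continuous.continuousOn h.2.1
  rwa [integrableOn_iff_integrable_of_support_subset] at h1
  intro x hx
  exact subset_tsupport _ (right_ne_zero_of_mul hx)

theorem setIntegral_eq {F : ℝ → ℝ} (h : IsTestIn U η) :
    ∫ x in U, F x * η x = ∫ x, F x * η x :=
  setIntegral_eq_integral_of_forall_compl_eq_zero fun x hx => by
    rw [image_eq_zero_of_notMem_tsupport fun h' => hx (h.2.2 h'), mul_zero]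

theorem exists_Icc (h : IsTestIn U η) (hU : OrdConnected U) {a : ℝ} (ha : a ∈ U) :
    ∃ c d, c ≤ a ∧ a ≤ d ∧ Icc c d ⊆ U ∧ tsupport η ⊆ Icc c d := by
  have hK : IsCompact (insert a (tsupport η)) := h.2.1.insert a
  have hne : (insert a (tsupport η)).Nonempty := insert_nonempty _ _
  have hKU : insert a (tsupport η) ⊆ U := insert_subset ha h.2.2
  refine ⟨sInf (insert a (tsupport η)), sSup (insert a (tsupport η)), csInf_le hK.bddBelow (mem_insert _ _),
    le_csSup hK.bddAbove (mem_insert _ _), hU.out (hKU (hK.sInf_mem hne)) (hKU (hK.sSup_mem hne)), ?_⟩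
  exact (subset_insert _ _).trans (subset_Icc_csInf_csSup hK.bddBelow hK.bddAbove)

end IsTestIn

theorem exists_isTestIn_integral_eq_one {U : Set ℝ} (hU : IsOpen U) {a : ℝ} (ha : a ∈ U) :
    ∃ θ, IsTestIn U θ ∧ ∫ x, θ x = 1 := by
  obtain ⟨ε, hε, hb⟩ := Metric.isOpen_iff.1 hU a ha
  let b : ContDiffBump a := ⟨ε / 4, ε / 2, by positivity, by linarith⟩
  refine ⟨b.normed volume, ⟨b.contDiff_normed, b.hasCompactSupport_normed, ?_⟩, b.integral_normed⟩
  rw [b.tsupport_normed_eq]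
  exact (Metric.closedBall_subset_ball (by simp [b]; linarith)).trans hb

/-- The primitive that starts to the left of the support vanishes before it and, because the mean is
zero, again beyond it. In between it may be nonzero on gaps of the support, so the convex hull of
the support has to lie in `U`. -/
theorem IsTestIn.exists_primitive {U : Set ℝ} {η : ℝ → ℝ} (h : IsTestIn U η) (hU : OrdConnected U)
    {a : ℝ} (ha : a ∈ U) (h0 : ∫ x, η x = 0) : ∃ Φ, IsTestIn U Φ ∧ deriv Φ = η := by
  obtain ⟨c, d, hca, had, hcd, hs⟩ := h.exists_Icc hU ha
  have hd : ∀ x, HasDerivAt (fun x => ∫ t in c..x, η t) (η x) x := fun x =>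
    intervalIntegral.integral_hasDerivAt_right (h.continuous.intervalIntegrable _ _)
      (h.continuous.stronglyMeasurableAtFilter _ _) h.continuous.continuousAt
  have hder : deriv (fun x => ∫ t in c..x, η t) = η := funext fun x => (hd x).deriv
  have hz : ∀ x, x ∉ Icc c d → η x = 0 := fun x hx =>
    image_eq_zero_of_notMem_tsupport fun h' => hx (hs h')
  have hsupp : Function.support (fun x => ∫ t in c..x, η t) ⊆ Icc c d := by
    intro x hx
    by_contra hx'
    apply hx
    beta_reduce
    simp only [mem_Icc, not_and_or, not_le] at hx'
    rcases hx' with hx' | hx'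
    · rw [intervalIntegral.integral_symm, intervalIntegral.integral_of_le hx'.le,
        ← integral_Ico_eq_integral_Ioc, setIntegral_eq_zero_of_forall_eq_zero, neg_zero]
      intro t ht
      exact hz t fun h' => absurd h'.1 (not_le.2 ht.2)
    · rw [intervalIntegral.integral_of_le (by linarith), ← integral_Icc_eq_integral_Ioc,
        setIntegral_eq_integral_of_forall_compl_eq_zero, h0]
      intro t ht
      exact hz t fun h' => ht ⟨h'.1, h'.2.trans hx'.le⟩
  have hts : tsupport (fun x => ∫ t in c..x, η t) ⊆ Icc c d := closure_minimal hsupp isClosed_Icc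
  refine ⟨_, ⟨?_, isCompact_Icc.of_isClosed_subset (isClosed_tsupport _) hts, hts.trans hcd⟩, hder⟩
  exact contDiff_infty_iff_deriv.2 ⟨fun x => (hd x).differentiableAt, hder.symm ▸ h.1⟩

/-- The lemma of du Bois-Reymond: for a fixed θ of mass one, g - (∫ g)θ has mean zero and so is the
derivative of a test function. Hence K pairs with g like the constant ∫ Kθ. -/
theorem exists_const_of_weak_deriv_zero {U : Set ℝ} (hU : IsOpen U) (hc : OrdConnected U) {K : ℝ → ℝ}
    (hK : LocallyIntegrableOn K U) {a : ℝ} (ha : a ∈ U)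
    (h : ∀ η, IsTestIn U η → ∫ x, K x * deriv η x = 0) :
    ∃ c, ∀ᵐ x, x ∈ U → K x = c := by
  obtain ⟨θ, hθ, hθ1⟩ := exists_isTestIn_integral_eq_one hU ha
  refine ⟨∫ x, K x * θ x, ?_⟩
  have hKc : LocallyIntegrableOn (fun x => K x - ∫ y, K y * θ y) U :=
    hK.sub (locallyIntegrableOn_const _)
  have := hU.ae_eq_zero_of_integral_contDiff_smul_eq_zero hKc ?_
  · filter_upwards [this] with x hx hxU
    linarith [hx hxU]
  intro g hg1 hg2 hg3
  have hg : IsTestIn U g := ⟨hg1, hg2, hg3⟩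
  have hgi : Integrable g := hg1.continuous.integrable_of_hasCompactSupport hg2
  have hθi : Integrable θ := hθ.1.continuous.integrable_of_hasCompactSupport hθ.2.1
  obtain ⟨Φ, hΦ, hΦd⟩ := (hg.sub (hθ.const_mul (∫ x, g x))).exists_primitive hc ha (by
    rw [integral_sub hgi (hθi.const_mul _), integral_const_mul, hθ1, mul_one, sub_self])
  have h1 := h Φ hΦ
  rw [hΦd] at h1
  have h2 : ∀ x, g x • (K x - ∫ y, K y * θ y) = K x * g x - (∫ y, K y * θ y) * g x := fun x => by
    simp only [smul_eq_mul]; ring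
  have h3 : ∀ x, K x * (g x - (∫ x, g x) * θ x) = K x * g x - (∫ x, g x) * (K x * θ x) :=
    fun x => by ring
  simp only [h2, h3] at h1 ⊢
  rw [integral_sub (hg.integrable_mul hK) (hgi.const_mul _), integral_const_mul]
  rw [integral_sub (hg.integrable_mul hK) ((hθ.integrable_mul hK).const_mul _), integral_const_mul] at h1
  linarith

theorem intervalIntegrable_of_mem {U : Set ℝ} (hc : OrdConnected U) {H : ℝ → ℝ}
    (hH : LocallyIntegrableOn H U) {a b : ℝ} (ha : a ∈ U) (hb : b ∈ U) :
    IntervalIntegrable H volume a b := by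
  rw [intervalIntegrable_iff]
  exact (hH.integrableOn_compact_subset (hc.uIcc_subset ha hb) isCompact_uIcc).mono_set
    uIoc_subset_uIcc

theorem continuousOn_primitive {U : Set ℝ} (hU : IsOpen U) (hc : OrdConnected U) {H : ℝ → ℝ}
    (hH : LocallyIntegrableOn H U) {a : ℝ} (ha : a ∈ U) :
    ContinuousOn (fun x => ∫ t in a..x, H t) U := by
  intro x hx
  obtain ⟨ε, hε, hb⟩ := Metric.isOpen_iff.1 hU x hx
  have h1 : x - ε / 2 ∈ U := hb (by simp [abs_of_pos hε, hε])
  have h2 : x + ε / 2 ∈ U := hb (by simp [abs_of_pos hε, hε])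
  have hle : x - ε / 2 ≤ x + ε / 2 := by linarith
  have h3 : ContinuousOn (fun y => ∫ t in (x - ε / 2)..y, H t) (uIcc (x - ε / 2) (x + ε / 2)) :=
    intervalIntegral.continuousOn_primitive_interval
      (hH.integrableOn_compact_subset (hc.uIcc_subset h1 h2) isCompact_uIcc)
  have hn : uIcc (x - ε / 2) (x + ε / 2) ∈ 𝓝 x := by
    rw [uIcc_of_le hle]; exact Icc_mem_nhds (by linarith) (by linarith)
  have h4 := (h3.continuousAt hn).const_add (∫ t in a..(x - ε / 2), H t)
  refine (h4.congr ?_).continuousWithinAt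
  filter_upwards [hU.mem_nhds hx] with y hy
  exact intervalIntegral.integral_add_adjacent_intervals
    (intervalIntegrable_of_mem hc hH ha h1) (intervalIntegrable_of_mem hc hH h1 hy)

/-- `H` is merely integrable, so this is integration by parts for absolutely continuous functions.
The constant `k` allows the primitive to be based at a point other than `a`. -/
theorem integral_primitive_mul_deriv {a b : ℝ} {H φ : ℝ → ℝ} (k : ℝ)
    (hH : IntervalIntegrable H volume a b) (hφ : ContDiff ℝ 1 φ) :
    ∫ x in a..b, (k + ∫ t in a..x, H t) * deriv φ x =
      (k + ∫ t in a..b, H t) * φ b - k * φ a - ∫ x in a..b, H x * φ x := by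
  have h1 : AbsolutelyContinuousOnInterval (fun x => k + ∫ t in a..x, H t) a b :=
    (LipschitzOnWith.absolutelyContinuousOnInterval (K := 0)
      ((LipschitzWith.const k).lipschitzOnWith)).add
      (hH.absolutelyContinuousOnInterval_intervalIntegral left_mem_uIcc)
  have h2 := h1.integral_mul_deriv_eq_deriv_mul
    (hφ.contDiffOn.absolutelyContinuousOnInterval (a := a) (b := b))
  rw [h2, intervalIntegral.integral_same, add_zero]
  congr 1
  apply intervalIntegral.integral_congr_ae
  filter_upwards [hH.ae_hasDerivAt_integral] with x hx hxm
  rw [((hx (uIoc_subset_uIcc hxm) a left_mem_uIcc).const_add k).deriv]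

theorem exists_const_add_primitive {U : Set ℝ} (hU : IsOpen U) (hc : OrdConnected U) {V H : ℝ → ℝ}
    (hV : LocallyIntegrableOn V U) (hH : LocallyIntegrableOn H U) {a : ℝ} (ha : a ∈ U)
    (h : ∀ η, IsTestIn U η → ∫ x, V x * deriv η x = -∫ x, H x * η x) :
    ∃ c, ∀ᵐ x, x ∈ U → V x = c + ∫ t in a..x, H t := by
  have hP : LocallyIntegrableOn (fun x => ∫ t in a..x, H t) U :=
    (continuousOn_primitive hU hc hH ha).locallyIntegrableOn hU.measurableSet
  obtain ⟨c, hcc⟩ := exists_const_of_weak_deriv_zero hU hc (hV.sub hP) ha (fun η hη => by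
    have h1 := h η hη
    have h2 : ∀ x, (V - fun x => ∫ t in a..x, H t) x * deriv η x =
      V x * deriv η x - (∫ t in a..x, H t) * deriv η x := fun x => by simp only [Pi.sub_apply]; ring
    simp only [h2]
    rw [integral_sub (hη.differentiate.integrable_mul hV) (hη.differentiate.integrable_mul hP), h1]
    obtain ⟨b, d, hba, had, hbd, hs⟩ := hη.exists_Icc hc ha
    -- The hull [b, d] of the support is enlarged slightly inside U, so that η vanishes at the new
    -- endpoints and no boundary terms arise.
    obtain ⟨ε, hε, hb1⟩ := Metric.isOpen_iff.1 hU b (hbd ⟨le_rfl, hba.trans had⟩)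
    have hb' : b - ε / 2 ∈ U := hb1 (by simp [abs_of_pos hε, hε])
    obtain ⟨δ, hδ, hd1⟩ := Metric.isOpen_iff.1 hU d (hbd ⟨hba.trans had, le_rfl⟩)
    have hd' : d + δ / 2 ∈ U := hd1 (by simp [abs_of_pos hδ, hδ])
    have hle : b - ε / 2 ≤ d + δ / 2 := by linarith
    have hI := intervalIntegrable_of_mem hc hH hb' hd'
    have key := integral_primitive_mul_deriv (∫ t in a..(b - ε / 2), H t) hI (hη.1.of_le (by simp))
    have hz : ∀ x, x ∉ Icc b d → η x = 0 := fun x hx =>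
      image_eq_zero_of_notMem_tsupport fun h' => hx (hs h')
    have hz' : ∀ x, x ∉ Icc b d → deriv η x = 0 := fun x hx =>
      image_eq_zero_of_notMem_tsupport fun h' => hx (hs (tsupport_deriv_subset h'))
    rw [hz (b - ε / 2) (fun h' => by linarith [h'.1]), hz (d + δ / 2) (fun h' => by linarith [h'.2]),
      mul_zero, mul_zero, sub_zero, zero_sub] at key
    have e1 : ∀ F : ℝ → ℝ, (∀ x, x ∉ Icc b d → F x = 0) →
        ∫ x in (b - ε / 2)..(d + δ / 2), F x = ∫ x, F x := fun F hF => by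
      rw [intervalIntegral.integral_of_le hle, ← integral_Icc_eq_integral_Ioc,
        setIntegral_eq_integral_of_forall_compl_eq_zero]
      intro x hx
      exact hF x fun h' => hx ⟨by linarith [h'.1], by linarith [h'.2]⟩
    rw [e1 (fun x => H x * η x) (fun x hx => by rw [hz x hx, mul_zero])] at key
    have e2 : ∫ x, (∫ t in a..x, H t) * deriv η x = -∫ x, H x * η x := by
      rw [← key, ← e1 (fun x => (∫ t in a..x, H t) * deriv η x) (fun x hx => by rw [hz' x hx, mul_zero])]
      apply intervalIntegral.integral_congr
      intro x hx
      rw [uIcc_of_le hle] at hx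
      simp only
      rw [intervalIntegral.integral_add_adjacent_intervals (intervalIntegrable_of_mem hc hH ha hb')
        (intervalIntegrable_of_mem hc hH hb' (hc.out hb' hd' hx))]
    rw [e2]; ring)
  refine ⟨c, ?_⟩
  filter_upwards [hcc] with x hx hxU
  have := hx hxU
  simp only [Pi.sub_apply] at this
  linarith

end ThinFilm

/-! ### Pairing with tensor products of test functions -/

namespace ThinFilm

/-- The pairing `∫∫ F(t, x) η(t) ψ(x) dx dt`. -/
noncomputable def pair (F : ℝ × ℝ → ℝ) (η ψ : ℝ → ℝ) : ℝ := ∫ p : ℝ × ℝ, F p * (η p.1 * ψ p.2)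

theorem ae_of_locally {X : Type*} [TopologicalSpace X] [SecondCountableTopology X]
    [MeasureSpace X] {U : Set X} {P : X → Prop}
    (h : ∀ p ∈ U, ∃ V ∈ 𝓝 p, ∀ᵐ q, q ∈ V → P q) : ∀ᵐ q, q ∈ U → P q := by
  suffices volume {p | p ∈ U ∧ ¬ P p} = 0 by
    rw [ae_iff]; simpa only [Classical.not_imp] using this
  refine measure_null_of_locally_null _ fun p hp => ?_
  obtain ⟨V, hV, h1⟩ := h p hp.1
  refine ⟨_, inter_mem self_mem_nhdsWithin (mem_nhdsWithin_of_mem_nhds hV), measure_mono_null ?_ h1⟩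
  exact fun q hq h2 => hq.1.2 (h2 hq.2)

section Pairing

variable {I J : Set ℝ} {F : ℝ × ℝ → ℝ} {η ψ : ℝ → ℝ}

theorem locallyIntegrableOn_swap (hF : LocallyIntegrableOn F (I ×ˢ J)) :
    LocallyIntegrableOn (F ∘ Prod.swap) (J ×ˢ I) := by
  intro p hp
  have h1 := hF p.swap ⟨hp.2, hp.1⟩
  obtain ⟨s, hs, h⟩ := h1
  refine ⟨Prod.swap ⁻¹' s, ?_, ?_⟩
  · have : Tendsto Prod.swap (𝓝[J ×ˢ I] p) (𝓝[I ×ˢ J] p.swap) :=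
      continuous_swap.continuousWithinAt.tendsto_nhdsWithin fun q hq => ⟨hq.2, hq.1⟩
    exact this hs
  · have hmp : MeasurePreserving (Prod.swap : ℝ × ℝ → ℝ × ℝ) volume volume :=
      Measure.measurePreserving_swap
    exact (hmp.integrableOn_comp_preimage MeasurableEquiv.prodComm.measurableEmbedding).2 h

theorem pair_swap : pair (F ∘ Prod.swap) η ψ = pair F ψ η := by
  unfold pair
  rw [Measure.volume_eq_prod, ← integral_prod_swap (f := fun p : ℝ × ℝ => F p * (ψ p.1 * η p.2))]
  refine integral_congr_ae (Eventually.of_forall fun p => ?_)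
  simp only [Function.comp, Prod.fst_swap, Prod.snd_swap]
  ring

theorem integrable_mul_snd_of_integrableOn {K : Set ℝ} (hK : MeasurableSet K)
    (hψ : IsTestIn J ψ) (hF : IntegrableOn F (K ×ˢ tsupport ψ)) :
    Integrable (fun p : ℝ × ℝ => F p * ψ p.2) ((volume.restrict K).prod volume) := by
  obtain ⟨C, hC⟩ := hψ.continuous.bounded_above_of_compact_support hψ.2.1
  have h1 : IntegrableOn (fun p : ℝ × ℝ => F p * ψ p.2) (K ×ˢ tsupport ψ) :=
    hF.mul_bdd (c := C) (hψ.continuous.comp continuous_snd).aestronglyMeasurable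
      (Eventually.of_forall fun p => hC p.2)
  have h2 : ((volume : Measure ℝ).restrict K).prod (volume : Measure ℝ) =
      (volume : Measure (ℝ × ℝ)).restrict (K ×ˢ univ) := by
    rw [Measure.volume_eq_prod, ← Measure.prod_restrict, Measure.restrict_univ]
  rw [h2]
  change IntegrableOn (fun p : ℝ × ℝ => F p * ψ p.2) (K ×ˢ univ)
  refine h1.of_forall_sdiff_eq_zero (hK.prod MeasurableSet.univ) fun p hp => ?_
  rw [image_eq_zero_of_notMem_tsupport (fun h => hp.2 ⟨hp.1.1, h⟩), mul_zero]

theorem integrable_mul_snd (hF : LocallyIntegrableOn F (I ×ˢ J)) {K : Set ℝ} (hK : IsCompact K)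
    (hKI : K ⊆ I) (hψ : IsTestIn J ψ) :
    Integrable (fun p : ℝ × ℝ => F p * ψ p.2) ((volume.restrict K).prod volume) :=
  integrable_mul_snd_of_integrableOn hK.measurableSet hψ
    (hF.integrableOn_compact_subset (prod_mono hKI hψ.2.2) (hK.prod hψ.2.1))

theorem integrable_pair (hF : LocallyIntegrableOn F (I ×ˢ J)) (hη : IsTestIn I η)
    (hψ : IsTestIn J ψ) : Integrable (fun p : ℝ × ℝ => F p * (η p.1 * ψ p.2)) := by
  have hc : IsCompact (tsupport η ×ˢ tsupport ψ) := hη.2.1.prod hψ.2.1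
  have h1 : IntegrableOn (fun p : ℝ × ℝ => F p * (η p.1 * ψ p.2)) (tsupport η ×ˢ tsupport ψ) :=
    (hF.integrableOn_compact_subset (prod_mono hη.2.2 hψ.2.2) hc).mul_continuousOn
      ((hη.continuous.comp continuous_fst).mul (hψ.continuous.comp continuous_snd)).continuousOn hc
  rwa [integrableOn_iff_integrable_of_support_subset] at h1
  intro p hp
  have := right_ne_zero_of_mul hp
  exact ⟨subset_tsupport _ (left_ne_zero_of_mul this), subset_tsupport _ (right_ne_zero_of_mul this)⟩

theorem pair_eq_integral (hF : LocallyIntegrableOn F (I ×ˢ J)) (hη : IsTestIn I η)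
    (hψ : IsTestIn J ψ) : pair F η ψ = ∫ t, (∫ x, F (t, x) * ψ x) * η t := by
  have h := integrable_pair hF hη hψ
  rw [Measure.volume_eq_prod] at h
  rw [pair, Measure.volume_eq_prod, integral_prod _ h]
  refine integral_congr_ae (Eventually.of_forall fun t => ?_)
  simp only
  rw [← integral_mul_const]
  refine integral_congr_ae (Eventually.of_forall fun x => ?_)
  simp only; ring

theorem locallyIntegrableOn_section (hI : IsOpen I) (hF : LocallyIntegrableOn F (I ×ˢ J))
    (hψ : IsTestIn J ψ) : LocallyIntegrableOn (fun t => ∫ x, F (t, x) * ψ x) I := by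
  rw [locallyIntegrableOn_iff hI.isLocallyClosed]
  exact fun K hKI hK => (integrable_mul_snd hF hK hKI hψ).integral_prod_left

theorem ae_integrable_section (hI : IsOpen I) (hF : LocallyIntegrableOn F (I ×ˢ J))
    (hψ : IsTestIn J ψ) : ∀ᵐ t, t ∈ I → Integrable fun x => F (t, x) * ψ x := by
  refine ae_of_locally fun t ht => ?_
  obtain ⟨K, hK, htK, hKI⟩ := exists_compact_subset hI ht
  refine ⟨K, mem_interior_iff_mem_nhds.1 htK, ?_⟩
  rw [← ae_restrict_iff' hK.measurableSet]
  exact (integrable_mul_snd hF hK hKI hψ).prod_right_ae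

/-- For fixed ψ the function t ↦ ∫ F(t, x)ψ(x) dx vanishes off a null set that depends on ψ. It is
integrated over [a, b] before ψ varies, so these null sets never have to be united; a second
one-variable argument then handles x. -/
theorem setIntegral_prod_eq_zero (hI : IsOpen I) (hJ : IsOpen J)
    (hF : LocallyIntegrableOn F (I ×ˢ J))
    (h : ∀ η ψ, IsTestIn I η → IsTestIn J ψ → pair F η ψ = 0) {a b c d : ℝ}
    (hab : Icc a b ⊆ I) (hcd : Icc c d ⊆ J) : ∫ p in Icc a b ×ˢ Icc c d, F p = 0 := by
  have hV : ∀ ψ, IsTestIn J ψ → ∀ᵐ t, t ∈ I → ∫ x, F (t, x) * ψ x = 0 := fun ψ hψ =>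
    hI.ae_eq_zero_of_integral_contDiff_smul_eq_zero (locallyIntegrableOn_section hI hF hψ)
      fun η h1 h2 h3 => by
        have := h η ψ ⟨h1, h2, h3⟩ hψ
        rw [pair_eq_integral hF ⟨h1, h2, h3⟩ hψ] at this
        simpa only [smul_eq_mul, mul_comm] using this
  have hbox : ∀ K ⊆ J, IsCompact K →
      Integrable F ((volume.restrict (Icc a b)).prod (volume.restrict K)) := fun K hKJ hK => by
    rw [Measure.prod_restrict]
    exact hF.integrableOn_compact_subset (prod_mono hab hKJ) (isCompact_Icc.prod hK)
  have hW : ∀ᵐ x, x ∈ J → ∫ t in Icc a b, F (t, x) = 0 := by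
    refine hJ.ae_eq_zero_of_integral_contDiff_smul_eq_zero ?_ fun ψ h1 h2 h3 => ?_
    · rw [locallyIntegrableOn_iff hJ.isLocallyClosed]
      exact fun K hKJ hK => (hbox K hKJ hK).integral_prod_right
    · have hψ : IsTestIn J ψ := ⟨h1, h2, h3⟩
      have hi := integrable_mul_snd hF isCompact_Icc hab hψ
      have h4 : ∀ x, ψ x • ∫ t in Icc a b, F (t, x) = ∫ t in Icc a b, F (t, x) * ψ x := fun x => by
        rw [integral_mul_const, smul_eq_mul, mul_comm]
      simp only [h4]
      rw [← integral_integral_swap hi, setIntegral_congr_ae measurableSet_Icc, integral_zero]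
      filter_upwards [hV ψ hψ] with t ht hti using ht (hab hti)
  have h5 := hbox _ hcd isCompact_Icc
  rw [Measure.volume_eq_prod, ← Measure.prod_restrict, integral_prod_symm _ h5,
    setIntegral_congr_ae measurableSet_Icc, integral_zero]
  filter_upwards [hW] with x hx hxi using hx (hcd hxi)

/-- Lebesgue differentiation: balls of the product metric are rectangles, over which the averages of
F vanish. This replaces a density argument for tensor products. -/
theorem ae_eq_zero_of_pair_eq_zero (hI : IsOpen I) (hJ : IsOpen J)
    (hF : LocallyIntegrableOn F (I ×ˢ J))
    (h : ∀ η ψ, IsTestIn I η → IsTestIn J ψ → pair F η ψ = 0) :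
    ∀ᵐ p, p ∈ I ×ˢ J → F p = 0 := by
  have hU : IsOpen (I ×ˢ J) := hI.prod hJ
  refine ae_of_locally fun p hp => ?_
  obtain ⟨ε, hε, hb⟩ := Metric.isOpen_iff.1 hU p hp
  have hK : Metric.closedBall p (ε / 2) ⊆ I ×ˢ J :=
    (Metric.closedBall_subset_ball (by linarith)).trans hb
  have hint : IntegrableOn F (Metric.closedBall p (ε / 2)) :=
    hF.integrableOn_compact_subset hK (isCompact_closedBall p _)
  refine ⟨_, Metric.ball_mem_nhds p (half_pos hε), ?_⟩
  -- The differentiation theorem wants a function that is locally integrable everywhere; cutting F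
  -- off to a ball does not affect averages over small balls around interior points.
  have hG := (hint.integrable_indicator Metric.isClosed_closedBall.measurableSet).locallyIntegrable
  have h1 := IsUnifLocDoublingMeasure.ae_tendsto_average volume hG 1
  filter_upwards [h1] with q hq hqb
  have h3 := hq (ι := ℕ) (l := atTop) (fun _ => q) (fun n => 1 / ((n : ℝ) + 1))
    (tendsto_nhdsWithin_iff.2 ⟨tendsto_one_div_add_atTop_nhds_zero_nat,
      Eventually.of_forall fun n => by simp only [mem_Ioi]; positivity⟩)
    (Eventually.of_forall fun n => Metric.mem_closedBall_self (by positivity))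
  rw [indicator_of_mem (Metric.ball_subset_closedBall hqb)] at h3
  refine tendsto_nhds_unique h3 (tendsto_const_nhds.congr' ?_)
  have h4 : ∀ᶠ n : ℕ in atTop, 1 / ((n : ℝ) + 1) < ε / 2 - dist q p :=
    tendsto_one_div_add_atTop_nhds_zero_nat.eventually_lt_const (by
      rw [Metric.mem_ball] at hqb; linarith)
  filter_upwards [h4] with n hn
  have h5 : Metric.closedBall q (1 / ((n : ℝ) + 1)) ⊆ Metric.closedBall p (ε / 2) :=
    Metric.closedBall_subset_closedBall' (by linarith)
  rw [setAverage_eq, setIntegral_congr_fun (g := F) Metric.isClosed_closedBall.measurableSet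
    fun r hr => indicator_of_mem (h5 hr) _]
  have h6 := h5.trans hK
  rw [← closedBall_prod_same, Real.closedBall_eq_Icc, Real.closedBall_eq_Icc] at h6 ⊢
  have hne : (0 : ℝ) ≤ 1 / ((n : ℝ) + 1) := by positivity
  rw [setIntegral_prod_eq_zero hI hJ hF h, smul_zero]
  · intro t ht
    exact (h6 (mk_mem_prod ht (right_mem_Icc.2 (by linarith)))).1
  · intro t ht
    exact (h6 (mk_mem_prod (right_mem_Icc.2 (by linarith)) ht)).2

end Pairing

end ThinFilm

/-! ### Primitives of functions of two variables -/

namespace ThinFilm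

section Primitive

variable {I J : Set ℝ} {F h v : ℝ × ℝ → ℝ} {a : ℝ}

theorem locallyIntegrableOn_prod_iff (hI : IsOpen I) (hJ : IsOpen J) :
    LocallyIntegrableOn F (I ×ˢ J) ↔ ∀ K L, K ⊆ I → L ⊆ J → IsCompact K → IsCompact L →
      IntegrableOn F (K ×ˢ L) := by
  rw [locallyIntegrableOn_iff (hI.prod hJ).isLocallyClosed]
  refine ⟨fun h K L hK hL hK' hL' => h _ (prod_mono hK hL) (hK'.prod hL'), fun h S hS hS' => ?_⟩
  refine (h (Prod.fst '' S) (Prod.snd '' S) ?_ ?_ (hS'.image continuous_fst)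
    (hS'.image continuous_snd)).mono_set fun p hp => ⟨mem_image_of_mem _ hp, mem_image_of_mem _ hp⟩
  · rintro _ ⟨p, hp, rfl⟩; exact (hS hp).1
  · rintro _ ⟨p, hp, rfl⟩; exact (hS hp).2

theorem locallyIntegrableOn_comp_snd (hI : IsOpen I) (hJ : IsOpen J) {c : ℝ → ℝ}
    (hc : LocallyIntegrableOn c J) : LocallyIntegrableOn (fun p : ℝ × ℝ => c p.2) (I ×ˢ J) := by
  rw [locallyIntegrableOn_prod_iff hI hJ]
  intro K L _ hL hK' hL'
  have : IsFiniteMeasure (volume.restrict K) := ⟨by simpa using hK'.measure_lt_top⟩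
  have := (hc.integrableOn_compact_subset hL hL').integrable.comp_snd (volume.restrict K)
  rwa [Measure.prod_restrict] at this

/-- The candidate is the time average c(x) = ∫ F(t, x)θ(t) dt against a θ of mass one; it pairs with
each ψ as F(t, ·) does for almost every t. -/
theorem exists_eq_comp_snd (hI : IsOpen I) (hJ : IsOpen J) (hF : LocallyIntegrableOn F (I ×ˢ J))
    (ha : a ∈ I)
    (hs : ∀ ψ, IsTestIn J ψ → ∃ c, ∀ᵐ t, t ∈ I → ∫ x, F (t, x) * ψ x = c) :
    ∃ c : ℝ → ℝ, LocallyIntegrableOn c J ∧ ∀ᵐ p, p ∈ I ×ˢ J → F p = c p.2 := by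
  obtain ⟨θ, hθ, hθ1⟩ := exists_isTestIn_integral_eq_one hI ha
  have hFs := locallyIntegrableOn_swap hF
  set c : ℝ → ℝ := fun x => ∫ t, F (t, x) * θ t with hcdef
  have hc : LocallyIntegrableOn c J := locallyIntegrableOn_section hJ hFs hθ
  have hc2 := locallyIntegrableOn_comp_snd hI hJ hc
  refine ⟨c, hc, ?_⟩
  have := ae_eq_zero_of_pair_eq_zero hI hJ (hF.sub hc2) fun η ψ hη hψ => ?_
  · filter_upwards [this] with p hp hpm
    have := hp hpm
    simp only [Pi.sub_apply] at this
    linarith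
  obtain ⟨k, hk⟩ := hs ψ hψ
  have hcψ : ∫ x, c x * ψ x = k := by
    have h1 := pair_eq_integral hFs hψ hθ
    rw [pair_swap, pair_eq_integral hF hθ hψ] at h1
    rw [hcdef]
    refine h1.symm.trans ?_
    rw [integral_congr_ae (g := fun t => k * θ t), integral_const_mul, hθ1, mul_one]
    filter_upwards [hk] with t ht
    by_cases hθt : θ t = 0
    · simp [hθt]
    · rw [ht (hθ.2.2 (subset_tsupport _ hθt))]
  rw [pair_eq_integral (hF.sub hc2) hη hψ, integral_congr_ae (g := fun _ => 0), integral_zero]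
  filter_upwards [hk, ae_integrable_section hI hF hψ] with t ht hint
  by_cases hηt : η t = 0
  · simp [hηt]
  · have htI := hη.2.2 (subset_tsupport _ hηt)
    simp only [Pi.sub_apply, sub_mul]
    rw [integral_sub (hint htI) (hψ.integrable_mul hc), ht htI, hcψ]
    ring

/-- The primitive is a partial integral of the three-variable function 1_{s ≤ t} h(s, x), so Fubini
gives joint measurability as well as integrability. -/
theorem integrableOn_primitive_Ioc {L : Set ℝ} {c d : ℝ}
    (hh : IntegrableOn h (Ioc c d ×ˢ L)) :
    IntegrableOn (fun p : ℝ × ℝ => ∫ s in c..p.1, h (s, p.2)) (Ioc c d ×ˢ L) := by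
  have h0 : Integrable h ((volume.restrict (Ioc c d)).prod (volume.restrict L)) := by
    rwa [Measure.prod_restrict]
  have h1 := (h0.swap.comp_snd (volume.restrict (Ioc c d)))
  have h2 := (measurePreserving_prodAssoc (volume.restrict (Ioc c d)) (volume.restrict L)
    (volume.restrict (Ioc c d))).integrable_comp_of_integrable h1
  have hms : MeasurableSet {q : (ℝ × ℝ) × ℝ | q.2 ≤ q.1.1} :=
    measurableSet_le measurable_snd (measurable_fst.comp measurable_fst)
  have h3 := (h2.indicator hms).integral_prod_left
  rw [Measure.prod_restrict] at h3
  refine h3.congr ?_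
  have hm : ∀ᵐ p ∂(volume : Measure (ℝ × ℝ)).restrict (Ioc c d ×ˢ L), p.1 ∈ Ioc c d := by
    rw [Measure.volume_eq_prod, ← Measure.prod_restrict]
    exact Measure.quasiMeasurePreserving_fst.ae (ae_restrict_mem measurableSet_Ioc)
  filter_upwards [hm] with p hp
  rw [intervalIntegral.integral_of_le hp.1.le]
  have h4 : ∀ s, {q : (ℝ × ℝ) × ℝ | q.2 ≤ q.1.1}.indicator
      (((fun z : ℝ × (ℝ × ℝ) => (h ∘ Prod.swap) z.2)) ∘ MeasurableEquiv.prodAssoc) (p, s) =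
      (Iic p.1).indicator (fun s => h (s, p.2)) s := fun s => by
    simp only [indicator, mem_ofPred_eq, mem_Iic]
    rfl
  simp only [h4]
  rw [setIntegral_indicator measurableSet_Iic, Ioc_inter_Iic, min_eq_right hp.2]

theorem ae_snd_of_ae {P : ℝ → Prop} {K L : Set ℝ} (h : ∀ᵐ x ∂volume.restrict L, P x) :
    ∀ᵐ p ∂(volume : Measure (ℝ × ℝ)).restrict (K ×ˢ L), P p.2 := by
  rw [Measure.volume_eq_prod, ← Measure.prod_restrict]
  exact Measure.quasiMeasurePreserving_snd.ae h

/-- The base point `a` may be a boundary point of I, as the initial time is; integrability of h up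
to `a` is therefore the separate hypothesis `hb`. Near a given time, ∫ₐᵗ splits at some c into a
function of x alone and a primitive over a short interval. -/
theorem locallyIntegrableOn_primitive (hI : IsOpen I) (hJ : IsOpen J)
    (hh : LocallyIntegrableOn h (I ×ˢ J))
    (hb : ∀ t ∈ I, ∀ L ⊆ J, IsCompact L → IntegrableOn h (uIoc a t ×ˢ L)) :
    LocallyIntegrableOn (fun p : ℝ × ℝ => ∫ s in a..p.1, h (s, p.2)) (I ×ˢ J) := by
  intro p hp
  obtain ⟨ε, hε, hbI⟩ := Metric.isOpen_iff.1 hI p.1 hp.1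
  have hsub : Icc (p.1 - ε / 2) (p.1 + ε / 2) ⊆ I := by
    rw [← Real.closedBall_eq_Icc]
    exact (Metric.closedBall_subset_ball (by linarith)).trans hbI
  obtain ⟨L, hL, hpL, hLJ⟩ := exists_compact_subset hJ hp.2
  set c := p.1 - ε / 2
  set d := p.1 + ε / 2
  have hcd : c < p.1 ∧ p.1 < d := ⟨by simp only [c]; linarith, by simp only [d]; linarith⟩
  have hcI : c ∈ I := hsub ⟨le_rfl, by linarith [hcd.1, hcd.2]⟩
  refine ⟨Ioc c d ×ˢ L, mem_nhdsWithin_of_mem_nhds ?_, ?_⟩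
  · exact prod_mem_nhds (Ioc_mem_nhds hcd.1 hcd.2) (mem_interior_iff_mem_nhds.1 hpL)
  have h1 : IntegrableOn h (Ioc c d ×ˢ L) :=
    (hh.integrableOn_compact_subset (prod_mono hsub hLJ) (isCompact_Icc.prod hL)).mono_set
      (prod_mono Ioc_subset_Icc_self le_rfl)
  have h2 := hb c hcI L hLJ hL
  have h1' : Integrable h ((volume.restrict (Ioc c d)).prod (volume.restrict L)) := by
    rwa [Measure.prod_restrict]
  have h2' : Integrable h ((volume.restrict (uIoc a c)).prod (volume.restrict L)) := by
    rwa [Measure.prod_restrict]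
  have h3 : IntegrableOn (fun x => ∫ s in a..c, h (s, x)) L := by
    simp only [intervalIntegral.intervalIntegral_eq_integral_uIoc]
    exact Integrable.smul (if a ≤ c then (1 : ℝ) else -1) h2'.integral_prod_right
  have h4 := h3.integrable.comp_snd (volume.restrict (Ioc c d))
  rw [Measure.prod_restrict] at h4
  refine (h4.add (integrableOn_primitive_Ioc h1)).congr ?_
  have hm : ∀ᵐ p ∂(volume : Measure (ℝ × ℝ)).restrict (Ioc c d ×ˢ L), p.1 ∈ Ioc c d := by
    rw [Measure.volume_eq_prod, ← Measure.prod_restrict]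
    exact Measure.quasiMeasurePreserving_fst.ae (ae_restrict_mem measurableSet_Ioc)
  filter_upwards [hm, ae_snd_of_ae h1'.prod_left_ae, ae_snd_of_ae h2'.prod_left_ae] with q hq hq1 hq2
  simp only [Pi.add_apply]
  refine intervalIntegral.integral_add_adjacent_intervals (intervalIntegrable_iff.2 hq2) ?_
  rw [intervalIntegrable_iff_integrableOn_Ioc_of_le hq.1.le]
  exact IntegrableOn.mono_set hq1 (Ioc_subset_Ioc_right hq.2)

theorem integral_primitive_mul (hb : ∀ t ∈ I, ∀ L ⊆ J, IsCompact L → IntegrableOn h (uIoc a t ×ˢ L))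
    {ψ : ℝ → ℝ} (hψ : IsTestIn J ψ) {t : ℝ} (ht : t ∈ I) :
    ∫ x, (∫ s in a..t, h (s, x)) * ψ x = ∫ s in a..t, ∫ x, h (s, x) * ψ x := by
  have h1 := integrable_mul_snd_of_integrableOn measurableSet_uIoc hψ (hb t ht _ hψ.2.2 hψ.2.1)
  simp only [intervalIntegral.intervalIntegral_eq_integral_uIoc, smul_eq_mul]
  rw [integral_integral_swap h1, ← integral_const_mul]
  refine integral_congr_ae (Eventually.of_forall fun x => ?_)
  simp only [integral_mul_const]; ring

theorem intervalIntegrable_section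
    (hb : ∀ t ∈ I, ∀ L ⊆ J, IsCompact L → IntegrableOn h (uIoc a t ×ˢ L))
    {ψ : ℝ → ℝ} (hψ : IsTestIn J ψ) {t : ℝ} (ht : t ∈ I) :
    IntervalIntegrable (fun s => ∫ x, h (s, x) * ψ x) volume a t := by
  rw [intervalIntegrable_iff]
  exact (integrable_mul_snd_of_integrableOn measurableSet_uIoc hψ
    (hb t ht _ hψ.2.2 hψ.2.1)).integral_prod_left

theorem exists_section_eq (hI : IsOpen I) (hIc : OrdConnected I)
    (hv : LocallyIntegrableOn v (I ×ˢ J)) (hh : LocallyIntegrableOn h (I ×ˢ J))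
    (hb : ∀ t ∈ I, ∀ L ⊆ J, IsCompact L → IntegrableOn h (uIoc a t ×ˢ L))
    (hvh : ∀ η ψ, IsTestIn I η → IsTestIn J ψ → pair v (deriv η) ψ = -pair h η ψ)
    {ψ : ℝ → ℝ} (hψ : IsTestIn J ψ) :
    ∃ c, ∀ᵐ t, t ∈ I → ∫ x, v (t, x) * ψ x = c + ∫ s in a..t, ∫ x, h (s, x) * ψ x := by
  rcases I.eq_empty_or_nonempty with rfl | ⟨b, hbI⟩
  · simp
  obtain ⟨c, hc⟩ := exists_const_add_primitive hI hIc (locallyIntegrableOn_section hI hv hψ)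
    (locallyIntegrableOn_section hI hh hψ) hbI (fun η hη => by
      have := hvh η ψ hη hψ
      rwa [pair_eq_integral hv hη.differentiate hψ, pair_eq_integral hh hη hψ] at this)
  -- The one-variable lemma needs a base point b inside I; the constant is corrected for moving it
  -- to `a`.
  refine ⟨c - ∫ s in a..b, ∫ x, h (s, x) * ψ x, ?_⟩
  filter_upwards [hc] with t ht htI
  have hb1 := intervalIntegrable_section hb hψ hbI
  rw [ht htI, ← intervalIntegral.integral_add_adjacent_intervals hb1
    (hb1.symm.trans (intervalIntegrable_section hb hψ htI))]
  ring

/-- For every ψ the pairing of v minus the primitive is constant along I, so the difference depends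
on the second variable only. The use is with time and space exchanged, to obtain absolutely
continuous slices in x. -/
theorem exists_eq_add_primitive (hI : IsOpen I) (hIc : OrdConnected I) (hJ : IsOpen J)
    (hv : LocallyIntegrableOn v (I ×ˢ J)) (hh : LocallyIntegrableOn h (I ×ˢ J))
    (hb : ∀ t ∈ I, ∀ L ⊆ J, IsCompact L → IntegrableOn h (uIoc a t ×ˢ L))
    (hvh : ∀ η ψ, IsTestIn I η → IsTestIn J ψ → pair v (deriv η) ψ = -pair h η ψ) :
    ∃ c : ℝ → ℝ, LocallyIntegrableOn c J ∧
      ∀ᵐ p, p ∈ I ×ˢ J → v p = c p.2 + ∫ s in a..p.1, h (s, p.2) := by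
  rcases I.eq_empty_or_nonempty with rfl | ⟨b, hbI⟩
  · exact ⟨fun _ => 0, locallyIntegrableOn_const _, by simp⟩
  have hP := locallyIntegrableOn_primitive hI hJ hh hb
  obtain ⟨c, hc, hcp⟩ := exists_eq_comp_snd hI hJ (hv.sub hP) hbI fun ψ hψ => by
    obtain ⟨k, hk⟩ := exists_section_eq hI hIc hv hh hb hvh hψ
    refine ⟨k, ?_⟩
    filter_upwards [hk, ae_integrable_section hI hv hψ, ae_integrable_section hI hP hψ]
      with t ht h1 h2 htI
    simp only [Pi.sub_apply, sub_mul]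
    rw [integral_sub (h1 htI) (h2 htI), ht htI, integral_primitive_mul hb hψ htI]
    ring
  refine ⟨c, hc, ?_⟩
  filter_upwards [hcp] with p hp hpm
  have := hp hpm
  simp only [Pi.sub_apply] at this
  linarith

/-- Essential one-sided limits are unique, since a null set contains no interval to the right of a.
-/
instance neBot_ae_inf_nhdsGT (a : ℝ) : (ae (volume : Measure ℝ) ⊓ 𝓝[>] a).NeBot := by
  refine inf_neBot_iff.2 fun s hs s' hs' => ?_
  obtain ⟨b, hb, hbs⟩ := mem_nhdsGT_iff_exists_Ioo_subset.1 hs'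
  by_contra hne
  have h1 : Ioo a b ⊆ sᶜ := fun t ht hts => hne ⟨t, hts, hbs ht⟩
  have h2 := measure_mono_null h1 (mem_ae_iff.1 hs)
  rw [Real.volume_Ioo, ENNReal.ofReal_eq_zero] at h2
  linarith [mem_Ioi.1 hb]

/-- For each ψ the constant of integration is the essential limit of the pairing at time zero,
because the primitive based at 0 tends to 0. Hence all these constants vanish. -/
theorem ae_eq_primitive (hI : IsOpen I) (hIc : OrdConnected I) (hJ : IsOpen J) (hI0 : I ∈ 𝓝[>] (0 : ℝ))
    (hv : LocallyIntegrableOn v (I ×ˢ J)) (hh : LocallyIntegrableOn h (I ×ˢ J))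
    (hb : ∀ t ∈ I, ∀ L ⊆ J, IsCompact L → IntegrableOn h (uIoc 0 t ×ˢ L))
    (hvh : ∀ η ψ, IsTestIn I η → IsTestIn J ψ → pair v (deriv η) ψ = -pair h η ψ)
    (hv0 : ∀ ψ, IsTestIn J ψ →
      Tendsto (fun t => ∫ x, v (t, x) * ψ x) (ae volume ⊓ 𝓝[>] 0) (𝓝 0)) :
    ∀ᵐ p, p ∈ I ×ˢ J → v p = ∫ s in (0 : ℝ)..p.1, h (s, p.2) := by
  have hP := locallyIntegrableOn_primitive hI hJ hh hb
  refine (ae_eq_zero_of_pair_eq_zero hI hJ (hv.sub hP) fun η ψ hη hψ => ?_).mono fun p hp hpm => by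
    have := hp hpm
    simp only [Pi.sub_apply] at this
    linarith
  obtain ⟨k, hk⟩ := exists_section_eq hI hIc hv hh hb hvh hψ
  obtain ⟨b, hbI⟩ : ∃ b, b ∈ I ∩ Ioi 0 :=
    (𝓝[>] (0 : ℝ)).nonempty_of_mem (inter_mem hI0 self_mem_nhdsWithin)
  have hk0 : k = 0 := by
    have h1 : Tendsto (fun t => ∫ s in (0 : ℝ)..t, ∫ x, h (s, x) * ψ x) (ae volume ⊓ 𝓝[>] 0) (𝓝 0) := by
      have h2 := intervalIntegral.continuousOn_primitive_interval
        ((intervalIntegrable_iff' (by finiteness)).1 (intervalIntegrable_section hb hψ hbI.1)) 0 left_mem_uIcc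
      rw [ContinuousWithinAt, intervalIntegral.integral_same] at h2
      refine h2.mono_left (inf_le_right.trans ?_)
      rw [uIcc_of_le (le_of_lt hbI.2)]
      exact nhdsWithin_le_of_mem (Icc_mem_nhdsGT hbI.2)
    have h3 : Tendsto (fun t => k + ∫ s in (0 : ℝ)..t, ∫ x, h (s, x) * ψ x)
        (ae volume ⊓ 𝓝[>] 0) (𝓝 0) := by
      refine (hv0 ψ hψ).congr' ?_
      filter_upwards [mem_inf_of_left hk, mem_inf_of_right hI0] with t ht htI using ht htI
    have := tendsto_nhds_unique h3 (h1.const_add k)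
    linarith
  rw [pair_eq_integral (hv.sub hP) hη hψ, integral_congr_ae (g := fun _ => 0), integral_zero]
  filter_upwards [hk, ae_integrable_section hI hv hψ, ae_integrable_section hI hP hψ] with t ht h1 h2
  by_cases hηt : η t = 0
  · simp [hηt]
  · have htI := hη.2.2 (subset_tsupport _ hηt)
    simp only [Pi.sub_apply, sub_mul]
    rw [integral_sub (h1 htI) (h2 htI), ht htI, integral_primitive_mul hb hψ htI, hk0]
    ring

end Primitive

end ThinFilm

/-! ### Logarithmic primitives and quadratic forms on the half line -/

namespace ThinFilm

/-- `D f = f'` on `(0, ∞)`, in the sense that `f` is a locally absolutely continuous primitive. -/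
def IsLogPrim (f f' : ℝ → ℝ) : Prop :=
  LocallyIntegrableOn (fun x => f' x / x) (Ioi 0) ∧
    ∀ a > 0, ∀ b > 0, f b - f a = ∫ x in a..b, f' x / x

namespace IsLogPrim

variable {f f' g g' : ℝ → ℝ}

theorem intervalIntegrable (h : IsLogPrim f f') {a b : ℝ} (ha : 0 < a) (hb : 0 < b) :
    IntervalIntegrable (fun x => f' x / x) volume a b :=
  intervalIntegrable_of_mem ordConnected_Ioi h.1 ha hb

theorem uIcc_subset {a b : ℝ} (ha : 0 < a) (hb : 0 < b) : uIcc a b ⊆ Ioi 0 :=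
  ordConnected_Ioi.uIcc_subset ha hb

theorem eqOn (h : IsLogPrim f f') {a : ℝ} (ha : 0 < a) :
    EqOn f (fun x => f a + ∫ t in a..x, f' t / t) (Ioi 0) := fun x hx => by
  simp only [← h.2 a ha x hx]; ring

theorem add_integral (h : IsLogPrim f f') {a x : ℝ} (ha : 0 < a) (hx : 0 < x) :
    f a + ∫ t in a..x, f' t / t = f x := (h.eqOn ha hx).symm

theorem continuousOn (h : IsLogPrim f f') : ContinuousOn f (Ioi 0) :=
  ((continuousOn_primitive isOpen_Ioi ordConnected_Ioi h.1 (mem_Ioi.2 one_pos)).const_add _).congr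
    (h.eqOn one_pos)

theorem absolutelyContinuousOnInterval (h : IsLogPrim f f') {a b : ℝ} (ha : 0 < a) (hb : 0 < b) :
    AbsolutelyContinuousOnInterval (fun x => f a + ∫ t in a..x, f' t / t) a b :=
  (LipschitzOnWith.absolutelyContinuousOnInterval (K := 0)
    ((LipschitzWith.const _).lipschitzOnWith)).add
    ((h.intervalIntegrable ha hb).absolutelyContinuousOnInterval_intervalIntegral left_mem_uIcc)

theorem ae_deriv (h : IsLogPrim f f') {a b : ℝ} (ha : 0 < a) (hb : 0 < b) :
    ∀ᵐ x, x ∈ uIcc a b → deriv (fun x => f a + ∫ t in a..x, f' t / t) x = f' x / x := by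
  filter_upwards [(h.intervalIntegrable ha hb).ae_hasDerivAt_integral] with x hx hxm
  exact ((hx hxm a left_mem_uIcc).const_add _).deriv

theorem mul (hf : IsLogPrim f f') (hg : IsLogPrim g g') :
    IsLogPrim (fun x => f x * g x) (fun x => f' x * g x + f x * g' x) := by
  refine ⟨?_, fun a ha b hb => ?_⟩
  · have h1 := hf.1.mul_continuousOn hg.continuousOn isOpen_Ioi.isLocallyClosed
    have h2 := hg.1.continuousOn_mul hf.continuousOn isOpen_Ioi.isLocallyClosed
    refine (h1.add h2).congr (Eventually.of_forall fun x => ?_)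
    simp only [Pi.add_apply]; ring
  · have h1 := (hf.absolutelyContinuousOnInterval ha hb).integral_deriv_mul_eq_sub
      (hg.absolutelyContinuousOnInterval ha hb)
    simp only [intervalIntegral.integral_same, add_zero] at h1
    rw [hf.add_integral ha hb, hg.add_integral ha hb] at h1
    rw [← h1]
    refine intervalIntegral.integral_congr_ae ?_
    filter_upwards [hf.ae_deriv ha hb, hg.ae_deriv ha hb] with x hx1 hx2 hxm
    have hxm' := uIoc_subset_uIcc hxm
    rw [hx1 hxm', hx2 hxm', hf.add_integral ha (uIcc_subset ha hb hxm'),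
      hg.add_integral ha (uIcc_subset ha hb hxm')]
    ring

theorem add (hf : IsLogPrim f f') (hg : IsLogPrim g g') :
    IsLogPrim (fun x => f x + g x) (fun x => f' x + g' x) := by
  refine ⟨(hf.1.add hg.1).congr (Eventually.of_forall fun x => ?_), fun a ha b hb => ?_⟩
  · simp only [Pi.add_apply]; ring
  · simp only [add_div]
    rw [intervalIntegral.integral_add (hf.intervalIntegrable ha hb) (hg.intervalIntegrable ha hb),
      ← hf.2 a ha b hb, ← hg.2 a ha b hb]
    ring

theorem of_hasDerivAt (hf : ∀ x > 0, HasDerivAt f (f' x / x) x) (hf' : ContinuousOn f' (Ioi 0)) :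
    IsLogPrim f f' := by
  have hc : ContinuousOn (fun x => f' x / x) (Ioi 0) :=
    hf'.div continuousOn_id fun x hx => (ne_of_gt hx)
  refine ⟨hc.locallyIntegrableOn measurableSet_Ioi, fun a ha b hb => ?_⟩
  exact (intervalIntegral.integral_eq_sub_of_hasDerivAt (fun x hx => hf x (uIcc_subset ha hb hx))
    (hc.mono (uIcc_subset ha hb)).intervalIntegrable).symm

theorem hasDerivAt (hf : IsLogPrim f f') (hf' : ContinuousOn f' (Ioi 0)) {x : ℝ} (hx : 0 < x) :
    HasDerivAt f (f' x / x) x := by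
  have hc : ContinuousOn (fun x => f' x / x) (Ioi 0) :=
    hf'.div continuousOn_id fun x hx => (ne_of_gt hx)
  have h1 : HasDerivAt (fun y => f 1 + ∫ t in (1 : ℝ)..y, f' t / t) (f' x / x) x :=
    (intervalIntegral.integral_hasDerivAt_right (hf.intervalIntegrable one_pos hx)
      (hc.stronglyMeasurableAtFilter isOpen_Ioi x hx) (hc.continuousAt (Ioi_mem_nhds hx))).const_add _
  refine h1.congr_of_eventuallyEq ?_
  filter_upwards [Ioi_mem_nhds hx] with y hy using hf.eqOn one_pos hy

theorem const_mul (c : ℝ) (hf : IsLogPrim f f') :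
    IsLogPrim (fun x => c * f x) (fun x => c * f' x) := by
  have h : IsLogPrim (fun _ => c) (fun _ => 0) :=
    of_hasDerivAt (fun x _ => by simpa using hasDerivAt_const x c) continuousOn_const
  have := h.mul hf
  simpa using this

theorem rpow_mul (β : ℝ) (hf : IsLogPrim f f') :
    IsLogPrim (fun x => x ^ (-β) * f x) (fun x => x ^ (-β) * (f' x - β * f x)) := by
  have h : IsLogPrim (fun x => x ^ (-β)) (fun x => -β * x ^ (-β)) := by
    refine of_hasDerivAt (fun x hx => ?_) ?_
    · have := Real.hasDerivAt_rpow_const (x := x) (p := -β) (Or.inl hx.ne')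
      rwa [Real.rpow_sub_one hx.ne', ← mul_div_assoc] at this
    · exact continuousOn_const.mul
        (continuousOn_id.rpow_const fun x hx => Or.inl (ne_of_gt (mem_Ioi.1 hx)))
  have := h.mul hf
  convert this using 2
  ring

/-- Integrability of Df with respect to dx/x gives f a limit at infinity, and a nonzero limit is
excluded because f itself is integrable with respect to dx/x while 1/x is not integrable there. -/
theorem eq_zero_of_integrable_atTop (hf : IsLogPrim f f')
    (h1 : IntegrableOn (fun x => f x / x) (Ioi 0)) (h2 : IntegrableOn (fun x => f' x / x) (Ioi 0)) :
    Tendsto f atTop (𝓝 0) := by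
  have h3 := intervalIntegral_tendsto_integral_Ioi 1 (h2.mono_set (Ioi_subset_Ioi zero_le_one))
    tendsto_id
  have h4 : Tendsto f atTop (𝓝 (f 1 + ∫ x in Ioi 1, f' x / x)) := by
    refine (h3.const_add (f 1)).congr' ?_
    filter_upwards [eventually_gt_atTop 0] with x hx using (hf.eqOn one_pos hx).symm
  set l := f 1 + ∫ x in Ioi 1, f' x / x
  suffices l = 0 by rwa [this] at h4
  by_contra hl
  have hl' : 0 < |l| := abs_pos.2 hl
  have h5 : ∀ᶠ x in atTop, |l| / 2 < |f x| := h4.abs.eventually_const_lt (by linarith)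
  obtain ⟨b, hb⟩ := eventually_atTop.1 h5
  refine not_integrableOn_Ioi_inv (a := max b 1) ?_
  have h6 : IntegrableOn (fun x => f x / x) (Ioi (max b 1)) :=
    h1.mono_set (Ioi_subset_Ioi (by positivity))
  refine (h6.norm.const_mul (2 / |l|)).mono' measurable_inv.aestronglyMeasurable ?_
  filter_upwards [ae_restrict_mem measurableSet_Ioi] with x hx
  have hx1 : 0 < x := lt_of_lt_of_le one_pos ((le_max_right b 1).trans (le_of_lt hx))
  have hx2 := hb x ((le_max_left b 1).trans (le_of_lt hx))
  rw [Real.norm_eq_abs, Real.norm_eq_abs, abs_div, abs_inv, abs_of_pos hx1, ← mul_div_assoc,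
    inv_eq_one_div]
  gcongr
  rw [div_mul_eq_mul_div, le_div_iff₀ hl']
  linarith

theorem eq_zero_of_integrable_zero (hf : IsLogPrim f f')
    (h1 : IntegrableOn (fun x => f x / x) (Ioi 0)) (h2 : IntegrableOn (fun x => f' x / x) (Ioi 0)) :
    Tendsto f (𝓝[>] 0) (𝓝 0) := by
  have h2' : IntegrableOn (fun x => f' x / x) (uIcc 0 1) := by
    rw [uIcc_of_le zero_le_one, integrableOn_Icc_iff_integrableOn_Ioc]
    exact h2.mono_set Ioc_subset_Ioi_self
  have h3 := intervalIntegral.continuousOn_primitive_interval_left h2' 0 left_mem_uIcc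
  have h4 : Tendsto f (𝓝[>] 0) (𝓝 (f 1 - ∫ x in (0 : ℝ)..1, f' x / x)) := by
    refine Tendsto.congr' ?_ ((h3.tendsto.mono_left ?_).const_sub (f 1))
    · filter_upwards [self_mem_nhdsWithin] with x hx
      rw [← hf.2 x hx 1 one_pos]; ring
    · rw [uIcc_of_le zero_le_one]
      exact nhdsWithin_le_of_mem (Icc_mem_nhdsGT one_pos)
  set l := f 1 - ∫ x in (0 : ℝ)..1, f' x / x
  suffices l = 0 by rwa [this] at h4
  by_contra hl
  have hl' : 0 < |l| := abs_pos.2 hl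
  have h5 : ∀ᶠ x in 𝓝[>] 0, |l| / 2 < |f x| := h4.abs.eventually_const_lt (by linarith)
  obtain ⟨b, hb0, hb⟩ := mem_nhdsGT_iff_exists_Ioc_subset.1 h5
  rw [mem_Ioi] at hb0
  have h7 : ¬ IntervalIntegrable (fun x : ℝ => x⁻¹) volume 0 b := by
    rw [intervalIntegrable_inv_iff]
    simp [hb0.ne, hb0.le]
  refine h7 ?_
  rw [intervalIntegrable_iff_integrableOn_Ioc_of_le hb0.le]
  have h6 : IntegrableOn (fun x => f x / x) (Ioc 0 b) := h1.mono_set Ioc_subset_Ioi_self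
  refine (h6.norm.const_mul (2 / |l|)).mono' measurable_inv.aestronglyMeasurable ?_
  filter_upwards [ae_restrict_mem measurableSet_Ioc] with x hx
  have hx1 : 0 < x := hx.1
  have hx2 : |l| / 2 < |f x| := hb hx
  rw [Real.norm_eq_abs, Real.norm_eq_abs, abs_div, abs_inv, abs_of_pos hx1, ← mul_div_assoc,
    inv_eq_one_div]
  gcongr
  rw [div_mul_eq_mul_div, le_div_iff₀ hl']
  linarith

theorem integral_eq_zero (hf : IsLogPrim f f')
    (h1 : IntegrableOn (fun x => f x / x) (Ioi 0)) (h2 : IntegrableOn (fun x => f' x / x) (Ioi 0)) :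
    ∫ x in Ioi 0, f' x / x = 0 := by
  have h3 := intervalIntegral_tendsto_integral_Ioi 1 (h2.mono_set (Ioi_subset_Ioi zero_le_one))
    tendsto_id
  have h4 : ∫ x in Ioi 1, f' x / x = - f 1 := by
    refine tendsto_nhds_unique h3 ?_
    have := (hf.eq_zero_of_integrable_atTop h1 h2).sub_const (f 1)
    rw [zero_sub] at this
    refine this.congr' ?_
    filter_upwards [eventually_gt_atTop 0] with x hx using hf.2 1 one_pos x hx
  have h2' : IntegrableOn (fun x => f' x / x) (uIcc 0 1) := by
    rw [uIcc_of_le zero_le_one, integrableOn_Icc_iff_integrableOn_Ioc]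
    exact h2.mono_set Ioc_subset_Ioi_self
  have h5 := intervalIntegral.continuousOn_primitive_interval_left h2' 0 left_mem_uIcc
  have h6 : ∫ x in (0 : ℝ)..1, f' x / x = f 1 := by
    have hle : 𝓝[>] (0 : ℝ) ≤ 𝓝[uIcc 0 1] 0 := by
      rw [uIcc_of_le zero_le_one]
      exact nhdsWithin_le_of_mem (Icc_mem_nhdsGT one_pos)
    refine tendsto_nhds_unique (h5.tendsto.mono_left hle) ?_
    have := (hf.eq_zero_of_integrable_zero h1 h2).const_sub (f 1)
    rw [sub_zero] at this
    refine this.congr' ?_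
    filter_upwards [self_mem_nhdsWithin] with x hx using hf.2 x hx 1 one_pos
  rw [intervalIntegral.integral_of_le zero_le_one] at h6
  rw [← Ioc_union_Ioi_eq_Ioi zero_le_one, setIntegral_union (Ioc_disjoint_Ioi le_rfl)
    measurableSet_Ioi (h2.mono_set Ioc_subset_Ioi_self)
    (h2.mono_set (Ioi_subset_Ioi zero_le_one)), h4, h6]
  ring

end IsLogPrim

/-- `∫ x^(-2β) f² dx/x < ∞` on `(0, ∞)`. -/
def WeightedL2 (β : ℝ) (f : ℝ → ℝ) : Prop :=
  MemLp (fun x => x ^ (-β - 1 / 2) * f x) 2 (volume.restrict (Ioi 0))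

theorem rpow_mul_rpow_eq {β x : ℝ} (hx : 0 < x) :
    x ^ (-β - 1 / 2) * x ^ (-β - 1 / 2) = x ^ (-2 * β - 1) := by
  rw [← Real.rpow_add hx]; ring_nf

namespace WeightedL2

variable {β : ℝ} {f f' g g' : ℝ → ℝ}

theorem add (hf : WeightedL2 β f) (hg : WeightedL2 β g) : WeightedL2 β (fun x => f x + g x) := by
  have := MemLp.add hf hg
  unfold WeightedL2
  convert this using 2
  simp only [Pi.add_apply]; ring

theorem const_mul (c : ℝ) (hf : WeightedL2 β f) : WeightedL2 β (fun x => c * f x) := by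
  have := MemLp.const_mul hf c
  unfold WeightedL2
  convert this using 2
  ring

theorem integrableOn_mul (hf : WeightedL2 β f) (hg : WeightedL2 β g) :
    IntegrableOn (fun x => x ^ (-2 * β - 1) * (f x * g x)) (Ioi 0) := by
  refine (MemLp.integrable_mul hf hg).congr ?_
  filter_upwards [ae_restrict_mem measurableSet_Ioi] with x hx
  simp only [Pi.mul_apply]
  rw [← rpow_mul_rpow_eq hx]; ring

theorem rpow_mul (hf : WeightedL2 β f) : WeightedL2 0 (fun x => x ^ (-β) * f x) := by
  refine (memLp_congr_ae ?_).1 hf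
  filter_upwards [ae_restrict_mem measurableSet_Ioi] with x hx
  rw [← mul_assoc, ← Real.rpow_add hx]; ring_nf

theorem integrableOn_mul_div (hf : WeightedL2 0 f) (hg : WeightedL2 0 g) :
    IntegrableOn (fun x => f x * g x / x) (Ioi 0) := by
  refine (integrableOn_mul hf hg).congr_fun (fun x hx => ?_) measurableSet_Ioi
  simp only [mul_zero, zero_sub]
  rw [Real.rpow_neg_one]; ring

/-- D is skew-symmetric for dx/x. Boundary terms are absent since fg and D(fg) are both integrable
with respect to dx/x, which forces fg to vanish at both ends. -/
theorem integral_by_parts (hf : IsLogPrim f f') (hg : IsLogPrim g g') (hf0 : WeightedL2 0 f)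
    (hf1 : WeightedL2 0 f') (hg0 : WeightedL2 0 g) (hg1 : WeightedL2 0 g') :
    ∫ x in Ioi 0, f' x * g x / x = -∫ x in Ioi 0, f x * g' x / x := by
  have h1 := integrableOn_mul_div hf1 hg0
  have h2 := integrableOn_mul_div hf0 hg1
  have h3 := (hf.mul hg).integral_eq_zero (integrableOn_mul_div hf0 hg0)
    ((h1.add h2).congr_fun (fun x _ => by simp only [Pi.add_apply]; ring) measurableSet_Ioi)
  simp only [add_div] at h3
  rw [integral_add h1 h2] at h3
  linarith

end WeightedL2

/-- The monic polynomial `ζ⁴ + a₃ ζ³ + a₂ ζ² + a₁ ζ + a₀`. -/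
structure Quartic where
  a₀ : ℝ
  a₁ : ℝ
  a₂ : ℝ
  a₃ : ℝ

namespace Quartic

variable (p : Quartic) (β : ℝ)

/-- The combination `y₄ + a₃ y₃ + a₂ y₂ + a₁ y₁ + a₀ y₀`. -/
def comb (y : ℕ → ℝ) : ℝ := y 4 + p.a₃ * y 3 + p.a₂ * y 2 + p.a₁ * y 1 + p.a₀ * y 0

/-- The value `p(β)`. -/
def value : ℝ := β ^ 4 + p.a₃ * β ^ 3 + p.a₂ * β ^ 2 + p.a₁ * β + p.a₀

/-- The number `p''(β) / 2`. -/
def halfSnd : ℝ := 6 * β ^ 2 + 3 * p.a₃ * β + p.a₂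

/-- The quadratic form in `y₀, y₁, y₂` that represents `(p(D) w, w)_β` for `y = w, D w, D² w`. -/
def form (y₀ y₁ y₂ : ℝ) : ℝ :=
  (y₂ - 2 * β * y₁ + β ^ 2 * y₀) ^ 2 - p.halfSnd β * (y₁ - β * y₀) ^ 2 + p.value β * y₀ ^ 2

/-- Multiplication by x^(-β) turns D into D + β and the weight into dx/x. With v_j = D^j(x^(-β)w),
Taylor expansion of p(β + D) and skew-symmetry of D give ∫v₄v₀ = ∫v₂², ∫v₂v₀ = -∫v₁², and the terms
with v₃v₀ and v₁v₀ drop out. -/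
theorem integral_comb_mul {p : Quartic} {β : ℝ} {w : ℕ → ℝ → ℝ}
    (hw : ∀ j < 4, IsLogPrim (w j) (w (j + 1))) (hL : ∀ j ≤ 4, WeightedL2 β (w j)) :
    ∫ x in Ioi 0, x ^ (-2 * β - 1) * (p.comb (fun j => w j x) * w 0 x) =
      ∫ x in Ioi 0, x ^ (-2 * β - 1) * p.form β (w 0 x) (w 1 x) (w 2 x) := by
  have w01 := hw 0 (by norm_num)
  have w12 := hw 1 (by norm_num)
  have w23 := hw 2 (by norm_num)
  have w34 := hw 3 (by norm_num)
  have L0 := hL 0 (by norm_num)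
  have L1 := hL 1 (by norm_num)
  have L2 := hL 2 (by norm_num)
  have L3 := hL 3 (by norm_num)
  have L4 := hL 4 (by norm_num)
  norm_num at w01 w12 w23 w34
  have V0 := L0.rpow_mul
  have V1 := (L1.add (L0.const_mul (-β))).rpow_mul
  have V2 := ((L2.add (L1.const_mul (-2 * β))).add (L0.const_mul (β ^ 2))).rpow_mul
  have V3 := (((L3.add (L2.const_mul (-3 * β))).add (L1.const_mul (3 * β ^ 2))).add
    (L0.const_mul (-β ^ 3))).rpow_mul
  have V4 := ((((L4.add (L3.const_mul (-4 * β))).add (L2.const_mul (6 * β ^ 2))).add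
    (L1.const_mul (-4 * β ^ 3))).add (L0.const_mul (β ^ 4))).rpow_mul
  have P01 := w01.rpow_mul β
  have P12 := (w12.add (w01.const_mul (-β))).rpow_mul β
  have P23 := ((w23.add (w12.const_mul (-2 * β))).add (w01.const_mul (β ^ 2))).rpow_mul β
  have P34 := (((w34.add (w23.const_mul (-3 * β))).add (w12.const_mul (3 * β ^ 2))).add
    (w01.const_mul (-β ^ 3))).rpow_mul β
  set v0 := fun x => x ^ (-β) * w 0 x with hv0
  set v1 := fun x => x ^ (-β) * (w 1 x + -β * w 0 x) with hv1
  set v2 := fun x => x ^ (-β) * (w 2 x + -2 * β * w 1 x + β ^ 2 * w 0 x) with hv2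
  set v3 := fun x => x ^ (-β) * (w 3 x + -3 * β * w 2 x + 3 * β ^ 2 * w 1 x + -β ^ 3 * w 0 x) with hv3
  set v4 := fun x => x ^ (-β) * (w 4 x + -4 * β * w 3 x + 6 * β ^ 2 * w 2 x + -4 * β ^ 3 * w 1 x
    + β ^ 4 * w 0 x) with hv4
  have e01 : (fun x => x ^ (-β) * (w 1 x - β * w 0 x)) = v1 := by
    ext x; simp only [hv1]; ring
  have e12 : (fun x => x ^ (-β) * (w 2 x + -β * w 1 x - β * (w 1 x + -β * w 0 x))) = v2 := by
    ext x; simp only [hv2]; ring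
  have e23 : (fun x => x ^ (-β) * (w 3 x + -2 * β * w 2 x + β ^ 2 * w 1 x -
      β * (w 2 x + -2 * β * w 1 x + β ^ 2 * w 0 x))) = v3 := by
    ext x; simp only [hv3]; ring
  have e34 : (fun x => x ^ (-β) * (w 4 x + -3 * β * w 3 x + 3 * β ^ 2 * w 2 x + -β ^ 3 * w 1 x -
      β * (w 3 x + -3 * β * w 2 x + 3 * β ^ 2 * w 1 x + -β ^ 3 * w 0 x))) = v4 := by
    ext x; simp only [hv4]; ring
  rw [e01] at P01
  rw [e12] at P12
  rw [e23] at P23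
  rw [e34] at P34
  have I40 := WeightedL2.integral_by_parts P34 P01 V3 V4 V0 V1
  have I31 := WeightedL2.integral_by_parts P23 P12 V2 V3 V1 V2
  have I30 := WeightedL2.integral_by_parts P23 P01 V2 V3 V0 V1
  have I21 := WeightedL2.integral_by_parts P12 P12 V1 V2 V1 V2
  have I20 := WeightedL2.integral_by_parts P12 P01 V1 V2 V0 V1
  have I10 := WeightedL2.integral_by_parts P01 P01 V0 V1 V0 V1
  have i40 := WeightedL2.integrableOn_mul_div V4 V0
  have i30 := WeightedL2.integrableOn_mul_div V3 V0
  have i20 := WeightedL2.integrableOn_mul_div V2 V0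
  have i10 := WeightedL2.integrableOn_mul_div V1 V0
  have i00 := WeightedL2.integrableOn_mul_div V0 V0
  have i22 := WeightedL2.integrableOn_mul_div V2 V2
  have i11 := WeightedL2.integrableOn_mul_div V1 V1
  have hx2 : ∀ x : ℝ, 0 < x → x ^ (-2 * β - 1) = x ^ (-β) * x ^ (-β) / x := fun x hx => by
    rw [← Real.rpow_add hx, Real.rpow_sub_one hx.ne']; ring_nf
  -- The coefficients are the Taylor coefficients of p at β: 1, p'''(β)/6, p''(β)/2, p'(β), p(β).
  have hl : ∫ x in Ioi 0, x ^ (-2 * β - 1) * (p.comb (fun j => w j x) * w 0 x) =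
      ∫ x in Ioi 0, (v4 x * v0 x / x + (4 * β + p.a₃) * (v3 x * v0 x / x)
        + p.halfSnd β * (v2 x * v0 x / x)
        + (4 * β ^ 3 + 3 * p.a₃ * β ^ 2 + 2 * p.a₂ * β + p.a₁) * (v1 x * v0 x / x)
        + p.value β * (v0 x * v0 x / x)) := by
    refine setIntegral_congr_fun measurableSet_Ioi fun x hx => ?_
    simp only [hx2 x hx, hv0, hv1, hv2, hv3, hv4, comb, value, halfSnd]
    ring
  have hr : ∫ x in Ioi 0, x ^ (-2 * β - 1) * p.form β (w 0 x) (w 1 x) (w 2 x) =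
      ∫ x in Ioi 0, (v2 x * v2 x / x - p.halfSnd β * (v1 x * v1 x / x)
        + p.value β * (v0 x * v0 x / x)) := by
    refine setIntegral_congr_fun measurableSet_Ioi fun x hx => ?_
    simp only [hx2 x hx, hv0, hv1, hv2, form]
    ring
  have s1 : ∫ x in Ioi 0, v1 x * v2 x / x = ∫ x in Ioi 0, v2 x * v1 x / x := by
    simp only [mul_comm]
  have s0 : ∫ x in Ioi 0, v0 x * v1 x / x = ∫ x in Ioi 0, v1 x * v0 x / x := by
    simp only [mul_comm]
  rw [hl, hr, integral_add, integral_add, integral_add, integral_add, integral_add, integral_sub]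
  · simp only [integral_const_mul]
    rw [I40, I31, I30, I20, show ∫ x in Ioi 0, v2 x * v1 x / x = 0 by linarith,
      show ∫ x in Ioi 0, v1 x * v0 x / x = 0 by linarith]
    ring
  all_goals first
    | exact i40 | exact i22 | exact i11.const_mul _ | exact i00.const_mul _ | exact i10.const_mul _
    | exact i20.const_mul _ | exact i30.const_mul _
    | exact i22.sub (i11.const_mul _)
    | exact i40.add (i30.const_mul _)
    | exact (i40.add (i30.const_mul _)).add (i20.const_mul _)
    | exact ((i40.add (i30.const_mul _)).add (i20.const_mul _)).add (i10.const_mul _)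

end Quartic

end ThinFilm

/-! ### Test functions and the operators `x⁻¹ p(D) + x⁻² q(D)` -/

namespace ThinFilm

theorem _root_.ThinFilm.IsTest.shiftD {w : ℝ → ℝ} (h : IsTest w) (γ : ℝ) : IsTest (shiftD γ w) :=
  IsTestIn.sub (IsTestIn.smul_left (IsTestIn.differentiate h) contDiff_id)
    (IsTestIn.const_mul γ h)

theorem shiftD_eq (γ : ℝ) (w : ℝ → ℝ) : shiftD γ w = fun x => shiftD 0 w x - γ * w x := by
  ext x; simp [shiftD]

theorem shiftD_zero_add {f g : ℝ → ℝ} (hf : Differentiable ℝ f) (hg : Differentiable ℝ g) (c : ℝ) :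
    shiftD 0 (fun x => f x - c * g x) = fun x => shiftD 0 f x - c * shiftD 0 g x := by
  ext x
  simp only [shiftD, zero_mul, sub_zero]
  rw [deriv_fun_sub (hf x) ((hg x).const_mul c), deriv_const_mul c (hg x)]
  ring

/-- The iterated logarithmic derivative `D^j w`. -/
noncomputable def logD (w : ℝ → ℝ) (j : ℕ) : ℝ → ℝ := (shiftD 0)^[j] w

theorem logD_succ (w : ℝ → ℝ) (j : ℕ) : logD w (j + 1) = shiftD 0 (logD w j) :=
  Function.iterate_succ_apply' _ _ _

theorem IsTest.logD {w : ℝ → ℝ} (h : IsTest w) (j : ℕ) : IsTest (logD w j) := by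
  induction j with
  | zero => exact h
  | succ j ih => rw [logD_succ]; exact ih.shiftD 0

theorem IsTest.isLogPrim {w : ℝ → ℝ} (h : IsTest w) (j : ℕ) :
    IsLogPrim (ThinFilm.logD w j) (ThinFilm.logD w (j + 1)) := by
  refine IsLogPrim.of_hasDerivAt (fun x hx => ?_) (h.logD (j + 1)).1.continuous.continuousOn
  rw [logD_succ]
  simp only [ThinFilm.shiftD, zero_mul, sub_zero, mul_div_cancel_left₀ _ hx.ne']
  exact (IsTestIn.differentiable (h.logD j) x).hasDerivAt

theorem WeightedL2.of_bound {f : ℝ → ℝ} (β : ℝ) {a b M : ℝ} (ha : 0 < a) (hf : AEStronglyMeasurable f)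
    (hM : ∀ x, |f x| ≤ M) (h0 : ∀ x ∉ Icc a b, f x = 0) : WeightedL2 β f := by
  have hc : ContinuousOn (fun x : ℝ => x ^ (-β - 1 / 2)) (Icc a b) :=
    continuousOn_id.rpow_const fun x hx => Or.inl (ne_of_gt (ha.trans_le hx.1))
  obtain ⟨C, hC⟩ := isCompact_Icc.exists_bound_of_continuousOn hc
  have h1 : MemLp (fun x => x ^ (-β - 1 / 2) * f x) 2 (volume.restrict (Icc a b)) := by
    refine MemLp.of_bound ((hc.aestronglyMeasurable measurableSet_Icc).mul hf.restrict) (C * M) ?_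
    filter_upwards [ae_restrict_mem measurableSet_Icc] with x hx
    rw [norm_mul]
    exact mul_le_mul (hC x hx) (hM x) (norm_nonneg _) ((norm_nonneg _).trans (hC x hx))
  have h2 : (Icc a b).indicator (fun x => x ^ (-β - 1 / 2) * f x) =
      fun x => x ^ (-β - 1 / 2) * f x := by
    rw [indicator_eq_self]
    intro x hx
    by_contra hx'
    exact hx (by simp only [h0 x hx', mul_zero])
  unfold WeightedL2
  rw [← h2]
  exact ((memLp_indicator_iff_restrict measurableSet_Icc).2 h1).restrict _

theorem IsTest.weightedL2 {w : ℝ → ℝ} (h : IsTest w) (β : ℝ) : WeightedL2 β w := by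
  obtain ⟨C, hC⟩ := h.1.continuous.bounded_above_of_compact_support h.2.1
  obtain ⟨a, b, h1, _, h2, h3⟩ := IsTestIn.exists_Icc h ordConnected_Ioi (mem_Ioi.2 one_pos)
  refine WeightedL2.of_bound β (a := a) (b := b) ?_ h.1.continuous.aestronglyMeasurable hC
    fun x hx => image_eq_zero_of_notMem_tsupport fun h' => hx (h3 h')
  exact h2 (left_mem_Icc.2 (by linarith))

/-- The operator `x⁻¹ p(D) + x⁻² q(D)`. -/
noncomputable def opOf (p q : Quartic) (w : ℝ → ℝ) : ℝ → ℝ := fun x =>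
  x⁻¹ * p.comb (fun j => logD w j x) + (x ^ 2)⁻¹ * q.comb (fun j => logD w j x)

theorem shiftD_shiftD_eq {w : ℝ → ℝ} (h : IsTest w) (a b c d : ℝ) :
    shiftD a (shiftD b (shiftD c (shiftD d w))) = fun x =>
      (⟨a * b * c * d, -(a * b * c + a * b * d + a * c * d + b * c * d),
        a * b + a * c + a * d + b * c + b * d + c * d, -(a + b + c + d)⟩ : Quartic).comb
        (fun j => logD w j x) := by
  have hd : ∀ j, Differentiable ℝ (logD w j) := fun j => IsTestIn.differentiable (h.logD j)
  have e1 : ∀ γ, shiftD γ w = fun x => logD w 1 x - γ * logD w 0 x := fun γ => by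
    rw [shiftD_eq]; rfl
  have hs : ∀ {f g : ℝ → ℝ} (c : ℝ), Differentiable ℝ f → Differentiable ℝ g →
      Differentiable ℝ (fun x => f x - c * g x) := fun c hf hg => hf.sub (hg.const_mul c)
  have e2 : shiftD c (shiftD d w) = fun x => (logD w 2 x - d * logD w 1 x) -
      c * (logD w 1 x - d * logD w 0 x) := by
    rw [shiftD_eq, e1, shiftD_zero_add (hd 1) (hd 0), ← logD_succ, ← logD_succ]
  have e3 : shiftD b (shiftD c (shiftD d w)) = fun x =>
      ((logD w 3 x - d * logD w 2 x) - c * (logD w 2 x - d * logD w 1 x)) -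
      b * ((logD w 2 x - d * logD w 1 x) - c * (logD w 1 x - d * logD w 0 x)) := by
    have l1 := shiftD_zero_add (hd 2) (hd 1) d
    have l2 := shiftD_zero_add (hd 1) (hd 0) d
    rw [← logD_succ, ← logD_succ] at l1 l2
    rw [shiftD_eq, e2, shiftD_zero_add (hs d (hd 2) (hd 1)) (hs d (hd 1) (hd 0)), l1, l2]
  have l1 := shiftD_zero_add (hd 3) (hd 2) d
  have l2 := shiftD_zero_add (hd 2) (hd 1) d
  have l3 := shiftD_zero_add (hd 1) (hd 0) d
  rw [← logD_succ, ← logD_succ] at l1 l2 l3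
  have D2 := hs d (hd 3) (hd 2)
  have D1 := hs d (hd 2) (hd 1)
  have D0 := hs d (hd 1) (hd 0)
  have m1 := shiftD_zero_add D2 D1 c
  have m2 := shiftD_zero_add D1 D0 c
  rw [shiftD_eq, e3, shiftD_zero_add (hs c D2 D1) (hs c D1 D0), m1, m2,
    l1, l2, l3]
  ext x
  simp only [Quartic.comb]
  ring

/-- `ζ² (ζ - 2)²` -/
def pTilde : Quartic := ⟨0, 0, 4, -4⟩
/-- `ζ (ζ - 1) (ζ - 2) (ζ - 3)` -/
def qTilde : Quartic := ⟨0, -6, 11, -6⟩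
/-- `ζ² (ζ - 2) (ζ - 3)` -/
def pCheck : Quartic := ⟨0, 0, 6, -5⟩
/-- `ζ (ζ - 1) (ζ - 3) (ζ - 4)` -/
def qCheck : Quartic := ⟨0, -12, 19, -8⟩

theorem opTilde_eq {w : ℝ → ℝ} (h : IsTest w) : opTilde w = opOf pTilde qTilde w := by
  ext x
  simp only [opTilde, opOf, shiftD_shiftD_eq h, pTilde, qTilde, Quartic.comb]
  ring

theorem opCheck_eq {w : ℝ → ℝ} (h : IsTest w) : opCheck w = opOf pCheck qCheck w := by
  ext x
  simp only [opCheck, opOf, shiftD_shiftD_eq h, pCheck, qCheck, Quartic.comb]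
  ring

/-! ### The energy form -/

/-- The quadratic form that represents `((x⁻¹ p(D) + x⁻² q(D)) w, w)_α` for `y = w, D w, D² w`. -/
noncomputable def energy (p q : Quartic) (α : ℝ) (y₀ y₁ y₂ : ℝ → ℝ) : ℝ :=
  ∫ x in Ioi 0, (x ^ (-2 * (α + 1 / 2) - 1) * p.form (α + 1 / 2) (y₀ x) (y₁ x) (y₂ x) +
    x ^ (-2 * (α + 1) - 1) * q.form (α + 1) (y₀ x) (y₁ x) (y₂ x))

namespace Quartic

theorem integrableOn_comb_mul (p : Quartic) {β : ℝ} {w : ℕ → ℝ → ℝ}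
    (hL : ∀ j ≤ 4, WeightedL2 β (w j)) :
    IntegrableOn (fun x => x ^ (-2 * β - 1) * (p.comb (fun j => w j x) * w 0 x)) (Ioi 0) := by
  have h := ((((hL 4 (by norm_num)).add ((hL 3 (by norm_num)).const_mul p.a₃)).add
    ((hL 2 (by norm_num)).const_mul p.a₂)).add ((hL 1 (by norm_num)).const_mul p.a₁)).add
    ((hL 0 (by norm_num)).const_mul p.a₀)
  exact h.integrableOn_mul (hL 0 (by norm_num))

theorem integrableOn_form (p : Quartic) (β : ℝ) {y₀ y₁ y₂ : ℝ → ℝ} (h₀ : WeightedL2 β y₀)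
    (h₁ : WeightedL2 β y₁) (h₂ : WeightedL2 β y₂) :
    IntegrableOn (fun x => x ^ (-2 * β - 1) * p.form β (y₀ x) (y₁ x) (y₂ x)) (Ioi 0) := by
  have z₂ := (h₂.add (h₁.const_mul (-2 * β))).add (h₀.const_mul (β ^ 2))
  have z₁ := h₁.add (h₀.const_mul (-β))
  have := ((z₂.integrableOn_mul z₂).sub ((z₁.integrableOn_mul z₁).const_mul (p.halfSnd β))).add
    ((h₀.integrableOn_mul h₀).const_mul (p.value β))
  refine this.congr_fun (fun x _ => ?_) measurableSet_Ioi
  simp only [Pi.add_apply, Pi.sub_apply, form]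
  ring

/-- This bound supplies the majorant for dominated convergence of the form. -/
theorem abs_form_le (p : Quartic) (β : ℝ) : ∃ C, 0 ≤ C ∧ ∀ y₀ y₁ y₂ : ℝ,
    |p.form β y₀ y₁ y₂| ≤ C * (y₀ ^ 2 + y₁ ^ 2 + y₂ ^ 2) := by
  refine ⟨3 * (1 + 4 * β ^ 2 + β ^ 4) + |p.halfSnd β| * (2 * (1 + β ^ 2)) + |p.value β|,
    by positivity, fun y₀ y₁ y₂ => ?_⟩
  have h1 : (y₂ - 2 * β * y₁ + β ^ 2 * y₀) ^ 2 ≤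
      3 * (1 + 4 * β ^ 2 + β ^ 4) * (y₀ ^ 2 + y₁ ^ 2 + y₂ ^ 2) := by
    have : (y₂ - 2 * β * y₁ + β ^ 2 * y₀) ^ 2 ≤
        3 * (y₂ ^ 2 + (2 * β * y₁) ^ 2 + (β ^ 2 * y₀) ^ 2) := by
      nlinarith [sq_nonneg (y₂ + 2 * β * y₁), sq_nonneg (y₂ - β ^ 2 * y₀),
        sq_nonneg (2 * β * y₁ + β ^ 2 * y₀)]
    refine this.trans ?_
    have e : 3 * (1 + 4 * β ^ 2 + β ^ 4) * (y₀ ^ 2 + y₁ ^ 2 + y₂ ^ 2) -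
      3 * (y₂ ^ 2 + (2 * β * y₁) ^ 2 + (β ^ 2 * y₀) ^ 2) = 3 * (y₀ ^ 2 + y₁ ^ 2 +
        4 * β ^ 2 * (y₀ ^ 2 + y₂ ^ 2) + β ^ 4 * (y₁ ^ 2 + y₂ ^ 2)) := by ring
    have : 0 ≤ 3 * (y₀ ^ 2 + y₁ ^ 2 +
        4 * β ^ 2 * (y₀ ^ 2 + y₂ ^ 2) + β ^ 4 * (y₁ ^ 2 + y₂ ^ 2)) := by positivity
    linarith
  have h2 : (y₁ - β * y₀) ^ 2 ≤ 2 * (1 + β ^ 2) * (y₀ ^ 2 + y₁ ^ 2 + y₂ ^ 2) := by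
    have e : 2 * (1 + β ^ 2) * (y₀ ^ 2 + y₁ ^ 2 + y₂ ^ 2) - (y₁ - β * y₀) ^ 2 =
      (y₁ + β * y₀) ^ 2 + 2 * (y₀ ^ 2 + y₂ ^ 2 + β ^ 2 * (y₁ ^ 2 + y₂ ^ 2)) := by ring
    have : 0 ≤ (y₁ + β * y₀) ^ 2 + 2 * (y₀ ^ 2 + y₂ ^ 2 + β ^ 2 * (y₁ ^ 2 + y₂ ^ 2)) := by
      positivity
    linarith
  have h3 : y₀ ^ 2 ≤ y₀ ^ 2 + y₁ ^ 2 + y₂ ^ 2 := by linarith [sq_nonneg y₁, sq_nonneg y₂]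
  calc |p.form β y₀ y₁ y₂| ≤ |(y₂ - 2 * β * y₁ + β ^ 2 * y₀) ^ 2| +
        |p.halfSnd β * (y₁ - β * y₀) ^ 2| + |p.value β * y₀ ^ 2| :=
      (abs_add_le _ _).trans (by gcongr; exact abs_sub _ _)
    _ = (y₂ - 2 * β * y₁ + β ^ 2 * y₀) ^ 2 + |p.halfSnd β| * (y₁ - β * y₀) ^ 2 +
        |p.value β| * y₀ ^ 2 := by
      rw [abs_mul, abs_mul, abs_of_nonneg (sq_nonneg (y₂ - 2 * β * y₁ + β ^ 2 * y₀)),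
        abs_of_nonneg (sq_nonneg (y₁ - β * y₀)), abs_of_nonneg (sq_nonneg y₀)]
    _ ≤ 3 * (1 + 4 * β ^ 2 + β ^ 4) * (y₀ ^ 2 + y₁ ^ 2 + y₂ ^ 2) +
        |p.halfSnd β| * (2 * (1 + β ^ 2) * (y₀ ^ 2 + y₁ ^ 2 + y₂ ^ 2)) +
        |p.value β| * (y₀ ^ 2 + y₁ ^ 2 + y₂ ^ 2) := by gcongr
    _ = _ := by ring

theorem continuous_form (p : Quartic) (β : ℝ) :
    Continuous fun y : ℝ × ℝ × ℝ => p.form β y.1 y.2.1 y.2.2 := by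
  unfold form; fun_prop

theorem tendsto_integral_form (p : Quartic) {β : ℝ} {Y₀ Y₁ Y₂ : ℕ → ℝ → ℝ} {y₀ y₁ y₂ m : ℝ → ℝ}
    (hm : WeightedL2 β m) (c₀ : ∀ n, ContinuousOn (Y₀ n) (Ioi 0))
    (c₁ : ∀ n, ContinuousOn (Y₁ n) (Ioi 0)) (c₂ : ∀ n, ContinuousOn (Y₂ n) (Ioi 0))
    (b₀ : ∀ n, ∀ x > 0, |Y₀ n x| ≤ m x) (b₁ : ∀ n, ∀ x > 0, |Y₁ n x| ≤ m x)
    (b₂ : ∀ n, ∀ x > 0, |Y₂ n x| ≤ m x)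
    (t₀ : ∀ x > 0, Tendsto (fun n => Y₀ n x) atTop (𝓝 (y₀ x)))
    (t₁ : ∀ x > 0, Tendsto (fun n => Y₁ n x) atTop (𝓝 (y₁ x)))
    (t₂ : ∀ x > 0, Tendsto (fun n => Y₂ n x) atTop (𝓝 (y₂ x))) :
    Tendsto (fun n => ∫ x in Ioi 0, x ^ (-2 * β - 1) * p.form β (Y₀ n x) (Y₁ n x) (Y₂ n x)) atTop
      (𝓝 (∫ x in Ioi 0, x ^ (-2 * β - 1) * p.form β (y₀ x) (y₁ x) (y₂ x))) := by
  obtain ⟨C, hC0, hC⟩ := p.abs_form_le β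
  have hpow : ContinuousOn (fun x : ℝ => x ^ (-2 * β - 1)) (Ioi 0) :=
    continuousOn_id.rpow_const fun x hx => Or.inl (ne_of_gt (mem_Ioi.1 hx))
  refine tendsto_integral_of_dominated_convergence
    (fun x => 3 * C * (x ^ (-2 * β - 1) * (m x * m x))) (fun n => ?_)
    ((hm.integrableOn_mul hm).const_mul _) (fun n => ?_) ?_
  · exact (hpow.mul ((p.continuous_form β).comp_continuousOn
      ((c₀ n).prodMk ((c₁ n).prodMk (c₂ n))))).aestronglyMeasurable measurableSet_Ioi
  · filter_upwards [ae_restrict_mem measurableSet_Ioi] with x hx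
    have hx' : 0 < x := hx
    have hp : 0 < x ^ (-2 * β - 1) := Real.rpow_pos_of_pos hx' _
    have q₀ := sq_le_sq' (abs_le.1 (b₀ n x hx)).1 (abs_le.1 (b₀ n x hx)).2
    have q₁ := sq_le_sq' (abs_le.1 (b₁ n x hx)).1 (abs_le.1 (b₁ n x hx)).2
    have q₂ := sq_le_sq' (abs_le.1 (b₂ n x hx)).1 (abs_le.1 (b₂ n x hx)).2
    rw [norm_mul, Real.norm_of_nonneg hp.le, Real.norm_eq_abs]
    calc x ^ (-2 * β - 1) * |p.form β (Y₀ n x) (Y₁ n x) (Y₂ n x)|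
        ≤ x ^ (-2 * β - 1) * (C * (m x ^ 2 + m x ^ 2 + m x ^ 2)) := by
          gcongr
          exact (hC _ _ _).trans (by gcongr)
      _ = _ := by ring
  · filter_upwards [ae_restrict_mem measurableSet_Ioi] with x hx
    exact (((p.continuous_form β).tendsto (y₀ x, y₁ x, y₂ x)).comp
      ((t₀ x hx).prodMk_nhds ((t₁ x hx).prodMk_nhds (t₂ x hx)))).const_mul _

end Quartic

theorem energy_eq (p q : Quartic) {α : ℝ} {y₀ y₁ y₂ : ℝ → ℝ}
    (h : ∀ β, β = α + 1 / 2 ∨ β = α + 1 → WeightedL2 β y₀ ∧ WeightedL2 β y₁ ∧ WeightedL2 β y₂) :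
    energy p q α y₀ y₁ y₂ =
      (∫ x in Ioi 0, x ^ (-2 * (α + 1 / 2) - 1) * p.form (α + 1 / 2) (y₀ x) (y₁ x) (y₂ x)) +
      ∫ x in Ioi 0, x ^ (-2 * (α + 1) - 1) * q.form (α + 1) (y₀ x) (y₁ x) (y₂ x) := by
  obtain ⟨a0, a1, a2⟩ := h _ (Or.inl rfl)
  obtain ⟨b0, b1, b2⟩ := h _ (Or.inr rfl)
  exact integral_add (p.integrableOn_form _ a0 a1 a2) (q.integrableOn_form _ b0 b1 b2)

/-- The factors x⁻¹ and x⁻² shift the weight index by 1/2 and by 1; this is the origin of the two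
norms in the coercivity estimate. -/
theorem weight_mul_eq (α : ℝ) {x : ℝ} (hx : 0 < x) (P Q w : ℝ) :
    x ^ (-2 * α) * (x⁻¹ * P + (x ^ 2)⁻¹ * Q) * w / x =
      x ^ (-2 * (α + 1 / 2) - 1) * (P * w) + x ^ (-2 * (α + 1) - 1) * (Q * w) := by
  rw [show -2 * (α + 1 / 2) - 1 = -2 * α - 1 - 1 by ring, show -2 * (α + 1) - 1 =
    -2 * α - 1 - 1 - 1 by ring, Real.rpow_sub_one hx.ne' (-2 * α - 1 - 1),
    Real.rpow_sub_one hx.ne' (-2 * α - 1), Real.rpow_sub_one hx.ne' (-2 * α)]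
  field_simp

/-- Only w, Dw and D²w enter the right-hand side, so its sign can be transferred by approximations
that control two derivatives rather than four. -/
theorem integral_comb_eq_energy (p q : Quartic) {α : ℝ} {w : ℕ → ℝ → ℝ}
    (hw : ∀ j < 4, IsLogPrim (w j) (w (j + 1)))
    (hL : ∀ β, β = α + 1 / 2 ∨ β = α + 1 → ∀ j ≤ 4, WeightedL2 β (w j)) :
    ∫ x in Ioi 0, x ^ (-2 * α) * (x⁻¹ * p.comb (fun j => w j x) +
      (x ^ 2)⁻¹ * q.comb (fun j => w j x)) * w 0 x / x = energy p q α (w 0) (w 1) (w 2) := by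
  rw [energy_eq p q fun β hβ => ⟨hL β hβ 0 (by norm_num), hL β hβ 1 (by norm_num),
    hL β hβ 2 (by norm_num)⟩, ← Quartic.integral_comb_mul hw (hL _ (Or.inl rfl)),
    ← Quartic.integral_comb_mul hw (hL _ (Or.inr rfl)),
    ← integral_add (p.integrableOn_comb_mul (hL _ (Or.inl rfl)))
      (q.integrableOn_comb_mul (hL _ (Or.inr rfl)))]
  exact setIntegral_congr_fun measurableSet_Ioi fun x hx => weight_mul_eq α hx _ _ _

theorem IsTest.wInner_opOf {w : ℝ → ℝ} (h : IsTest w) (p q : Quartic) (α : ℝ) :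
    wInner α (opOf p q w) w =
      energy p q α w (ThinFilm.logD w 1) (ThinFilm.logD w 2) :=
  integral_comb_eq_energy (w := ThinFilm.logD w) p q (fun j _ => h.isLogPrim j)
    fun β _ j _ => (h.logD j).weightedL2 β

end ThinFilm

/-! ### Coercivity -/

namespace ThinFilm

theorem WeightedL2.abs {β : ℝ} {f : ℝ → ℝ} (hf : WeightedL2 β f) : WeightedL2 β fun x => |f x| := by
  refine (memLp_congr_ae ?_).1 (MemLp.norm hf)
  filter_upwards [ae_restrict_mem measurableSet_Ioi] with x hx
  rw [norm_mul, Real.norm_of_nonneg (Real.rpow_nonneg (le_of_lt hx) _), Real.norm_eq_abs]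

/-- The form of `x⁻¹ p(D) + x⁻² q(D)` is nonnegative on test functions. -/
def NonnegOnTests (p q : Quartic) (α : ℝ) : Prop :=
  ∀ w, IsTest w → 0 ≤ energy p q α w (logD w 1) (logD w 2)

theorem tendsto_energy (p q : Quartic) {α : ℝ} {Y₀ Y₁ Y₂ : ℕ → ℝ → ℝ} {y₀ y₁ y₂ m : ℝ → ℝ}
    (hm : ∀ β, β = α + 1 / 2 ∨ β = α + 1 → WeightedL2 β m)
    (hY : ∀ n β, β = α + 1 / 2 ∨ β = α + 1 →
      WeightedL2 β (Y₀ n) ∧ WeightedL2 β (Y₁ n) ∧ WeightedL2 β (Y₂ n))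
    (hy : ∀ β, β = α + 1 / 2 ∨ β = α + 1 → WeightedL2 β y₀ ∧ WeightedL2 β y₁ ∧ WeightedL2 β y₂)
    (c₀ : ∀ n, ContinuousOn (Y₀ n) (Ioi 0))
    (c₁ : ∀ n, ContinuousOn (Y₁ n) (Ioi 0)) (c₂ : ∀ n, ContinuousOn (Y₂ n) (Ioi 0))
    (b₀ : ∀ n, ∀ x > 0, |Y₀ n x| ≤ m x) (b₁ : ∀ n, ∀ x > 0, |Y₁ n x| ≤ m x)
    (b₂ : ∀ n, ∀ x > 0, |Y₂ n x| ≤ m x)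
    (t₀ : ∀ x > 0, Tendsto (fun n => Y₀ n x) atTop (𝓝 (y₀ x)))
    (t₁ : ∀ x > 0, Tendsto (fun n => Y₁ n x) atTop (𝓝 (y₁ x)))
    (t₂ : ∀ x > 0, Tendsto (fun n => Y₂ n x) atTop (𝓝 (y₂ x))) :
    Tendsto (fun n => energy p q α (Y₀ n) (Y₁ n) (Y₂ n)) atTop (𝓝 (energy p q α y₀ y₁ y₂)) := by
  rw [energy_eq p q hy]
  simp only [fun n => energy_eq p q (hY n)]
  exact (p.tendsto_integral_form (hm _ (Or.inl rfl)) c₀ c₁ c₂ b₀ b₁ b₂ t₀ t₁ t₂).add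
    (q.tendsto_integral_form (hm _ (Or.inr rfl)) c₀ c₁ c₂ b₀ b₁ b₂ t₀ t₁ t₂)

theorem tsupport_convolution_subset_Icc {ρ V : ℝ → ℝ} {r a b : ℝ}
    (hρ : Function.support ρ ⊆ Metric.ball 0 r) (hV : ∀ x ∉ Icc a b, V x = 0) :
    tsupport (convolution ρ V (ContinuousLinearMap.lsmul ℝ ℝ) volume) ⊆ Icc (a - r) (b + r) := by
  refine closure_minimal ((support_convolution_subset _).trans ?_) isClosed_Icc
  rintro _ ⟨x, hx, y, hy, rfl⟩
  have h1 := hρ hx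
  have h2 : y ∈ Icc a b := by
    by_contra h
    exact hy (hV y h)
  rw [Metric.mem_ball, dist_zero_right, Real.norm_eq_abs, abs_lt] at h1
  exact ⟨by simp only; linarith [h2.1], by simp only; linarith [h2.2]⟩

/-- Mollification: derivatives fall on V, so bounds and pointwise convergence hold for the orders 0,
1, 2 alike. Radii of at most a/2 keep the supports in one compact part of (0, ∞). -/
theorem exists_test_approximation {V : ℝ → ℝ} (hV : ContDiff ℝ 2 V) {a b : ℝ} (ha : 0 < a)
    (h0 : ∀ x ∉ Icc a b, V x = 0) :
    ∃ φ : ℕ → ℝ → ℝ, ∃ M : ℝ, (∀ n, IsTest (φ n)) ∧ (∀ n, ∀ x ∉ Icc (a / 2) (b + a / 2), φ n x = 0) ∧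
      ∀ j ≤ 2, (∀ n x, |deriv^[j] (φ n) x| ≤ M) ∧
        ∀ x, Tendsto (fun n => deriv^[j] (φ n) x) atTop (𝓝 (deriv^[j] V x)) := by
  have hsV : HasCompactSupport V := HasCompactSupport.intro isCompact_Icc h0
  have hV1 : ContDiff ℝ 1 (deriv V) := by
    have : ContDiff ℝ (1 + 1) V := by simpa [one_add_one_eq_two] using hV
    exact ((contDiff_succ_iff_deriv).1 this).2.2
  have hV2 : Continuous (deriv (deriv V)) := hV1.continuous_deriv le_rfl
  have hs1 := hsV.deriv
  have hs2 := hs1.deriv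
  let B : ℕ → ContDiffBump (0 : ℝ) := fun n =>
    ⟨a / 4 / ((n : ℝ) + 1), a / 2 / ((n : ℝ) + 1), by positivity, by gcongr; norm_num⟩
  have hB : Tendsto (fun n => (B n).rOut) atTop (𝓝 0) := by
    have := (tendsto_one_div_add_atTop_nhds_zero_nat (𝕜 := ℝ)).const_mul (a / 2)
    rw [mul_zero] at this
    refine this.congr fun n => ?_
    simp only [B]; ring
  have hBa : ∀ n, (B n).rOut ≤ a / 2 := fun n => by
    simp only [B]
    exact div_le_self (by positivity) (by linarith [(Nat.cast_nonneg n : (0 : ℝ) ≤ n)])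
  let L := ContinuousLinearMap.lsmul ℝ ℝ (E := ℝ)
  let φ : ℕ → ℝ → ℝ := fun n => convolution ((B n).normed volume) V L volume
  have hint : ∀ n, LocallyIntegrable ((B n).normed volume) (volume : Measure ℝ) := fun n =>
    (B n).continuous_normed.locallyIntegrable
  have hφ1 : ∀ n, deriv (φ n) = convolution ((B n).normed volume) (deriv V) L volume := fun n =>
    funext fun x => (hsV.hasDerivAt_convolution_right L (hint n) (hV.of_le (by norm_num)) x).deriv
  have hφ2 : ∀ n, deriv (deriv (φ n)) =
      convolution ((B n).normed volume) (deriv (deriv V)) L volume := fun n => by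
    rw [hφ1]
    exact funext fun x => (hs1.hasDerivAt_convolution_right L (hint n) hV1 x).deriv
  have hsupp : ∀ n, tsupport (φ n) ⊆ Icc (a / 2) (b + a / 2) := fun n =>
    (tsupport_convolution_subset_Icc (B n).support_normed_eq.subset h0).trans
      (Icc_subset_Icc (by linarith [hBa n]) (by linarith [hBa n]))
  have hbound : ∀ (W : ℝ → ℝ) (M : ℝ), Continuous W → (∀ x, ‖W x‖ ≤ M) → ∀ n x,
      |convolution ((B n).normed volume) W L volume x| ≤ M := fun W M hW hM n x => by
    have := dist_convolution_le (μ := volume) (f := (B n).normed volume) (x₀ := x) (z₀ := (0 : ℝ))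
      ((norm_nonneg _).trans (hM x)) (B n).support_normed_eq.subset (B n).nonneg_normed
      (B n).integral_normed hW.aestronglyMeasurable (fun y _ => by simpa using hM y)
    simpa using this
  obtain ⟨M₀, hM₀⟩ := hV.continuous.bounded_above_of_compact_support hsV
  obtain ⟨M₁, hM₁⟩ := hV1.continuous.bounded_above_of_compact_support hs1
  obtain ⟨M₂, hM₂⟩ := hV2.bounded_above_of_compact_support hs2
  refine ⟨φ, max M₀ (max M₁ M₂), fun n => ⟨?_, ?_, ?_⟩, fun n x hx => ?_, ?_⟩
  · exact (B n).hasCompactSupport_normed.contDiff_convolution_left L (B n).contDiff_normed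
      hV.continuous.locallyIntegrable
  · exact isCompact_Icc.of_isClosed_subset (isClosed_tsupport _) (hsupp n)
  · exact (hsupp n).trans fun x hx => (half_pos ha).trans_le hx.1
  · exact image_eq_zero_of_notMem_tsupport fun h => hx (hsupp n h)
  · intro j hj
    interval_cases j
    · simp only [Function.iterate_zero, id_eq]
      exact ⟨fun n x => (hbound V M₀ hV.continuous hM₀ n x).trans (le_max_left _ _), fun x =>
        ContDiffBump.convolution_tendsto_right_of_continuous hB hV.continuous x⟩
    · simp only [Function.iterate_one, hφ1]
      exact ⟨fun n x => (hbound _ M₁ hV1.continuous hM₁ n x).trans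
        ((le_max_left _ _).trans (le_max_right _ _)), fun x =>
        ContDiffBump.convolution_tendsto_right_of_continuous hB hV1.continuous x⟩
    · simp only [Function.iterate_succ, Function.iterate_zero, Function.comp, id_eq, hφ2]
      exact ⟨fun n x => (hbound _ M₂ hV2 hM₂ n x).trans
        ((le_max_right _ _).trans (le_max_right _ _)), fun x =>
        ContDiffBump.convolution_tendsto_right_of_continuous hB hV2 x⟩

theorem logD_one (w : ℝ → ℝ) : logD w 1 = fun x => x * deriv w x := by
  ext x; simp [logD, shiftD]

theorem logD_two {w : ℝ → ℝ} (hw : IsTest w) :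
    logD w 2 = fun x => x * deriv w x + x ^ 2 * deriv (deriv w) x := by
  ext x
  rw [logD_succ, logD_one]
  have h := ((IsTestIn.differentiate hw).differentiable x)
  simp only [shiftD, zero_mul, sub_zero]
  rw [deriv_fun_mul differentiableAt_fun_id h, deriv_id'']
  ring

theorem NonnegOnTests.of_contDiff {p q : Quartic} {α : ℝ} (H : NonnegOnTests p q α) {V : ℝ → ℝ}
    (hV : ContDiff ℝ 2 V) {a b : ℝ} (ha : 0 < a) (h0 : ∀ x ∉ Icc a b, V x = 0) :
    0 ≤ energy p q α V (fun x => x * deriv V x)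
      (fun x => x * deriv V x + x ^ 2 * deriv (deriv V) x) := by
  obtain ⟨φ, M, hφ, hs, hf⟩ := exists_test_approximation hV ha h0
  obtain ⟨b0, t0⟩ := hf 0 (by norm_num)
  obtain ⟨b1, t1⟩ := hf 1 (by norm_num)
  obtain ⟨b2, t2⟩ := hf 2 (by norm_num)
  simp only [Function.iterate_succ, Function.iterate_zero, Function.comp, id_eq] at b0 t0 b1 t1 b2 t2
  have hsV : HasCompactSupport V := HasCompactSupport.intro isCompact_Icc h0
  have hV1 : ContDiff ℝ 1 (deriv V) := by
    have : ContDiff ℝ (1 + 1) V := by simpa [one_add_one_eq_two] using hV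
    exact ((contDiff_succ_iff_deriv).1 this).2.2
  have hz : ∀ {W : ℝ → ℝ} {c d : ℝ}, (∀ x ∉ Icc c d, W x = 0) → ∀ x ∉ Icc c d, deriv W x = 0 :=
    fun {W c d} hW x hx => by
      have : W =ᶠ[𝓝 x] fun _ => 0 := by
        filter_upwards [isClosed_Icc.isOpen_compl.mem_nhds hx] with y hy using hW y hy
      rw [this.deriv_eq, deriv_const]
  have hM0 : 0 ≤ M := (abs_nonneg _).trans (b0 0 0)
  set d := max 1 (b + a / 2) with hd
  have hd1 : 1 ≤ d := le_max_left _ _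
  have hdb : b + a / 2 ≤ d := le_max_right _ _
  -- A common majorant of φ, xφ' and xφ' + x²φ'' on the supports, where x ≤ d and d ≥ 1.
  let m : ℝ → ℝ := (Icc (a / 2) (b + a / 2)).indicator fun _ => 2 * d ^ 2 * M
  have hm : ∀ β, WeightedL2 β m := fun β => by
    refine WeightedL2.of_bound β (a := a / 2) (b := b + a / 2) (M := 2 * d ^ 2 * M) (half_pos ha)
      (aestronglyMeasurable_const.indicator measurableSet_Icc) (fun x => ?_)
      fun x hx => indicator_of_notMem hx _
    by_cases hx : x ∈ Icc (a / 2) (b + a / 2)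
    · simp only [m, indicator_of_mem hx]
      rw [abs_of_nonneg (by positivity)]
    · simp only [m, indicator_of_notMem hx, abs_zero]; positivity
  have hbd : ∀ (Y : ℝ → ℝ), (∀ x ∉ Icc (a / 2) (b + a / 2), Y x = 0) →
      (∀ x ∈ Icc (a / 2) (b + a / 2), 0 < x → x ≤ d → |Y x| ≤ 2 * d ^ 2 * M) → ∀ x > 0, |Y x| ≤ m x :=
    fun Y h1 h2 x hx => by
      by_cases hxm : x ∈ Icc (a / 2) (b + a / 2)
      · simp only [m, indicator_of_mem hxm]
        exact h2 x hxm hx (hxm.2.trans hdb)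
      · simp only [m, indicator_of_notMem hxm, h1 x hxm, abs_zero, le_refl]
  have hcomp : ∀ {Y : ℝ → ℝ}, Continuous Y → (∀ x ∉ Icc a b, Y x = 0) → ∀ β, WeightedL2 β Y :=
    fun {Y} hY hY0 β => by
      obtain ⟨C, hC⟩ := hY.bounded_above_of_compact_support (HasCompactSupport.intro isCompact_Icc hY0)
      exact WeightedL2.of_bound β ha hY.aestronglyMeasurable hC hY0
  have hlim := tendsto_energy p q (α := α) (Y₀ := φ) (Y₁ := fun n => logD (φ n) 1)
    (Y₂ := fun n => logD (φ n) 2) (y₀ := V) (y₁ := fun x => x * deriv V x)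
    (y₂ := fun x => x * deriv V x + x ^ 2 * deriv (deriv V) x) (m := m) (fun β _ => hm β)
    (fun n β _ => ⟨(hφ n).weightedL2 β, ((hφ n).logD 1).weightedL2 β, ((hφ n).logD 2).weightedL2 β⟩)
    (fun β _ => ⟨hcomp hV.continuous h0 β,
      hcomp (continuous_id.mul hV1.continuous) (fun x hx => by simp [hz h0 x hx]) β,
      hcomp ((continuous_id.mul hV1.continuous).add
        ((continuous_pow 2).mul (hV1.continuous_deriv le_rfl)))
        (fun x hx => by simp [hz h0 x hx, hz (hz h0) x hx]) β⟩)
    (fun n => (hφ n).1.continuous.continuousOn)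
    (fun n => ((hφ n).logD 1).1.continuous.continuousOn)
    (fun n => ((hφ n).logD 2).1.continuous.continuousOn) ?_ ?_ ?_ (fun x _ => t0 x) ?_ ?_
  · exact ge_of_tendsto' hlim fun n => H _ (hφ n)
  · refine fun n => hbd _ (hs n) fun x hx hx0 hxd => (b0 n x).trans ?_
    nlinarith [one_le_pow₀ (n := 2) hd1]
  · refine fun n => hbd _ (fun x hx => ?_) fun x hx hx0 hxd => ?_
    · simp [logD_one, hz (hs n) x hx]
    · rw [logD_one]
      simp only
      rw [abs_mul, abs_of_pos hx0]
      calc x * |deriv (φ n) x| ≤ d * M := mul_le_mul hxd (b1 n x) (abs_nonneg _) (by linarith)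
        _ ≤ d ^ 2 * M := by gcongr; nlinarith
        _ ≤ 2 * d ^ 2 * M := by nlinarith [mul_nonneg (sq_nonneg d) hM0]
  · refine fun n => hbd _ (fun x hx => ?_) fun x hx hx0 hxd => ?_
    · simp [logD_two (hφ n), hz (hs n) x hx, hz (hz (hs n)) x hx]
    · rw [logD_two (hφ n)]
      simp only
      refine (abs_add_le _ _).trans ?_
      rw [abs_mul, abs_mul, abs_of_pos hx0, abs_of_pos (pow_pos hx0 2)]
      calc x * |deriv (φ n) x| + x ^ 2 * |deriv (deriv (φ n)) x| ≤ d * M + d ^ 2 * M :=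
            add_le_add (mul_le_mul hxd (b1 n x) (abs_nonneg _) (by linarith))
              (mul_le_mul (by gcongr) (b2 n x) (abs_nonneg _) (by positivity))
        _ ≤ d ^ 2 * M + d ^ 2 * M := by gcongr; nlinarith
        _ = 2 * d ^ 2 * M := by ring
  · intro x _
    simp only [logD_one]
    exact (t1 x).const_mul x
  · intro x _
    simp only [fun n => logD_two (hφ n)]
    exact ((t1 x).const_mul x).add ((t2 x).const_mul (x ^ 2))

end ThinFilm

/-! ### Removing smoothness at the origin and compact support from the nonnegativity of the form -/

namespace ThinFilm

theorem hasDerivAt_indicator_Ioi {f f' : ℝ → ℝ} {a b : ℝ} (ha : 0 < a)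
    (hf : ∀ x > 0, HasDerivAt f (f' x) x) (h0 : ∀ x > 0, x ∉ Icc a b → f x = 0) (x : ℝ) :
    HasDerivAt ((Ioi 0).indicator f) ((Ioi 0).indicator f' x) x := by
  rcases lt_or_ge 0 x with hx | hx
  · rw [indicator_of_mem (mem_Ioi.2 hx)]
    refine (hf x hx).congr_of_eventuallyEq ?_
    filter_upwards [Ioi_mem_nhds hx] with y hy using indicator_of_mem hy _
  · rw [indicator_of_notMem (by simpa using hx)]
    refine (hasDerivAt_const x (0 : ℝ)).congr_of_eventuallyEq ?_
    filter_upwards [Iio_mem_nhds (hx.trans_lt ha)] with y hy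
    by_cases hy0 : 0 < y
    · rw [indicator_of_mem (mem_Ioi.2 hy0)]
      exact h0 y hy0 fun h => absurd h.1 (not_le.2 hy)
    · exact indicator_of_notMem (by simpa using hy0) _

theorem continuous_indicator_Ioi {f : ℝ → ℝ} {a b : ℝ} (ha : 0 < a) (hf : ContinuousOn f (Ioi 0))
    (h0 : ∀ x > 0, x ∉ Icc a b → f x = 0) : Continuous ((Ioi 0).indicator f) := by
  refine continuous_iff_continuousAt.2 fun x => ?_
  rcases lt_or_ge 0 x with hx | hx
  · refine (hf.continuousAt (Ioi_mem_nhds hx)).congr ?_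
    filter_upwards [Ioi_mem_nhds hx] with y hy using (indicator_of_mem hy _).symm
  · refine (continuousAt_const (y := (0 : ℝ))).congr ?_
    filter_upwards [Iio_mem_nhds (hx.trans_lt ha)] with y hy
    by_cases hy0 : 0 < y
    · rw [indicator_of_mem (mem_Ioi.2 hy0), h0 y hy0 fun h => absurd h.1 (not_le.2 hy)]
    · exact (indicator_of_notMem (by simpa using hy0) _).symm

/-- Extension by zero to the line is of class C², because the support stays away from 0; there V' =
y₁/x and V'' = (y₂ - y₁)/x². -/
theorem NonnegOnTests.of_compact {p q : Quartic} {α : ℝ} (H : NonnegOnTests p q α)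
    {y₀ y₁ y₂ : ℝ → ℝ} (d₀ : ∀ x > 0, HasDerivAt y₀ (y₁ x / x) x)
    (d₁ : ∀ x > 0, HasDerivAt y₁ (y₂ x / x) x) (c₂ : ContinuousOn y₂ (Ioi 0)) {a b : ℝ} (ha : 0 < a)
    (h₀ : ∀ x > 0, x ∉ Icc a b → y₀ x = 0) (h₁ : ∀ x > 0, x ∉ Icc a b → y₁ x = 0)
    (h₂ : ∀ x > 0, x ∉ Icc a b → y₂ x = 0) : 0 ≤ energy p q α y₀ y₁ y₂ := by
  have c₁ : ContinuousOn y₁ (Ioi 0) := fun x hx => (d₁ x hx).continuousAt.continuousWithinAt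
  have D0 : ∀ x, HasDerivAt ((Ioi 0).indicator y₀) ((Ioi 0).indicator (fun x => y₁ x / x) x) x :=
    hasDerivAt_indicator_Ioi ha d₀ h₀
  have D1 : ∀ x, HasDerivAt ((Ioi 0).indicator (fun x => y₁ x / x))
      ((Ioi 0).indicator (fun x => (y₂ x - y₁ x) / x ^ 2) x) x :=
    hasDerivAt_indicator_Ioi ha (fun x hx => by
      have := (d₁ x hx).div (hasDerivAt_id x) hx.ne'
      refine this.congr_deriv ?_
      have := hx.ne'
      simp only [id_eq]
      field_simp) fun x hx hxm => by rw [h₁ x hx hxm, zero_div]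
  have C2 : Continuous ((Ioi 0).indicator (fun x => (y₂ x - y₁ x) / x ^ 2)) :=
    continuous_indicator_Ioi ha ((c₂.sub c₁).div (continuousOn_pow 2)
      fun x hx => pow_ne_zero 2 (ne_of_gt (mem_Ioi.1 hx)))
      fun x hx hxm => by rw [h₁ x hx hxm, h₂ x hx hxm, sub_zero, zero_div]
  have e0 := funext fun x => (D0 x).deriv
  have e1 := funext fun x => (D1 x).deriv
  have hV : ContDiff ℝ 2 ((Ioi 0).indicator y₀) := by
    rw [← one_add_one_eq_two, contDiff_succ_iff_deriv]
    refine ⟨fun x => (D0 x).differentiableAt, by simp, ?_⟩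
    change ContDiff ℝ 1 (fun x => deriv ((Ioi 0).indicator y₀) x)
    rw [e0, contDiff_one_iff_deriv]
    refine ⟨fun x => (D1 x).differentiableAt, ?_⟩
    change Continuous (fun x => deriv ((Ioi 0).indicator fun x => y₁ x / x) x)
    rwa [e1]
  have key := H.of_contDiff hV ha (b := b) fun x hx => by
    by_cases hx0 : 0 < x
    · rw [indicator_of_mem (mem_Ioi.2 hx0), h₀ x hx0 hx]
    · exact indicator_of_notMem (by simpa using hx0) _
  refine key.trans_eq ?_
  have e0' : deriv ((Ioi 0).indicator y₀) = (Ioi 0).indicator (fun x => y₁ x / x) := e0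
  have e1' : deriv ((Ioi 0).indicator fun x => y₁ x / x) =
    (Ioi 0).indicator (fun x => (y₂ x - y₁ x) / x ^ 2) := e1
  rw [e0', e1']
  refine setIntegral_congr_fun measurableSet_Ioi fun x hx => ?_
  have hx0 : x ≠ 0 := ne_of_gt (mem_Ioi.1 hx)
  simp only [indicator_of_mem hx]
  rw [mul_div_cancel₀ _ hx0, mul_div_cancel₀ _ (pow_ne_zero 2 hx0), add_sub_cancel]

/-- The cut-offs are χ(ε log x). Each application of D to such a function costs a factor ε, so the
commutator terms disappear as ε → 0, and everything is dominated by a multiple of |y₀| + |y₁| +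
|y₂|. -/
theorem NonnegOnTests.of_weightedL2 {p q : Quartic} {α : ℝ} (H : NonnegOnTests p q α)
    {y₀ y₁ y₂ : ℝ → ℝ} (d₀ : ∀ x > 0, HasDerivAt y₀ (y₁ x / x) x)
    (d₁ : ∀ x > 0, HasDerivAt y₁ (y₂ x / x) x) (c₂ : ContinuousOn y₂ (Ioi 0))
    (hy : ∀ β, β = α + 1 / 2 ∨ β = α + 1 → WeightedL2 β y₀ ∧ WeightedL2 β y₁ ∧ WeightedL2 β y₂) :
    0 ≤ energy p q α y₀ y₁ y₂ := by
  have c₀ : ContinuousOn y₀ (Ioi 0) := fun x hx => (d₀ x hx).continuousAt.continuousWithinAt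
  have c₁ : ContinuousOn y₁ (Ioi 0) := fun x hx => (d₁ x hx).continuousAt.continuousWithinAt
  let χ : ContDiffBump (0 : ℝ) := ⟨1, 2, one_pos, one_lt_two⟩
  have hχ : IsTestIn univ (χ : ℝ → ℝ) := ⟨χ.contDiff, χ.hasCompactSupport, subset_univ _⟩
  have hχ1 := hχ.differentiate
  have hχ2 := hχ1.differentiate
  have hsup : tsupport (χ : ℝ → ℝ) ⊆ Icc (-2) 2 := by
    rw [χ.tsupport_eq, Real.closedBall_eq_Icc]; simp [χ]
  have z0 : ∀ s ∉ Icc (-2 : ℝ) 2, χ s = 0 := fun s hs =>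
    image_eq_zero_of_notMem_tsupport fun h => hs (hsup h)
  have z1 : ∀ s ∉ Icc (-2 : ℝ) 2, deriv χ s = 0 := fun s hs =>
    image_eq_zero_of_notMem_tsupport fun h => hs (hsup (tsupport_deriv_subset h))
  have z2 : ∀ s ∉ Icc (-2 : ℝ) 2, deriv (deriv χ) s = 0 := fun s hs =>
    image_eq_zero_of_notMem_tsupport fun h =>
      hs (hsup (tsupport_deriv_subset (tsupport_deriv_subset h)))
  obtain ⟨M₁, hM₁⟩ := hχ1.continuous.bounded_above_of_compact_support hχ1.2.1
  obtain ⟨M₂, hM₂⟩ := hχ2.continuous.bounded_above_of_compact_support hχ2.2.1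
  set M := max 1 (max M₁ M₂) with hM
  have b0 : ∀ s, |χ s| ≤ M := fun s => by
    rw [abs_of_nonneg χ.nonneg]; exact χ.le_one.trans (le_max_left _ _)
  have b1 : ∀ s, |deriv χ s| ≤ M := fun s =>
    (hM₁ s).trans ((le_max_left _ _).trans (le_max_right _ _))
  have b2 : ∀ s, |deriv (deriv χ) s| ≤ M := fun s =>
    (hM₂ s).trans ((le_max_right _ _).trans (le_max_right _ _))
  have hM1 : 1 ≤ M := le_max_left _ _
  -- the cut-off at scale `n + 1` in the variable `log x`
  let ε : ℕ → ℝ := fun n => 1 / ((n : ℝ) + 1)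
  have ε0 : ∀ n, 0 < ε n := fun n => by simp only [ε]; positivity
  have ε1 : ∀ n, ε n ≤ 1 := fun n => by
    simp only [ε]
    rw [div_le_one (by positivity)]; linarith [(Nat.cast_nonneg n : (0 : ℝ) ≤ n)]
  have εt : Tendsto ε atTop (𝓝 0) := tendsto_one_div_add_atTop_nhds_zero_nat
  let f0 : ℕ → ℝ → ℝ := fun n x => χ (ε n * Real.log x)
  let f1 : ℕ → ℝ → ℝ := fun n x => ε n * deriv χ (ε n * Real.log x)
  let f2 : ℕ → ℝ → ℝ := fun n x => ε n * (ε n * deriv (deriv χ) (ε n * Real.log x))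
  have hlog : ∀ n, ∀ x > 0, HasDerivAt (fun x => ε n * Real.log x) (ε n * x⁻¹) x := fun n x hx =>
    (Real.hasDerivAt_log hx.ne').const_mul _
  have df0 : ∀ n, ∀ x > 0, HasDerivAt (f0 n) (f1 n x / x) x := fun n x hx => by
    have := (hχ.differentiable (ε n * Real.log x)).hasDerivAt.comp x (hlog n x hx)
    refine this.congr_deriv ?_
    simp only [f1]; ring
  have df1 : ∀ n, ∀ x > 0, HasDerivAt (f1 n) (f2 n x / x) x := fun n x hx => by
    have := ((hχ1.differentiable (ε n * Real.log x)).hasDerivAt.comp x (hlog n x hx)).const_mul (ε n)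
    refine this.congr_deriv ?_
    simp only [f2]; ring
  have cl : ∀ n, ContinuousOn (fun x => ε n * Real.log x) (Ioi 0) := fun n x hx =>
    (hlog n x hx).continuousAt.continuousWithinAt
  have cf0 : ∀ n, ContinuousOn (f0 n) (Ioi 0) := fun n => hχ.continuous.comp_continuousOn (cl n)
  have cf1 : ∀ n, ContinuousOn (f1 n) (Ioi 0) := fun n =>
    continuousOn_const.mul (hχ1.continuous.comp_continuousOn (cl n))
  have cf2 : ∀ n, ContinuousOn (f2 n) (Ioi 0) := fun n =>
    continuousOn_const.mul (continuousOn_const.mul (hχ2.continuous.comp_continuousOn (cl n)))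
  have bf0 : ∀ n x, |f0 n x| ≤ M := fun n x => b0 _
  have bf1 : ∀ n x, |f1 n x| ≤ M := fun n x => by
    simp only [f1]
    rw [abs_mul, abs_of_pos (ε0 n)]
    calc ε n * |deriv χ (ε n * Real.log x)| ≤ 1 * M :=
          mul_le_mul (ε1 n) (b1 _) (abs_nonneg _) zero_le_one
      _ = M := one_mul M
  have bf2 : ∀ n x, |f2 n x| ≤ M := fun n x => by
    simp only [f2]
    rw [abs_mul, abs_mul, abs_of_pos (ε0 n)]
    calc ε n * (ε n * |deriv (deriv χ) (ε n * Real.log x)|) ≤ 1 * (1 * M) :=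
          mul_le_mul (ε1 n) (mul_le_mul (ε1 n) (b2 _) (abs_nonneg _) zero_le_one)
            (mul_nonneg (ε0 n).le (abs_nonneg _)) zero_le_one
      _ = M := by ring
  have hlt : ∀ x, Tendsto (fun n => ε n * Real.log x) atTop (𝓝 0) := fun x => by
    simpa using εt.mul_const (Real.log x)
  have tf0 : ∀ x, Tendsto (fun n => f0 n x) atTop (𝓝 1) := fun x => by
    have h1 : χ 0 = 1 := χ.one_of_mem_closedBall (Metric.mem_closedBall_self χ.rIn_pos.le)
    rw [← h1]
    exact (hχ.continuous.tendsto 0).comp (hlt x)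
  have tf1 : ∀ x, Tendsto (fun n => f1 n x) atTop (𝓝 0) := fun x => by
    have := εt.mul ((hχ1.continuous.tendsto 0).comp (hlt x))
    rwa [zero_mul] at this
  have tf2 : ∀ x, Tendsto (fun n => f2 n x) atTop (𝓝 0) := fun x => by
    have := εt.mul (εt.mul ((hχ2.continuous.tendsto 0).comp (hlt x)))
    rwa [zero_mul] at this
  have hout : ∀ n, ∀ x > 0, x ∉ Icc (Real.exp (-2 / ε n)) (Real.exp (2 / ε n)) →
      ε n * Real.log x ∉ Icc (-2 : ℝ) 2 := fun n x hx hxm h => by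
    refine hxm ⟨?_, ?_⟩
    · rw [← Real.le_log_iff_exp_le hx, div_le_iff₀ (ε0 n)]; linarith [h.1]
    · rw [← Real.log_le_iff_le_exp hx, le_div_iff₀ (ε0 n)]; linarith [h.2]
  let Y0 : ℕ → ℝ → ℝ := fun n x => f0 n x * y₀ x
  let Y1 : ℕ → ℝ → ℝ := fun n x => f1 n x * y₀ x + f0 n x * y₁ x
  let Y2 : ℕ → ℝ → ℝ := fun n x => f2 n x * y₀ x + 2 * f1 n x * y₁ x + f0 n x * y₂ x
  have dY0 : ∀ n, ∀ x > 0, HasDerivAt (Y0 n) (Y1 n x / x) x := fun n x hx => by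
    refine ((df0 n x hx).mul (d₀ x hx)).congr_deriv ?_
    simp only [Y1]; ring
  have dY1 : ∀ n, ∀ x > 0, HasDerivAt (Y1 n) (Y2 n x / x) x := fun n x hx => by
    refine (((df1 n x hx).mul (d₀ x hx)).add ((df0 n x hx).mul (d₁ x hx))).congr_deriv ?_
    simp only [Y2]; ring
  have cY0 : ∀ n, ContinuousOn (Y0 n) (Ioi 0) := fun n => (cf0 n).mul c₀
  have cY1 : ∀ n, ContinuousOn (Y1 n) (Ioi 0) := fun n => ((cf1 n).mul c₀).add ((cf0 n).mul c₁)
  have cY2 : ∀ n, ContinuousOn (Y2 n) (Ioi 0) := fun n =>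
    (((cf2 n).mul c₀).add ((continuousOn_const.mul (cf1 n)).mul c₁)).add ((cf0 n).mul c₂)
  let m : ℝ → ℝ := fun x => 2 * M * (|y₀ x| + |y₁ x| + |y₂ x|)
  have hm : ∀ β, β = α + 1 / 2 ∨ β = α + 1 → WeightedL2 β m := fun β hβ =>
    (((hy β hβ).1.abs.add (hy β hβ).2.1.abs).add (hy β hβ).2.2.abs).const_mul _
  have hmm : ∀ {A B C a b c : ℝ}, |A| ≤ M → |B| ≤ 2 * M → |C| ≤ M →
      |A * a + B * b + C * c| ≤ 2 * M * (|a| + |b| + |c|) := fun {A B C a b c} hA hB hC => by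
    refine (abs_add_le _ _).trans ((add_le_add_left (abs_add_le _ _) _).trans ?_)
    rw [abs_mul, abs_mul, abs_mul]
    have hA' : |A| ≤ 2 * M := by linarith
    have hC' : |C| ≤ 2 * M := by linarith
    nlinarith [mul_le_mul_of_nonneg_right hA' (abs_nonneg a),
      mul_le_mul_of_nonneg_right hB (abs_nonneg b), mul_le_mul_of_nonneg_right hC' (abs_nonneg c)]
  have bY0 : ∀ n, ∀ x > 0, |Y0 n x| ≤ m x := fun n x _ => by
    have := hmm (A := f0 n x) (B := 0) (C := 0) (a := y₀ x) (b := y₁ x) (c := y₂ x) (bf0 n x)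
      (by simp; linarith) (by simp; linarith)
    simpa [Y0, m] using this
  have bY1 : ∀ n, ∀ x > 0, |Y1 n x| ≤ m x := fun n x _ => by
    have := hmm (A := f1 n x) (B := f0 n x) (C := 0) (a := y₀ x) (b := y₁ x) (c := y₂ x) (bf1 n x)
      ((bf0 n x).trans (by linarith)) (by simp; linarith)
    simpa [Y1, m] using this
  have bY2 : ∀ n, ∀ x > 0, |Y2 n x| ≤ m x := fun n x _ =>
    hmm (A := f2 n x) (B := 2 * f1 n x) (C := f0 n x) (bf2 n x)
      (by rw [abs_mul, abs_two]; linarith [bf1 n x]) (bf0 n x)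
  have wY : ∀ (Y : ℝ → ℝ), ContinuousOn Y (Ioi 0) → (∀ x > 0, |Y x| ≤ m x) →
      ∀ β, β = α + 1 / 2 ∨ β = α + 1 → WeightedL2 β Y := fun Y hc hb β hβ => by
    have hpow : ContinuousOn (fun x : ℝ => x ^ (-β - 1 / 2)) (Ioi 0) :=
      continuousOn_id.rpow_const fun x hx => Or.inl (ne_of_gt (mem_Ioi.1 hx))
    refine MemLp.mono (hm β hβ) ((hpow.mul hc).aestronglyMeasurable measurableSet_Ioi) ?_
    filter_upwards [ae_restrict_mem measurableSet_Ioi] with x hx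
    rw [norm_mul, norm_mul]
    gcongr
    exact (hb x hx).trans (le_abs_self _)
  have hlim := tendsto_energy p q (Y₀ := Y0) (Y₁ := Y1) (Y₂ := Y2) hm
    (fun n β hβ => ⟨wY _ (cY0 n) (bY0 n) β hβ, wY _ (cY1 n) (bY1 n) β hβ,
      wY _ (cY2 n) (bY2 n) β hβ⟩) hy cY0 cY1 cY2 bY0 bY1 bY2
    (fun x _ => by simpa using (tf0 x).mul_const (y₀ x))
    (fun x _ => by simpa using ((tf1 x).mul_const (y₀ x)).add ((tf0 x).mul_const (y₁ x)))
    (fun x _ => by simpa using (((tf2 x).mul_const (y₀ x)).add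
      (((tf1 x).const_mul 2).mul_const (y₁ x))).add ((tf0 x).mul_const (y₂ x)))
  refine ge_of_tendsto' hlim fun n => H.of_compact (dY0 n) (dY1 n) (cY2 n)
    (Real.exp_pos (-2 / ε n)) (b := Real.exp (2 / ε n)) ?_ ?_ ?_
  · intro x hx hxm
    simp only [Y0, f0, z0 _ (hout n x hx hxm), zero_mul]
  · intro x hx hxm
    simp only [Y1, f0, f1, z0 _ (hout n x hx hxm), z1 _ (hout n x hx hxm), zero_mul, mul_zero,
      add_zero]
  · intro x hx hxm
    simp only [Y2, f0, f1, f2, z0 _ (hout n x hx hxm), z1 _ (hout n x hx hxm),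
      z2 _ (hout n x hx hxm), zero_mul, mul_zero, add_zero]

theorem NonnegOnTests.integral_nonneg {p q : Quartic} {α : ℝ} (H : NonnegOnTests p q α)
    {w : ℕ → ℝ → ℝ} (hw : ∀ j < 4, IsLogPrim (w j) (w (j + 1)))
    (hL : ∀ β, β = α + 1 / 2 ∨ β = α + 1 → ∀ j ≤ 4, WeightedL2 β (w j)) :
    0 ≤ ∫ x in Ioi 0, x ^ (-2 * α) * (x⁻¹ * p.comb (fun j => w j x) +
      (x ^ 2)⁻¹ * q.comb (fun j => w j x)) * w 0 x / x := by
  rw [integral_comb_eq_energy p q hw hL]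
  have w01 := hw 0 (by norm_num)
  have w12 := hw 1 (by norm_num)
  have w23 := hw 2 (by norm_num)
  exact H.of_weightedL2 (fun x hx => w01.hasDerivAt w12.continuousOn hx)
    (fun x hx => w12.hasDerivAt w23.continuousOn hx) w23.continuousOn
    fun β hβ => ⟨hL β hβ 0 (by norm_num), hL β hβ 1 (by norm_num), hL β hβ 2 (by norm_num)⟩

/-! ### Explicit weights -/

/-- The form is diagonal in z₂, z₁, y₀ with positive coefficients 1, -p''(β)/2, p(β), and (y₀, y₁,
y₂) ↦ (y₀, z₁, z₂) is a triangular, invertible change of variables. -/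
theorem Quartic.exists_form_ge (p : Quartic) {β : ℝ} (h1 : p.halfSnd β < 0) (h0 : 0 < p.value β) :
    ∃ c, 0 < c ∧ ∀ y₀ y₁ y₂ : ℝ, c * (y₀ ^ 2 + y₁ ^ 2 + y₂ ^ 2) ≤ p.form β y₀ y₁ y₂ := by
  -- The sum of all the coefficients in the bounds for y₀², y₁² (`a1`) and y₂² (`a2`) by z₂², z₁²,
  -- y₀².
  set K := 6 + 14 * β ^ 2 + 3 * β ^ 4 with hK
  have hK0 : 0 < K := by positivity
  set e := min 1 (min (-p.halfSnd β) (p.value β)) with he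
  have he0 : 0 < e := lt_min one_pos (lt_min (neg_pos.2 h1) h0)
  refine ⟨e / K, div_pos he0 hK0, fun y₀ y₁ y₂ => ?_⟩
  set z₁ := y₁ - β * y₀ with hz₁
  set z₂ := y₂ - 2 * β * y₁ + β ^ 2 * y₀ with hz₂
  have k1 : y₀ ^ 2 + y₁ ^ 2 + y₂ ^ 2 ≤ K * (z₂ ^ 2 + z₁ ^ 2 + y₀ ^ 2) := by
    have e1 : y₁ = z₁ + β * y₀ := by rw [hz₁]; ring
    have e2 : y₂ = z₂ + 2 * β * z₁ + β ^ 2 * y₀ := by rw [hz₁, hz₂]; ring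
    have a1 : y₁ ^ 2 ≤ 2 * z₁ ^ 2 + 2 * β ^ 2 * y₀ ^ 2 := by
      rw [e1]; nlinarith [sq_nonneg (z₁ - β * y₀)]
    have a2 : y₂ ^ 2 ≤ 3 * z₂ ^ 2 + 12 * β ^ 2 * z₁ ^ 2 + 3 * β ^ 4 * y₀ ^ 2 := by
      rw [e2]
      nlinarith [sq_nonneg (z₂ - 2 * β * z₁), sq_nonneg (z₂ - β ^ 2 * y₀),
        sq_nonneg (2 * β * z₁ - β ^ 2 * y₀)]
    have a3 : K * (z₂ ^ 2 + z₁ ^ 2 + y₀ ^ 2) - (y₀ ^ 2 + (2 * z₁ ^ 2 + 2 * β ^ 2 * y₀ ^ 2) +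
        (3 * z₂ ^ 2 + 12 * β ^ 2 * z₁ ^ 2 + 3 * β ^ 4 * y₀ ^ 2)) =
        3 * z₂ ^ 2 + 4 * z₁ ^ 2 + 5 * y₀ ^ 2 + β ^ 2 * (14 * z₂ ^ 2 + 2 * z₁ ^ 2 + 12 * y₀ ^ 2) +
        β ^ 4 * (3 * z₂ ^ 2 + 3 * z₁ ^ 2) := by rw [hK]; ring
    have a4 : 0 ≤ 3 * z₂ ^ 2 + 4 * z₁ ^ 2 + 5 * y₀ ^ 2 +
        β ^ 2 * (14 * z₂ ^ 2 + 2 * z₁ ^ 2 + 12 * y₀ ^ 2) +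
        β ^ 4 * (3 * z₂ ^ 2 + 3 * z₁ ^ 2) := by positivity
    linarith
  have k2 : e * (z₂ ^ 2 + z₁ ^ 2 + y₀ ^ 2) ≤ p.form β y₀ y₁ y₂ := by
    have l1 : e ≤ 1 := min_le_left _ _
    have l2 : e ≤ -p.halfSnd β := (min_le_right _ _).trans (min_le_left _ _)
    have l3 : e ≤ p.value β := (min_le_right _ _).trans (min_le_right _ _)
    have := mul_le_mul_of_nonneg_right l1 (sq_nonneg z₂)
    have := mul_le_mul_of_nonneg_right l2 (sq_nonneg z₁)
    have := mul_le_mul_of_nonneg_right l3 (sq_nonneg y₀)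
    simp only [form]
    linarith
  calc e / K * (y₀ ^ 2 + y₁ ^ 2 + y₂ ^ 2) ≤ e / K * (K * (z₂ ^ 2 + z₁ ^ 2 + y₀ ^ 2)) := by gcongr
    _ = e * (z₂ ^ 2 + z₁ ^ 2 + y₀ ^ 2) := by field_simp
    _ ≤ _ := k2

theorem wNormSq_two_eq {w : ℝ → ℝ} (h : IsTest w) (β : ℝ) :
    IntegrableOn (fun x => x ^ (-2 * β - 1) * (w x ^ 2 + logD w 1 x ^ 2 + logD w 2 x ^ 2)) (Ioi 0) ∧
    wNormSq 2 β w = ∫ x in Ioi 0,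
      x ^ (-2 * β - 1) * (w x ^ 2 + logD w 1 x ^ 2 + logD w 2 x ^ 2) := by
  have i : ∀ j, IntegrableOn (fun x => x ^ (-2 * β - 1) *
      (logD w j x * logD w j x)) (Ioi 0) := fun j =>
    ((h.logD j).weightedL2 β).integrableOn_mul ((h.logD j).weightedL2 β)
  have e : ∀ j, wInner β ((shiftD 0)^[j] w) ((shiftD 0)^[j] w) =
      ∫ x in Ioi 0, x ^ (-2 * β - 1) * (logD w j x * logD w j x) := fun j => by
    refine setIntegral_congr_fun measurableSet_Ioi fun x hx => ?_
    simp only [logD]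
    rw [Real.rpow_sub_one (ne_of_gt (mem_Ioi.1 hx))]
    ring
  have hs : ∀ x, x ^ (-2 * β - 1) * (w x ^ 2 + logD w 1 x ^ 2 + logD w 2 x ^ 2) =
      x ^ (-2 * β - 1) * (logD w 0 x * logD w 0 x) +
      x ^ (-2 * β - 1) * (logD w 1 x * logD w 1 x) +
      x ^ (-2 * β - 1) * (logD w 2 x * logD w 2 x) := fun x => by
    rw [show logD w 0 x = w x from rfl]; ring
  simp only [hs]
  have i01 : IntegrableOn (fun x => x ^ (-2 * β - 1) * (logD w 0 x * logD w 0 x) +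
      x ^ (-2 * β - 1) * (logD w 1 x * logD w 1 x)) (Ioi 0) := (i 0).add (i 1)
  refine ⟨i01.add (i 2), ?_⟩
  rw [integral_add i01 (i 2), integral_add (i 0) (i 1), wNormSq]
  simp only [e, Finset.sum_range_succ, Finset.sum_range_zero, zero_add]

theorem mem_coercivityRange_of_quartic {L : (ℝ → ℝ) → ℝ → ℝ} {p q : Quartic}
    (hL : ∀ w, IsTest w → L w = opOf p q w) {α : ℝ} (p1 : p.halfSnd (α + 1 / 2) < 0)
    (p0 : 0 < p.value (α + 1 / 2)) (q1 : q.halfSnd (α + 1) < 0) (q0 : 0 < q.value (α + 1)) :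
    α ∈ coercivityRange L := by
  obtain ⟨c, hc, hcp⟩ := p.exists_form_ge p1 p0
  obtain ⟨d, hd, hdq⟩ := q.exists_form_ge q1 q0
  refine ⟨min c d, lt_min hc hd, fun w hw => ?_⟩
  have W := fun β => And.intro (hw.weightedL2 β) (And.intro ((hw.logD 1).weightedL2 β)
    ((hw.logD 2).weightedL2 β))
  rw [hL w hw, hw.wInner_opOf, energy_eq p q fun β _ => W β, mul_add]
  refine add_le_add ?_ ?_
  · obtain ⟨hi, he⟩ := wNormSq_two_eq hw (α + 1 / 2)
    rw [he, ← integral_const_mul]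
    refine setIntegral_mono_on (hi.const_mul _)
      (p.integrableOn_form _ (W _).1 (W _).2.1 (W _).2.2) measurableSet_Ioi fun x hx => ?_
    rw [mul_left_comm]
    refine mul_le_mul_of_nonneg_left (le_trans ?_ (hcp _ _ _))
      (Real.rpow_nonneg (le_of_lt hx) _)
    exact mul_le_mul_of_nonneg_right (min_le_left _ _) (by positivity)
  · obtain ⟨hi, he⟩ := wNormSq_two_eq hw (α + 1)
    rw [he, ← integral_const_mul]
    refine setIntegral_mono_on (hi.const_mul _)
      (q.integrableOn_form _ (W _).1 (W _).2.1 (W _).2.2) measurableSet_Ioi fun x hx => ?_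
    rw [mul_left_comm]
    refine mul_le_mul_of_nonneg_left (le_trans ?_ (hdq _ _ _))
      (Real.rpow_nonneg (le_of_lt hx) _)
    exact mul_le_mul_of_nonneg_right (min_le_right _ _) (by positivity)

/-- With s = α - 1/2 the values are p̃ = (1 - s²)² and q̃ = (9/4 - s²)(1/4 - s²), while the halved
second derivatives are 6s² - 2 and 6s² - 5/2. The restrictive condition is s² < 1/4, from q̃ > 0. -/
theorem Ioo_subset_coercivityRange_opTilde : Ioo (0 : ℝ) 1 ⊆ coercivityRange opTilde := by
  rintro α ⟨h0, h1⟩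
  have hb : (α - 1 / 2) ^ 2 < 1 / 4 := by nlinarith
  refine mem_coercivityRange_of_quartic (p := pTilde) (q := qTilde) (fun w hw => opTilde_eq hw)
    ?_ ?_ ?_ ?_ <;> simp only [pTilde, qTilde, Quartic.halfSnd, Quartic.value]
  · nlinarith
  · have : 0 < (1 - (α - 1 / 2) ^ 2) ^ 2 := pow_pos (by linarith) 2
    nlinarith
  · nlinarith
  · have : 0 < (9 / 4 - (α - 1 / 2) ^ 2) * (1 / 4 - (α - 1 / 2) ^ 2) :=
      mul_pos (by linarith) (by linarith)
    nlinarith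

/-- With s = α - 1, q̌ = (4 - s²)(1 - s²) and q̌''/2 = 6s² - 5, whence the lower end 1 - √(5/6). The
upper end comes from p̌ = (α + 1/2)²(3/2 - α)(5/2 - α) and p̌''/2 = -6α(3/2 - α). -/
theorem Ioo_subset_coercivityRange_opCheck :
    Ioo (1 - √(5 / 6 : ℝ)) (3 / 2) ⊆ coercivityRange opCheck := by
  rintro α ⟨h0, h1⟩
  have hs : √(5 / 6 : ℝ) ^ 2 = 5 / 6 := Real.sq_sqrt (by norm_num)
  have hs0 : 0 ≤ √(5 / 6 : ℝ) := Real.sqrt_nonneg _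
  have hs1 : √(5 / 6 : ℝ) < 1 := by
    rw [Real.sqrt_lt' one_pos]; norm_num
  have hs2 : 1 / 2 < √(5 / 6 : ℝ) := by
    rw [Real.lt_sqrt (by norm_num)]; norm_num
  have hb : (α - 1) ^ 2 < 5 / 6 := by
    rw [← hs]
    exact sq_lt_sq' (by linarith) (by linarith)
  refine mem_coercivityRange_of_quartic (p := pCheck) (q := qCheck) (fun w hw => opCheck_eq hw)
    ?_ ?_ ?_ ?_ <;> simp only [pCheck, qCheck, Quartic.halfSnd, Quartic.value]
  · nlinarith [mul_pos (show 0 < α by linarith) (show 0 < 3 / 2 - α by linarith)]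
  · have : 0 < (α + 1 / 2) ^ 2 * ((3 / 2 - α) * (5 / 2 - α)) := by
      have : 0 < α + 1 / 2 := by linarith
      have : 0 < 3 / 2 - α := by linarith
      have : 0 < 5 / 2 - α := by linarith
      positivity
    linarith
  · linarith
  · have : 0 < (4 - (α - 1) ^ 2) * (1 - (α - 1) ^ 2) := mul_pos (by linarith) (by linarith)
    linarith

end ThinFilm

/-! ### The algebra of adjoint operators on test functions -/

namespace ThinFilm

/-- The space of test functions on `(0, ∞)`. -/
def testSpace : Submodule ℝ (ℝ → ℝ) where
  carrier := {ψ | IsTest ψ}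
  add_mem' h h' := IsTestIn.add h h'
  zero_mem' := IsTestIn.zero
  smul_mem' c _ h := IsTestIn.const_mul c h

theorem IsTest.inv_mul {ψ : ℝ → ℝ} (h : IsTest ψ) : IsTest fun x => x⁻¹ * ψ x := by
  have hs : tsupport (fun x => x⁻¹ * ψ x) ⊆ tsupport ψ := tsupport_mul_subset_right
  refine ⟨?_, h.2.1.of_isClosed_subset (isClosed_tsupport _) hs, hs.trans h.2.2⟩
  refine contDiff_iff_contDiffAt.2 fun x => ?_
  by_cases hx : x ∈ tsupport ψ
  · exact (contDiffAt_inv ℝ (ne_of_gt (h.2.2 hx))).mul h.1.contDiffAt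
  · refine (contDiffAt_const (c := (0 : ℝ))).congr_of_eventuallyEq ?_
    filter_upwards [(isClosed_tsupport ψ).isOpen_compl.mem_nhds hx] with y hy
    rw [image_eq_zero_of_notMem_tsupport hy, mul_zero]

/-- The adjoint `ψ ↦ -(x ψ)'` of `D`. -/
noncomputable def adjLog : Module.End ℝ testSpace where
  toFun ψ := ⟨fun x => -1 * deriv (fun y => y * ψ.1 y) x,
    IsTestIn.const_mul _ (IsTestIn.smul_left ψ.2 contDiff_id).differentiate⟩
  map_add' ψ φ := by
    ext x
    have h1 := (IsTestIn.smul_left ψ.2 contDiff_id).differentiable x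
    have h2 := (IsTestIn.smul_left φ.2 contDiff_id).differentiable x
    simp only [id] at h1 h2
    change -1 * deriv (fun y => y * (ψ.1 y + φ.1 y)) x = -1 * deriv (fun y => y * ψ.1 y) x +
      -1 * deriv (fun y => y * φ.1 y) x
    simp only [mul_add]
    rw [deriv_fun_add h1 h2]; ring
  map_smul' c ψ := by
    ext x
    change -1 * deriv (fun y => y * (c * ψ.1 y)) x = c * (-1 * deriv (fun y => y * ψ.1 y) x)
    simp only [mul_left_comm _ c]
    rw [deriv_const_mul_field]; ring

/-- Multiplication by `x⁻¹`. -/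
noncomputable def invMul : Module.End ℝ testSpace where
  toFun ψ := ⟨fun x => x⁻¹ * ψ.1 x, IsTest.inv_mul ψ.2⟩
  map_add' ψ φ := by
    ext x
    exact mul_add _ _ _
  map_smul' c ψ := by
    ext x
    exact mul_left_comm _ _ _

theorem adjLog_apply (ψ : testSpace) (x : ℝ) :
    (adjLog ψ).1 x = -ψ.1 x - x * deriv ψ.1 x := by
  change -1 * deriv (fun y => y * ψ.1 y) x = _
  rw [deriv_fun_mul differentiableAt_fun_id (IsTestIn.differentiable ψ.2 x), deriv_id'']
  ring

theorem apply_eq_zero_of_nonpos (ψ : testSpace) {x : ℝ} (hx : ¬ 0 < x) : ψ.1 x = 0 :=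
  image_eq_zero_of_notMem_tsupport fun h => hx (ψ.2.2.2 h)

theorem mul_invMul_apply (ψ : testSpace) (x : ℝ) : x * (invMul ψ).1 x = ψ.1 x := by
  by_cases hx : 0 < x
  · exact mul_inv_cancel_left₀ hx.ne' _
  -- Test functions vanish for x ≤ 0, so the default value of x⁻¹ at 0 is harmless.
  · rw [apply_eq_zero_of_nonpos _ hx, apply_eq_zero_of_nonpos _ hx, mul_zero]

theorem deriv_eq (ψ : testSpace) : deriv ψ.1 = (-(adjLog * invMul) ψ : testSpace).1 := by
  ext x
  change _ = -(-1 * deriv (fun y => y * (invMul ψ).1 y) x)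
  simp only [mul_invMul_apply]; ring

theorem invMul_mul_adjLog : invMul * adjLog = (adjLog - 1) * invMul := by
  ext ψ x
  change x⁻¹ * (adjLog ψ).1 x = (adjLog (invMul ψ)).1 x - x⁻¹ * ψ.1 x
  rw [adjLog_apply]
  have h : (adjLog (invMul ψ)).1 x = - deriv ψ.1 x := by
    rw [deriv_eq]; exact (neg_neg _).symm
  rw [h]
  by_cases hx : 0 < x
  · have := hx.ne'
    field_simp
    ring
  · have h1 : deriv ψ.1 x = 0 :=
      image_eq_zero_of_notMem_tsupport fun h => hx (ψ.2.2.2 (tsupport_deriv_subset h))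
    rw [apply_eq_zero_of_nonpos ψ hx, h1]; simp

open Polynomial in
-- Moving x⁻¹ to the right shifts the argument of P by one. Once all powers of x⁻¹ stand on the
-- right, operator identities are identities between commuting polynomials.
theorem invMul_mul_aeval (P : ℝ[X]) :
    invMul * aeval adjLog P = aeval adjLog (P.comp (X - 1)) * invMul := by
  induction P using Polynomial.induction_on' with
  | add P Q hP hQ => rw [map_add, mul_add, hP, hQ, add_comp, map_add, add_mul]
  | monomial n a =>
    induction n with
    | zero =>
      rw [monomial_zero_left, C_comp, aeval_C]
      exact (Algebra.commutes a invMul).symm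
    | succ n ih =>
      rw [← monomial_mul_X, map_mul, ← mul_assoc, ih, mul_comp, map_mul, mul_assoc, mul_assoc,
        aeval_X, X_comp, invMul_mul_adjLog, map_sub, aeval_X, map_one]

/-- The operator `ψ ↦ ∂³ ((x³ + x²) ∂ ψ)` adjoint to `∂ (x³ + x²) ∂³`. -/
noncomputable def adjFourth (ψ : ℝ → ℝ) : ℝ → ℝ :=
  deriv (deriv (deriv fun x => (x ^ 3 + x ^ 2) * deriv ψ x))

open Polynomial in
-- On test functions ∂ = -E x⁻¹, hence ∂³ = -E(E - 1)(E - 2)x⁻³. The factor x⁻³ meets x³ + x² and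
-- leaves (1 + x⁻¹)∂ψ, which is expanded with the same rule.
theorem adjFourth_eq (ψ : testSpace) :
    adjFourth ψ.1 = ((aeval adjLog (X ^ 2 * (X - 1) * (X - 2) : ℝ[X]) * invMul +
      aeval adjLog (X * (X - 1) ^ 2 * (X - 2) : ℝ[X]) * invMul ^ 2 : Module.End ℝ testSpace)
        ψ).1 := by
  have h1 : IsTest fun x => (x ^ 3 + x ^ 2) * deriv ψ.1 x :=
    IsTestIn.smul_left (IsTestIn.differentiate ψ.2) (by fun_prop)
  let φ : testSpace := ⟨_, h1⟩
  have h2 : adjFourth ψ.1 = (-((adjLog * invMul * (adjLog * invMul) * (adjLog * invMul) :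
      Module.End ℝ testSpace) φ)).1 := by
    change deriv (deriv (deriv φ.1)) = _
    rw [deriv_eq φ, deriv_eq, deriv_eq, map_neg, map_neg, neg_neg, map_neg]
    rfl
  have hY : invMul * adjLog = aeval adjLog (X - 1 : ℝ[X]) * invMul := by
    rw [invMul_mul_adjLog, map_sub, aeval_X, map_one]
  have h3 : adjLog * invMul * (adjLog * invMul) * (adjLog * invMul) =
      aeval adjLog (X * (X - 1) * (X - 2) : ℝ[X]) * invMul ^ 3 := by
    have hc : ((X : ℝ[X]) - 1).comp (X - 1) = X - 2 := by
      simp only [sub_comp, X_comp, one_comp]; ring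
    calc adjLog * invMul * (adjLog * invMul) * (adjLog * invMul)
        = adjLog * (invMul * adjLog) * (invMul * adjLog) * invMul := by simp only [mul_assoc]
      _ = adjLog * aeval adjLog (X - 1 : ℝ[X]) * (invMul * aeval adjLog (X - 1 : ℝ[X])) *
          invMul ^ 2 := by
        rw [hY]; simp only [pow_two, mul_assoc]
      _ = _ := by
        rw [invMul_mul_aeval, hc, map_mul, map_mul, aeval_X]
        simp only [pow_succ, pow_zero, one_mul, mul_assoc]
  have h4 : (invMul ^ 3) φ = (-(adjLog * invMul + invMul * (adjLog * invMul)) :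
      Module.End ℝ testSpace) ψ := by
    ext x
    have hd : deriv ψ.1 x = -((adjLog * invMul : Module.End ℝ testSpace) ψ).1 x := by
      rw [deriv_eq ψ]; rfl
    change x⁻¹ * (x⁻¹ * (x⁻¹ * ((x ^ 3 + x ^ 2) * deriv ψ.1 x))) =
      -(((adjLog * invMul : Module.End ℝ testSpace) ψ).1 x +
        x⁻¹ * ((adjLog * invMul : Module.End ℝ testSpace) ψ).1 x)
    rw [hd]
    by_cases hx : 0 < x
    · have := hx.ne'
      field_simp
    · rw [apply_eq_zero_of_nonpos _ hx]; simp
  have h5 : adjLog * invMul + invMul * (adjLog * invMul) =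
      aeval adjLog (X : ℝ[X]) * invMul + aeval adjLog (X - 1 : ℝ[X]) * invMul ^ 2 := by
    rw [← mul_assoc invMul, hY, aeval_X, pow_two, mul_assoc _ invMul]
  have e1 : (X ^ 2 * (X - 1) * (X - 2) : ℝ[X]) = X * (X - 1) * (X - 2) * X := by ring
  have e2 : (X * (X - 1) ^ 2 * (X - 2) : ℝ[X]) = X * (X - 1) * (X - 2) * (X - 1) := by ring
  have h6 : aeval adjLog (X ^ 2 * (X - 1) * (X - 2) : ℝ[X]) * invMul +
      aeval adjLog (X * (X - 1) ^ 2 * (X - 2) : ℝ[X]) * invMul ^ 2 =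
      aeval adjLog (X * (X - 1) * (X - 2) : ℝ[X]) *
        (adjLog * invMul + invMul * (adjLog * invMul)) := by
    rw [h5, e1, e2, map_mul _ _ X, map_mul _ _ (X - 1 : ℝ[X]), mul_add, ← mul_assoc, ← mul_assoc]
  rw [h2, h3, h6]
  change (-(aeval adjLog (X * (X - 1) * (X - 2) : ℝ[X]) ((invMul ^ 3) φ))).1 = _
  rw [h4, LinearMap.neg_apply, map_neg, neg_neg]
  rfl

/-- The operator `p(E)`. -/
noncomputable def Quartic.aeval (p : Quartic) (E : Module.End ℝ testSpace) : Module.End ℝ testSpace :=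
  E ^ 4 + p.a₃ • E ^ 3 + p.a₂ • E ^ 2 + p.a₁ • E + p.a₀ • 1

/-- `r` intertwines the adjoint of `∂ (x³ + x²) ∂³` with the adjoint of `x⁻¹ p(D) + x⁻² q(D)`, and
divides the former. -/
structure Intertwines (r : Module.End ℝ testSpace) (p q : Quartic) : Prop where
  comm : ∀ ψ : testSpace, adjFourth (r ψ).1 =
    (r ((p.aeval adjLog * invMul + q.aeval adjLog * invMul ^ 2) ψ)).1
  factor : ∀ ψ : testSpace, ∃ φ : testSpace, adjFourth ψ.1 = (r φ).1

open Polynomial in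
theorem Quartic.aeval_eq (p : Quartic) (E : Module.End ℝ testSpace) :
    p.aeval E = Polynomial.aeval E
      (X ^ 4 + C p.a₃ * X ^ 3 + C p.a₂ * X ^ 2 + C p.a₁ * X + C p.a₀ : ℝ[X]) := by
  simp [Quartic.aeval, Algebra.smul_def]

open Polynomial in
-- Commuting r(E) past x⁻¹ and x⁻² replaces r by its shifts by one and two; `hp` and `hq` compare
-- the coefficients of these two powers. By `hs`, r divides ζ(ζ - 1)(ζ - 2), a common factor of both
-- symbols of the adjoint of 𝒜, which gives `factor`.
theorem intertwines_aeval {r s : ℝ[X]} {p q : Quartic}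
    (hp : X ^ 2 * (X - 1) * (X - 2) * r.comp (X - 1) =
      r * (X ^ 4 + C p.a₃ * X ^ 3 + C p.a₂ * X ^ 2 + C p.a₁ * X + C p.a₀))
    (hq : X * (X - 1) ^ 2 * (X - 2) * (r.comp (X - 1)).comp (X - 1) =
      r * (X ^ 4 + C q.a₃ * X ^ 3 + C q.a₂ * X ^ 2 + C q.a₁ * X + C q.a₀))
    (hs : X * (X - 1) * (X - 2) = r * s) : Intertwines (aeval adjLog r) p q := by
  have e1 : (X ^ 2 * (X - 1) * (X - 2) : ℝ[X]) = r * (s * X) := by rw [← mul_assoc, ← hs]; ring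
  have e2 : (X * (X - 1) ^ 2 * (X - 2) : ℝ[X]) = r * (s * (X - 1)) := by
    rw [← mul_assoc, ← hs]; ring
  have hY : invMul ^ 2 * aeval adjLog r =
      aeval adjLog ((r.comp (X - 1)).comp (X - 1)) * invMul ^ 2 := by
    rw [pow_two, mul_assoc, invMul_mul_aeval, ← mul_assoc, invMul_mul_aeval, mul_assoc]
  refine ⟨fun ψ => ?_, fun ψ => ⟨(aeval adjLog (s * X : ℝ[X]) * invMul +
      aeval adjLog (s * (X - 1) : ℝ[X]) * invMul ^ 2 : Module.End ℝ testSpace) ψ, ?_⟩⟩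
  · have h : (aeval adjLog (X ^ 2 * (X - 1) * (X - 2) : ℝ[X]) * invMul +
        aeval adjLog (X * (X - 1) ^ 2 * (X - 2) : ℝ[X]) * invMul ^ 2) * aeval adjLog r =
        aeval adjLog r * (p.aeval adjLog * invMul + q.aeval adjLog * invMul ^ 2) := by
      rw [add_mul, mul_assoc _ invMul, invMul_mul_aeval, mul_assoc _ (invMul ^ 2), hY, ← mul_assoc,
        ← mul_assoc, ← map_mul, hp, ← map_mul, hq, p.aeval_eq, q.aeval_eq, map_mul, map_mul,
        mul_add, ← mul_assoc, ← mul_assoc]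
    rw [adjFourth_eq]
    exact congrArg Subtype.val (LinearMap.congr_fun h ψ)
  · rw [adjFourth_eq, e1, e2, map_mul _ r (s * X), map_mul _ r, mul_assoc, mul_assoc, ← mul_add]
    rfl

open Polynomial in
theorem intertwines_tilde : Intertwines (aeval adjLog (X - 1 : ℝ[X])) pTilde qTilde := by
  refine intertwines_aeval (s := X * (X - 2)) ?_ ?_ (by ring) <;>
  · simp only [sub_comp, X_comp, one_comp, pTilde, qTilde, map_neg, map_ofNat, map_zero]
    ring

open Polynomial in
theorem intertwines_check :
    Intertwines (aeval adjLog ((X - 1) * (X - 2) : ℝ[X])) pCheck qCheck := by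
  have h2 : (2 : ℝ[X]).comp (X - 1) = 2 := by simp
  refine intertwines_aeval (s := X) ?_ ?_ (by ring) <;>
  · simp only [mul_comp, sub_comp, X_comp, one_comp, h2, pCheck, qCheck, map_neg,
      map_ofNat, map_zero]
    ring

end ThinFilm

/-! ### Weak formulations tested with products -/

namespace ThinFilm

/-- The time interval `(0, T)`. -/
def timeSet (T : EReal) : Set ℝ := {t | 0 < t ∧ (t : EReal) < T}

variable {T : EReal}

theorem domain_eq (T : EReal) : domain T = timeSet T ×ˢ Ioi 0 := by
  ext p
  simp only [domain, timeSet, mem_ofPred_eq, mem_prod, mem_Ioi, and_assoc]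

theorem isOpen_timeSet (T : EReal) : IsOpen (timeSet T) :=
  (isOpen_Ioi (a := (0 : ℝ))).inter (isOpen_Iio.preimage continuous_coe_real_ereal)

theorem timeSet_subset (T : EReal) : timeSet T ⊆ Ioi 0 := fun _ h => h.1

theorem ordConnected_timeSet (T : EReal) : OrdConnected (timeSet T) :=
  ⟨fun _ ha _ hb _ hc => ⟨ha.1.trans_le hc.1, (EReal.coe_le_coe_iff.2 hc.2).trans_lt hb.2⟩⟩

theorem timeSet_mem_nhdsGT (hT : 0 < T) : timeSet T ∈ 𝓝[>] (0 : ℝ) := by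
  refine inter_mem self_mem_nhdsWithin (mem_nhdsWithin_of_mem_nhds ?_)
  exact (isOpen_Iio.preimage continuous_coe_real_ereal).mem_nhds (by simpa using hT)

/-- The product `η(t) ψ(x)`. -/
def tensor (η ψ : ℝ → ℝ) : ℝ × ℝ → ℝ := fun p => η p.1 * ψ p.2

theorem isTestOn_tensor {η ψ : ℝ → ℝ} (hη : IsTestIn (timeSet T) η) (hψ : IsTest ψ) :
    IsTestOn T (tensor η ψ) := by
  have hc : IsCompact (tsupport η ×ˢ tsupport ψ) := hη.2.1.prod hψ.2.1
  have hs : tsupport (tensor η ψ) ⊆ tsupport η ×ˢ tsupport ψ := by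
    refine closure_minimal (fun p hp => ?_) ((isClosed_tsupport _).prod (isClosed_tsupport _))
    exact ⟨subset_tsupport _ (left_ne_zero_of_mul hp), subset_tsupport _ (right_ne_zero_of_mul hp)⟩
  refine ⟨(hη.1.comp contDiff_fst).mul (hψ.1.comp contDiff_snd),
    hc.of_isClosed_subset (isClosed_tsupport _) hs, hs.trans ?_⟩
  rw [domain_eq]
  exact prod_mono hη.2.2 hψ.2.2

theorem setIntegral_tensor {η ψ : ℝ → ℝ} (hη : IsTestIn (timeSet T) η) (hψ : IsTest ψ)
    (F : ℝ × ℝ → ℝ) : ∫ p in domain T, F p * tensor η ψ p = pair F η ψ :=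
  setIntegral_eq_integral_of_forall_compl_eq_zero fun p hp => by
    rw [image_eq_zero_of_notMem_tsupport fun h => hp ((isTestOn_tensor hη hψ).2.2 h), mul_zero]

theorem dx_tensor (η ψ : ℝ → ℝ) : dx (tensor η ψ) = tensor η (deriv ψ) := by
  ext p
  exact deriv_const_mul_field (𝕜 := ℝ) (η p.1)

theorem dt_tensor (η ψ : ℝ → ℝ) : dt (tensor η ψ) = tensor (deriv η) ψ := by
  ext p
  exact deriv_mul_const_field (𝕜 := ℝ) (ψ p.2)

theorem mul_tensor (a η ψ : ℝ → ℝ) :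
    (fun q => a q.2 * tensor η ψ q) = tensor η fun x => a x * ψ x := by
  ext p
  exact mul_left_comm _ _ _

open Polynomial in
theorem adjD_tensor (γ : ℝ) (η : ℝ → ℝ) (ψ : testSpace) :
    adjD γ (tensor η ψ.1) = tensor η (aeval adjLog (X - C γ) ψ).1 := by
  ext p
  have h : aeval adjLog (X - C γ) ψ = adjLog ψ - γ • ψ := by
    rw [map_sub, aeval_X, aeval_C]
    rfl
  simp only [adjD]
  rw [mul_tensor (fun x => x), dx_tensor, h]
  change -(η p.1 * deriv (fun x => x * ψ.1 x) p.2) - γ * (η p.1 * ψ.1 p.2) =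
    η p.1 * (-1 * deriv (fun x => x * ψ.1 x) p.2 - γ * ψ.1 p.2)
  ring

theorem adjA_tensor (η ψ : ℝ → ℝ) : adjA (tensor η ψ) = tensor η (adjFourth ψ) := by
  rw [adjA, dx_tensor, mul_tensor (fun x => x ^ 3 + x ^ 2), dx_tensor, dx_tensor, dx_tensor]
  rfl

theorem isTest_adjFourth (ψ : testSpace) : IsTest (adjFourth ψ.1) := by
  rw [adjFourth_eq]
  exact Subtype.prop _

section Pair

variable {I J : Set ℝ} {F G : ℝ × ℝ → ℝ} {η ψ : ℝ → ℝ}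

theorem pair_sub (hF : LocallyIntegrableOn F (I ×ˢ J)) (hG : LocallyIntegrableOn G (I ×ˢ J))
    (hη : IsTestIn I η) (hψ : IsTestIn J ψ) :
    pair (F - G) η ψ = pair F η ψ - pair G η ψ := by
  simp only [pair, Pi.sub_apply, sub_mul]
  exact integral_sub (integrable_pair hF hη hψ) (integrable_pair hG hη hψ)

theorem ae_eq_of_pair_eq (hI : IsOpen I) (hJ : IsOpen J)
    (hF : LocallyIntegrableOn F (I ×ˢ J)) (hG : LocallyIntegrableOn G (I ×ˢ J))
    (h : ∀ η ψ, IsTestIn I η → IsTestIn J ψ → pair F η ψ = pair G η ψ) :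
    F =ᵐ[volume.restrict (I ×ˢ J)] G := by
  have := ae_eq_zero_of_pair_eq_zero hI hJ (hF.sub hG) fun η ψ hη hψ => by
    rw [pair_sub hF hG hη hψ, h η ψ hη hψ, sub_self]
  filter_upwards [(ae_restrict_iff' (hI.prod hJ).measurableSet).2 this] with p hp
  exact sub_eq_zero.1 hp

end Pair

theorem IsWeakImage.pair_eq {v w : ℝ × ℝ → ℝ} {L : (ℝ × ℝ → ℝ) → ℝ × ℝ → ℝ}
    (h : IsWeakImage T L v w) {r : Module.End ℝ testSpace}
    (hL : ∀ η (ψ : testSpace), L (tensor η ψ.1) = tensor η (r ψ).1) {η : ℝ → ℝ}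
    (hη : IsTestIn (timeSet T) η) (ψ : testSpace) : pair w η ψ.1 = pair v η (r ψ).1 := by
  have := h.2 _ (isTestOn_tensor hη ψ.2)
  rwa [hL, setIntegral_tensor hη ψ.2, setIntegral_tensor hη (r ψ).2] at this

/-- `u` is a distributional solution of the homogeneous problem on `I × (0, ∞)`, tested with
products. -/
structure IsHomSolution (I : Set ℝ) (u : ℝ × ℝ → ℝ) : Prop where
  locallyIntegrable : LocallyIntegrableOn u (I ×ˢ Ioi 0)
  equation : ∀ η, IsTestIn I η → ∀ ψ : testSpace, pair u (deriv η) ψ.1 = pair u η (adjFourth ψ.1)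
  initial : ∀ ψ, IsTest ψ → Tendsto (fun t => ∫ x, u (t, x) * ψ x) (ae volume ⊓ 𝓝[>] 0) (𝓝 0)

theorem IsSolution.pair_eq {f u : ℝ × ℝ → ℝ} {u₀ : ℝ → ℝ} (hu : IsSolution T f u₀ u)
    {η : ℝ → ℝ} (hη : IsTestIn (timeSet T) η) (ψ : testSpace) :
    pair u η (adjFourth ψ.1) - pair u (deriv η) ψ.1 = pair f η ψ.1 := by
  have hli := hu.locallyIntegrable
  rw [domain_eq] at hli
  have h := hu.equation _ (isTestOn_tensor hη ψ.2)
  rw [setIntegral_tensor hη ψ.2, dt_tensor, adjA_tensor] at h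
  have h1 := integrable_pair hli hη.differentiate ψ.2
  have h2 := integrable_pair hli hη (isTest_adjFourth ψ)
  rw [← h, ← setIntegral_tensor hη (isTest_adjFourth ψ), ← setIntegral_tensor hη.differentiate ψ.2,
    ← integral_sub]
  · refine integral_congr_ae (Eventually.of_forall fun p => ?_)
    simp only
    ring
  · exact h2.integrableOn
  · exact h1.integrableOn

theorem IsSolution.sub (hT : 0 < T) {f u v : ℝ × ℝ → ℝ} {u₀ : ℝ → ℝ} (hu : IsSolution T f u₀ u)
    (hv : IsSolution T f u₀ v) : IsHomSolution (timeSet T) (u - v) := by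
  have hui := hu.locallyIntegrable
  have hvi := hv.locallyIntegrable
  rw [domain_eq] at hui hvi
  refine ⟨hui.sub hvi, fun η hη ψ => ?_, fun ψ hψ => ?_⟩
  · rw [pair_sub hui hvi hη.differentiate ψ.2, pair_sub hui hvi hη (isTest_adjFourth ψ)]
    linarith [hu.pair_eq hη ψ, hv.pair_eq hη ψ]
  · have h := (hu.initial ψ hψ).sub (hv.initial ψ hψ)
    rw [sub_self] at h
    refine h.congr' ?_
    have h1 := ae_integrable_section (isOpen_timeSet T) hui hψ
    have h2 := ae_integrable_section (isOpen_timeSet T) hvi hψ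
    filter_upwards [inf_le_left (a := ae volume) h1, inf_le_left (a := ae volume) h2,
      inf_le_right (a := ae volume) (timeSet_mem_nhdsGT hT)] with t ht1 ht2 ht
    rw [IsTestIn.setIntegral_eq hψ, IsTestIn.setIntegral_eq hψ, ← integral_sub (ht1 ht) (ht2 ht)]
    simp only [Pi.sub_apply, sub_mul]

theorem IsSolution.isHomSolution (hT : 0 < T) {u : ℝ × ℝ → ℝ}
    (hu : IsSolution T (fun _ => 0) (fun _ => 0) u) : IsHomSolution (timeSet T) u := by
  have h0 : IsSolution T (fun _ => 0) (fun _ => 0) (0 : ℝ × ℝ → ℝ) :=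
    ⟨locallyIntegrableOn_const 0, by simp, by simp, by simp⟩
  simpa using hu.sub hT h0

/-- `W 0, …, W 4` are `w, D w, …, D⁴ w`, where the distribution `w` on `I × (0, ∞)` is the image of
`u` under the operator with adjoint `r`, and are square integrable with the weights that belong to
`α + 1/2` and `α + 1`. -/
structure IsEnergyChain (I : Set ℝ) (α : ℝ) (r : Module.End ℝ testSpace) (u : ℝ × ℝ → ℝ)
    (W : ℕ → ℝ × ℝ → ℝ) : Prop where
  locallyIntegrable : ∀ j ≤ 4, LocallyIntegrableOn (W j) (I ×ˢ Ioi 0)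
  image : ∀ η, IsTestIn I η → ∀ ψ : testSpace, pair (W 0) η ψ.1 = pair u η (r ψ).1
  step : ∀ j < 4, ∀ η, IsTestIn I η → ∀ ψ : testSpace,
    pair (W (j + 1)) η ψ.1 = pair (W j) η (adjLog ψ).1
  memLp : ∀ β, β = α + 1 / 2 ∨ β = α + 1 → ∀ j ≤ 4,
    MemLp (fun p : ℝ × ℝ => p.2 ^ (-β - 1 / 2) * W j p) 2 (volume.restrict (I ×ˢ Ioi 0))

theorem IsEnergyChain.sub {I : Set ℝ} {α : ℝ} {r : Module.End ℝ testSpace} {u v : ℝ × ℝ → ℝ}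
    {W V : ℕ → ℝ × ℝ → ℝ} (hu : LocallyIntegrableOn u (I ×ˢ Ioi 0))
    (hv : LocallyIntegrableOn v (I ×ˢ Ioi 0)) (hW : IsEnergyChain I α r u W)
    (hV : IsEnergyChain I α r v V) : IsEnergyChain I α r (u - v) (W - V) where
  locallyIntegrable j hj := (hW.locallyIntegrable j hj).sub (hV.locallyIntegrable j hj)
  image η hη ψ := by
    rw [Pi.sub_apply, pair_sub (hW.locallyIntegrable 0 zero_le) (hV.locallyIntegrable 0 zero_le) hη
      ψ.2, pair_sub hu hv hη (r ψ).2, hW.image η hη, hV.image η hη]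
  step j hj η hη ψ := by
    rw [Pi.sub_apply, Pi.sub_apply, pair_sub (hW.locallyIntegrable _ hj)
      (hV.locallyIntegrable _ hj) hη ψ.2, pair_sub (hW.locallyIntegrable j hj.le)
      (hV.locallyIntegrable j hj.le) hη (adjLog ψ).2, hW.step j hj η hη, hV.step j hj η hη]
  memLp β hβ j hj := by
    refine (memLp_congr_ae (Eventually.of_forall fun p => ?_)).1
      ((hW.memLp β hβ j hj).sub (hV.memLp β hβ j hj))
    simp only [Pi.sub_apply]
    ring

theorem IsWeakChain.locallyIntegrableOn {k : ℕ} {w : ℝ × ℝ → ℝ} {W : ℕ → ℝ × ℝ → ℝ}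
    (h : IsWeakChain T k w W) (hw : LocallyIntegrableOn w (domain T)) {j : ℕ} (hj : j ≤ k) :
    LocallyIntegrableOn (W j) (timeSet T ×ˢ Ioi 0) := by
  rw [← domain_eq]
  cases j with
  | zero => rwa [h.1]
  | succ j => exact (h.2 j hj).1

theorem IsWeakChain.step {k : ℕ} {w : ℝ × ℝ → ℝ} {W : ℕ → ℝ × ℝ → ℝ} (h : IsWeakChain T k w W)
    {j : ℕ} (hj : j < k) {η : ℝ → ℝ} (hη : IsTestIn (timeSet T) η) (ψ : testSpace) :
    pair (W (j + 1)) η ψ.1 = pair (W j) η (adjLog ψ).1 :=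
  (h.2 j hj).pair_eq (fun η ψ => by
    rw [adjD_tensor, Polynomial.C_0, sub_zero, Polynomial.aeval_X]) hη ψ

/-- Each of the two weighted norms is an infimum that provides its own chain of weak derivatives;
uniqueness lets a single chain carry both bounds. -/
theorem IsWeakChain.ae_eq {k : ℕ} {w : ℝ × ℝ → ℝ} {W V : ℕ → ℝ × ℝ → ℝ}
    (h : IsWeakChain T k w W) (h' : IsWeakChain T k w V) (hw : LocallyIntegrableOn w (domain T))
    {j : ℕ} (hj : j ≤ k) : W j =ᵐ[volume.restrict (timeSet T ×ˢ Ioi 0)] V j := by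
  have key : ∀ j ≤ k, ∀ η ψ, IsTestIn (timeSet T) η → IsTestIn (Ioi 0) ψ →
      pair (W j) η ψ = pair (V j) η ψ := by
    intro j
    induction j with
    | zero => intro _ η ψ _ _; rw [h.1, h'.1]
    | succ j ih =>
      intro hj η ψ hη hψ
      rw [h.step hj hη ⟨ψ, hψ⟩, h'.step hj hη ⟨ψ, hψ⟩]
      exact ih (Nat.le_of_succ_le hj) _ _ hη (Subtype.prop _)
  exact ae_eq_of_pair_eq (isOpen_timeSet T) isOpen_Ioi (h.locallyIntegrableOn hw hj)
    (h'.locallyIntegrableOn hw hj) (key j hj)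

theorem memLp_of_lintegral_lt_top {β : ℝ} {F : ℝ × ℝ → ℝ}
    (hF : LocallyIntegrableOn F (timeSet T ×ˢ Ioi 0))
    (h : ∫⁻ p in domain T, ENNReal.ofReal (p.2 ^ (-2 * β) * (F p) ^ 2 / p.2) < ⊤) :
    MemLp (fun p : ℝ × ℝ => p.2 ^ (-β - 1 / 2) * F p) 2 (volume.restrict (timeSet T ×ˢ Ioi 0)) := by
  have hms : MeasurableSet (timeSet T ×ˢ Ioi (0 : ℝ)) :=
    ((isOpen_timeSet T).prod isOpen_Ioi).measurableSet
  have hm : AEStronglyMeasurable (fun p : ℝ × ℝ => p.2 ^ (-β - 1 / 2) * F p)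
      (volume.restrict (timeSet T ×ˢ Ioi 0)) :=
    (measurable_snd.pow_const _).aestronglyMeasurable.mul hF.aestronglyMeasurable
  rw [memLp_two_iff_integrable_sq hm]
  refine ⟨hm.pow 2, ?_⟩
  rw [domain_eq] at h
  rw [hasFiniteIntegral_iff_ofReal (Eventually.of_forall fun p => sq_nonneg _)]
  refine (setLIntegral_congr_fun hms fun p hp => ?_).trans_lt h
  have hp : 0 < p.2 := hp.2
  congr 1
  rw [mul_pow, pow_two (_ ^ _), rpow_mul_rpow_eq hp, Real.rpow_sub_one hp.ne']
  ring

theorem exists_isWeakChain {k : ℕ} {β : ℝ} {w : ℝ × ℝ → ℝ} (h : timeNormSq T k β w < ⊤) :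
    ∃ W, IsWeakChain T k w W ∧ ∀ j ≤ k,
      ∫⁻ p in domain T, ENNReal.ofReal (p.2 ^ (-2 * β) * (W j p) ^ 2 / p.2) < ⊤ := by
  simp only [timeNormSq, iInf_lt_iff] at h
  obtain ⟨W, hW, h⟩ := h
  exact ⟨W, hW, fun j hj => ENNReal.sum_lt_top.1 h j (Finset.mem_range.2 (Nat.lt_succ_of_le hj))⟩

theorem exists_isEnergyChain {α : ℝ} {u w : ℝ × ℝ → ℝ} {r : Module.End ℝ testSpace}
    (hw : LocallyIntegrableOn w (domain T))
    (hr : ∀ η, IsTestIn (timeSet T) η → ∀ ψ : testSpace, pair w η ψ.1 = pair u η (r ψ).1)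
    (h : timeNormSq T 4 (α + 1 / 2) w + timeNormSq T 4 (α + 1) w < ⊤) :
    ∃ W, IsEnergyChain (timeSet T) α r u W := by
  obtain ⟨h1, h2⟩ := ENNReal.add_lt_top.1 h
  obtain ⟨W, hW, hWL⟩ := exists_isWeakChain h1
  obtain ⟨V, hV, hVL⟩ := exists_isWeakChain h2
  refine ⟨W, fun j hj => hW.locallyIntegrableOn hw hj, fun η hη ψ => ?_,
    fun j hj η hη ψ => hW.step hj hη ψ, ?_⟩
  · rw [hW.1, hr η hη]
  · rintro β (rfl | rfl) j hj
    · exact memLp_of_lintegral_lt_top (hW.locallyIntegrableOn hw hj) (hWL j hj)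
    · refine (memLp_congr_ae ?_).1
        (memLp_of_lintegral_lt_top (hV.locallyIntegrableOn hw hj) (hVL j hj))
      filter_upwards [hV.ae_eq hW hw hj] with p hp
      rw [hp]

open Polynomial in
theorem TildeBound.exists_isEnergyChain {α : ℝ} {u : ℝ × ℝ → ℝ} (h : TildeBound T α u) :
    ∃ W, IsEnergyChain (timeSet T) α (aeval adjLog (X - 1 : ℝ[X])) u W := by
  obtain ⟨w, hw, h⟩ := h
  refine ThinFilm.exists_isEnergyChain hw.1 (fun η hη ψ => hw.pair_eq (fun η ψ => ?_) hη ψ) h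
  rw [adjD_tensor, C_1]

open Polynomial in
theorem CheckBound.exists_isEnergyChain {α : ℝ} {u : ℝ × ℝ → ℝ} (h : CheckBound T α u) :
    ∃ W, IsEnergyChain (timeSet T) α (aeval adjLog ((X - 1) * (X - 2) : ℝ[X])) u W := by
  obtain ⟨w, hw, h⟩ := h
  refine ThinFilm.exists_isEnergyChain hw.1 (fun η hη ψ => hw.pair_eq (fun η ψ => ?_) hη ψ) h
  rw [adjD_tensor, adjD_tensor, C_1, C_ofNat, map_mul]
  rfl

end ThinFilm

/-! ### The evolution equation for the transformed function -/

namespace ThinFilm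

section Pair

variable {I J : Set ℝ} {F G : ℝ × ℝ → ℝ} {η ψ φ : ℝ → ℝ}

theorem pair_add (hF : LocallyIntegrableOn F (I ×ˢ J)) (hG : LocallyIntegrableOn G (I ×ˢ J))
    (hη : IsTestIn I η) (hψ : IsTestIn J ψ) :
    pair (fun z => F z + G z) η ψ = pair F η ψ + pair G η ψ := by
  simp only [pair, add_mul]
  exact integral_add (integrable_pair hF hη hψ) (integrable_pair hG hη hψ)

theorem pair_const_mul (c : ℝ) : pair (fun z => c * F z) η ψ = c * pair F η ψ := by
  simp only [pair, mul_assoc, integral_const_mul]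

/-- The pairing as a linear functional of the test function in `x`. -/
noncomputable def pairHom (hF : LocallyIntegrableOn F (I ×ˢ Ioi 0)) (hη : IsTestIn I η) :
    testSpace →ₗ[ℝ] ℝ where
  toFun ψ := pair F η ψ.1
  map_add' ψ φ := by
    change ∫ p : ℝ × ℝ, F p * (η p.1 * (ψ.1 p.2 + φ.1 p.2)) = _
    simp only [mul_add]
    exact integral_add (integrable_pair hF hη ψ.2) (integrable_pair hF hη φ.2)
  map_smul' c ψ := by
    change ∫ p : ℝ × ℝ, F p * (η p.1 * (c * ψ.1 p.2)) = c * _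
    rw [pair, ← integral_const_mul]
    exact integral_congr_ae (Eventually.of_forall fun p => by simp only; ring)

theorem pair_inv_mul (ψ : testSpace) :
    pair (fun z => z.2⁻¹ * F z) η ψ.1 = pair F η (invMul ψ).1 := by
  refine integral_congr_ae (Eventually.of_forall fun z => ?_)
  change z.2⁻¹ * F z * (η z.1 * ψ.1 z.2) = F z * (η z.1 * (z.2⁻¹ * ψ.1 z.2))
  ring

theorem pair_comb {W : ℕ → ℝ × ℝ → ℝ} (p : Quartic)
    (hW : ∀ j ≤ 4, LocallyIntegrableOn (W j) (I ×ˢ J)) (hη : IsTestIn I η) (hψ : IsTestIn J ψ) :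
    pair (fun z => p.comb fun j => W j z) η ψ = p.comb fun j => pair (W j) η ψ := by
  have h (j : ℕ) (hj : j ≤ 4) (c : ℝ) : LocallyIntegrableOn (fun z => c * W j z) (I ×ˢ J) :=
    (hW j hj).smul c
  have h3 := (hW 4 le_rfl).add (h 3 (by norm_num) p.a₃)
  have h2 := h3.add (h 2 (by norm_num) p.a₂)
  have h1 := h2.add (h 1 (by norm_num) p.a₁)
  simp only [Quartic.comb]
  have e1 := pair_add h1 (h 0 (by norm_num) p.a₀) hη hψ
  have e2 := pair_add h2 (h 1 (by norm_num) p.a₁) hη hψ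
  have e3 := pair_add h3 (h 2 (by norm_num) p.a₂) hη hψ
  have e4 := pair_add (hW 4 le_rfl) (h 3 (by norm_num) p.a₃) hη hψ
  simp only [pair_const_mul] at e1 e2 e3 e4
  refine e1.trans (congrArg (· + _) (e2.trans (congrArg (· + _) (e3.trans ?_))))
  exact congrArg (· + _) e4

end Pair

theorem locallyIntegrableOn_comb {U : Set (ℝ × ℝ)} {W : ℕ → ℝ × ℝ → ℝ} (p : Quartic)
    (hW : ∀ j ≤ 4, LocallyIntegrableOn (W j) U) :
    LocallyIntegrableOn (fun z => p.comb fun j => W j z) U := by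
  have h (j : ℕ) (hj : j ≤ 4) (c : ℝ) : LocallyIntegrableOn (fun z => c * W j z) U :=
    (hW j hj).smul c
  exact ((((hW 4 le_rfl).add (h 3 (by norm_num) p.a₃)).add (h 2 (by norm_num) p.a₂)).add
    (h 1 (by norm_num) p.a₁)).add (h 0 (by norm_num) p.a₀)

/-- The function `x⁻¹ p(D) w + x⁻² q(D) w`, where `W j = D^j w`. -/
noncomputable def operatorImage (p q : Quartic) (W : ℕ → ℝ × ℝ → ℝ) : ℝ × ℝ → ℝ := fun z =>
  z.2⁻¹ * p.comb (fun j => W j z) + (z.2 ^ 2)⁻¹ * q.comb fun j => W j z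

theorem locallyIntegrableOn_snd_mul {I J : Set ℝ} {F : ℝ × ℝ → ℝ} {a : ℝ → ℝ} (hI : IsOpen I)
    (hJ : IsOpen J) (ha : ContinuousOn a J) (hF : LocallyIntegrableOn F (I ×ˢ J)) :
    LocallyIntegrableOn (fun z => a z.2 * F z) (I ×ˢ J) :=
  hF.continuousOn_mul (ha.comp continuousOn_snd fun _ hz => hz.2) (hI.prod hJ).isLocallyClosed

theorem continuousOn_inv_Ioi : ContinuousOn (fun x : ℝ => x⁻¹) (Ioi 0) :=
  continuousOn_inv₀.mono fun _ hx => ne_of_gt hx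

theorem continuousOn_inv_sq_Ioi : ContinuousOn (fun x : ℝ => (x ^ 2)⁻¹) (Ioi 0) :=
  (continuousOn_pow 2).inv₀ fun _ hx => pow_ne_zero 2 (ne_of_gt hx)

namespace IsEnergyChain

variable {I : Set ℝ} {α : ℝ} {r : Module.End ℝ testSpace} {u : ℝ × ℝ → ℝ} {W : ℕ → ℝ × ℝ → ℝ}
  {p q : Quartic} {η : ℝ → ℝ}

theorem pair_pow (h : IsEnergyChain I α r u W) (hη : IsTestIn I η) {j : ℕ} (hj : j ≤ 4)
    (ψ : testSpace) : pair (W j) η ψ.1 = pair (W 0) η ((adjLog ^ j) ψ).1 := by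
  induction j generalizing ψ with
  | zero => rfl
  | succ j ih => rw [h.step j hj η hη, ih (Nat.le_of_succ_le hj), pow_succ]; rfl

theorem pair_comb (h : IsEnergyChain I α r u W) (hη : IsTestIn I η) (p : Quartic)
    (ψ : testSpace) :
    pair (fun z => p.comb fun j => W j z) η ψ.1 = pair (W 0) η (p.aeval adjLog ψ).1 := by
  rw [ThinFilm.pair_comb p h.locallyIntegrable hη ψ.2]
  change _ = pairHom (h.locallyIntegrable 0 zero_le) hη (p.aeval adjLog ψ)
  have e : p.aeval adjLog ψ = (adjLog ^ 4) ψ + p.a₃ • (adjLog ^ 3) ψ + p.a₂ • (adjLog ^ 2) ψ +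
    p.a₁ • (adjLog ^ 1) ψ + p.a₀ • (adjLog ^ 0) ψ := rfl
  rw [e]
  simp only [map_add, map_smul, smul_eq_mul, Quartic.comb]
  rw [h.pair_pow hη le_rfl, h.pair_pow hη (j := 3) (by norm_num),
    h.pair_pow hη (j := 2) (by norm_num), h.pair_pow hη (j := 1) (by norm_num),
    h.pair_pow hη (j := 0) (by norm_num)]
  rfl

theorem pair_operatorImage (hI : IsOpen I) (h : IsEnergyChain I α r u W) (hη : IsTestIn I η)
    (ψ : testSpace) : pair (operatorImage p q W) η ψ.1 =
      pair (W 0) η ((p.aeval adjLog * invMul + q.aeval adjLog * invMul ^ 2 :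
        Module.End ℝ testSpace) ψ).1 := by
  have hp := locallyIntegrableOn_snd_mul hI isOpen_Ioi continuousOn_inv_Ioi
    (locallyIntegrableOn_comb p h.locallyIntegrable)
  have hq := locallyIntegrableOn_snd_mul hI isOpen_Ioi continuousOn_inv_sq_Ioi
    (locallyIntegrableOn_comb q h.locallyIntegrable)
  unfold operatorImage
  rw [pair_add hp hq hη ψ.2, pair_inv_mul, h.pair_comb hη]
  have e : pair (fun z : ℝ × ℝ => (z.2 ^ 2)⁻¹ * q.comb fun j => W j z) η ψ.1 =
      pair (W 0) η (q.aeval adjLog ((invMul ^ 2) ψ)).1 := by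
    rw [← h.pair_comb hη]
    change _ = pair _ η (invMul (invMul ψ)).1
    rw [← pair_inv_mul, ← pair_inv_mul]
    simp only [pow_two, mul_inv, mul_assoc]
  rw [e]
  exact (map_add (pairHom (h.locallyIntegrable 0 zero_le) hη) (p.aeval adjLog (invMul ψ))
    (q.aeval adjLog ((invMul ^ 2) ψ))).symm

/-- The weak form of ∂ₜw = -Lw: the equation for u is tested with η · rψ, and the intertwining
relation moves r to the outside. -/
theorem pair_deriv (hI : IsOpen I) (hu : IsHomSolution I u) (h : IsEnergyChain I α r u W)
    (hr : Intertwines r p q) (hη : IsTestIn I η) (ψ : testSpace) :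
    pair (W 0) (deriv η) ψ.1 = pair (operatorImage p q W) η ψ.1 := by
  rw [h.image _ hη.differentiate, hu.equation η hη, hr.comm, ← h.image η hη,
    h.pair_operatorImage hI hη]

/-- The relation between w and u is known only after integration in t, so w(t) pairs with ψ as u(t)
does with rψ for almost every t. That is enough for an essential limit. -/
theorem tendsto_zero (hI : IsOpen I) (hI0 : I ∈ 𝓝[>] (0 : ℝ)) (hu : IsHomSolution I u)
    (h : IsEnergyChain I α r u W) (ψ : testSpace) :
    Tendsto (fun t => ∫ x, W 0 (t, x) * ψ.1 x) (ae volume ⊓ 𝓝[>] 0) (𝓝 0) := by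
  refine (hu.initial (r ψ).1 (r ψ).2).congr' ?_
  have h1 := locallyIntegrableOn_section hI (h.locallyIntegrable 0 zero_le) ψ.2
  have h2 := locallyIntegrableOn_section hI hu.locallyIntegrable (r ψ).2
  have h3 := hI.ae_eq_zero_of_integral_contDiff_smul_eq_zero (h2.sub h1) fun η a b c => by
    have hη : IsTestIn I η := ⟨a, b, c⟩
    have := h.image η hη ψ
    rw [pair_eq_integral (h.locallyIntegrable 0 zero_le) hη ψ.2,
      pair_eq_integral hu.locallyIntegrable hη (r ψ).2] at this
    simp only [Pi.sub_apply, smul_eq_mul, mul_sub]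
    rw [integral_sub]
    · rw [sub_eq_zero]
      simpa only [mul_comm] using this.symm
    · simpa only [mul_comm] using hη.integrable_mul h2
    · simpa only [mul_comm] using hη.integrable_mul h1
  filter_upwards [inf_le_left (a := ae volume) h3, inf_le_right (a := ae volume) hI0] with t ht htI
  exact sub_eq_zero.1 (ht htI)

/-- The energy bound is global in time, so K needs only finite measure and may reach down to the
initial time. This is what allows primitives based at 0. -/
theorem integrableOn_mul (h : IsEnergyChain I α r u W) {K L : Set ℝ} (hK : MeasurableSet K)
    (hKI : K ⊆ I) (hKv : volume K ≠ ⊤) (hL : IsCompact L) (hL0 : L ⊆ Ioi 0) {a : ℝ → ℝ}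
    (ha : ContinuousOn a (Ioi 0)) {j : ℕ} (hj : j ≤ 4) :
    IntegrableOn (fun z => a z.2 * W j z) (K ×ˢ L) := by
  -- Either weight would do, since powers of x are bounded on the compact set L.
  set β := α + 1
  have hm := (h.memLp β (Or.inr rfl) j hj).mono_measure
    (Measure.restrict_mono (prod_mono hKI hL0) le_rfl)
  have hf : IsFiniteMeasure ((volume : Measure (ℝ × ℝ)).restrict (K ×ˢ L)) := by
    refine ⟨?_⟩
    rw [Measure.restrict_apply_univ, Measure.volume_eq_prod, Measure.prod_prod]
    exact ENNReal.mul_lt_top hKv.lt_top hL.measure_lt_top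
  have hi := hm.integrable (by norm_num)
  have hb : ContinuousOn (fun x => a x * x ^ (β + 1 / 2)) (Ioi 0) :=
    ha.mul (continuousOn_id.rpow_const fun x hx => Or.inl (ne_of_gt hx))
  obtain ⟨C, hC⟩ := hL.exists_bound_of_continuousOn (hb.mono hL0)
  have hmeas : MeasurableSet (K ×ˢ L) := hK.prod hL.measurableSet
  have hbm : AEStronglyMeasurable (fun z : ℝ × ℝ => a z.2 * z.2 ^ (β + 1 / 2))
      (volume.restrict (K ×ˢ L)) :=
    ((hb.mono hL0).comp continuousOn_snd fun z hz => hz.2).aestronglyMeasurable hmeas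
  refine (hi.bdd_mul hbm (c := C) ?_).congr ?_
  · filter_upwards [ae_restrict_mem hmeas] with z hz using hC z.2 hz.2
  · filter_upwards [ae_restrict_mem hmeas] with z hz
    have hz0 : 0 < z.2 := hL0 hz.2
    have : z.2 ^ (β + 1 / 2) * z.2 ^ (-β - 1 / 2) = 1 := by
      rw [← Real.rpow_add hz0]; ring_nf; exact Real.rpow_zero _
    linear_combination a z.2 * W j z * this

theorem integrableOn_operatorImage (h : IsEnergyChain I α r u W) {K L : Set ℝ}
    (hK : MeasurableSet K) (hKI : K ⊆ I) (hKv : volume K ≠ ⊤) (hL : IsCompact L)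
    (hL0 : L ⊆ Ioi 0) : IntegrableOn (operatorImage p q W) (K ×ˢ L) := by
  have key (p : Quartic) {a : ℝ → ℝ} (ha : ContinuousOn a (Ioi 0)) :
      IntegrableOn (fun z : ℝ × ℝ => a z.2 * p.comb fun j => W j z) (K ×ˢ L) := by
    have e (j : ℕ) (hj : j ≤ 4) := h.integrableOn_mul hK hKI hKv hL hL0 ha hj
    refine (((((e 4 le_rfl).add ((e 3 (by norm_num)).const_mul p.a₃)).add
      ((e 2 (by norm_num)).const_mul p.a₂)).add ((e 1 (by norm_num)).const_mul p.a₁)).add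
      ((e 0 (by norm_num)).const_mul p.a₀)).congr (Eventually.of_forall fun z => ?_)
    simp only [Pi.add_apply, Quartic.comb]
    ring
  exact (key p continuousOn_inv_Ioi).add (key q continuousOn_inv_sq_Ioi)

theorem uIoc_subset (hIc : OrdConnected I) (hIs : I ⊆ Ioi 0) (hI0 : I ∈ 𝓝[>] (0 : ℝ)) {t : ℝ}
    (ht : t ∈ I) : uIoc 0 t ⊆ I := by
  intro s hs
  rw [uIoc_of_le (hIs ht).le] at hs
  obtain ⟨b, hb, hbs⟩ := mem_nhdsGT_iff_exists_Ioo_subset.1 hI0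
  have hb : 0 < b := hb
  have hm : 0 < min b s := lt_min hb hs.1
  exact hIc.out (hbs ⟨half_pos hm, by linarith [min_le_left b s]⟩) ht
    ⟨by linarith [min_le_right b s], hs.2⟩

theorem ae_eq_primitive (hI : IsOpen I) (hIc : OrdConnected I) (hIs : I ⊆ Ioi 0)
    (hI0 : I ∈ 𝓝[>] (0 : ℝ)) (hu : IsHomSolution I u) (h : IsEnergyChain I α r u W)
    (hr : Intertwines r p q) :
    ∀ᵐ z, z ∈ I ×ˢ Ioi 0 → W 0 z = ∫ s in (0 : ℝ)..z.1, -operatorImage p q W (s, z.2) := by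
  have hg : LocallyIntegrableOn (operatorImage p q W) (I ×ˢ Ioi 0) :=
    (locallyIntegrableOn_prod_iff hI isOpen_Ioi).2 fun K L hK hL hK' hL' =>
      h.integrableOn_operatorImage hK'.measurableSet hK hK'.measure_lt_top.ne hL' hL
  refine ThinFilm.ae_eq_primitive (h := fun z => -operatorImage p q W z) hI hIc isOpen_Ioi hI0
    (h.locallyIntegrable 0 zero_le) hg.neg (fun t ht L hL hL' => ?_) (fun η ψ hη hψ => ?_)
    fun ψ hψ => h.tendsto_zero hI hI0 hu ⟨ψ, hψ⟩
  · exact (h.integrableOn_operatorImage measurableSet_uIoc (uIoc_subset hIc hIs hI0 ht)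
      (by simp [uIoc]) hL' hL).neg
  · rw [h.pair_deriv hI hu hr hη ⟨ψ, hψ⟩]
    simp only [pair, neg_mul, integral_neg, neg_neg]

end IsEnergyChain

end ThinFilm

/-! ### Slices in space -/

namespace ThinFilm

theorem WeightedL2.congr {β : ℝ} {f g : ℝ → ℝ} (hf : WeightedL2 β f)
    (h : f =ᵐ[volume.restrict (Ioi 0)] g) : WeightedL2 β g :=
  (memLp_congr_ae (h.mono fun x hx => by simp only [hx])).1 hf

theorem WeightedL2.locallyIntegrableOn_div {β : ℝ} {f : ℝ → ℝ} (hf : WeightedL2 β f) :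
    LocallyIntegrableOn (fun x => f x / x) (Ioi 0) := by
  rw [locallyIntegrableOn_iff isOpen_Ioi.isLocallyClosed]
  intro K hK hKc
  have hm := MemLp.mono_measure (Measure.restrict_mono hK le_rfl) hf
  have : IsFiniteMeasure (volume.restrict K) := ⟨by simpa using hKc.measure_lt_top⟩
  have hb : ContinuousOn (fun x : ℝ => x ^ (β - 1 / 2)) K :=
    continuousOn_id.rpow_const fun x hx => Or.inl (ne_of_gt (hK hx))
  obtain ⟨C, hC⟩ := hKc.exists_bound_of_continuousOn hb
  refine ((hm.integrable (by norm_num)).bdd_mul (hb.aestronglyMeasurable hKc.measurableSet)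
    (c := C) ?_).congr ?_
  · filter_upwards [ae_restrict_mem hKc.measurableSet] with x hx using hC x hx
  · filter_upwards [ae_restrict_mem hKc.measurableSet] with x hx
    have hx0 : 0 < x := hK hx
    have : x ^ (β - 1 / 2) * x ^ (-β - 1 / 2) = x⁻¹ := by
      rw [← Real.rpow_add hx0, ← Real.rpow_neg_one]; ring_nf
    rw [← mul_assoc, this, div_eq_inv_mul]

theorem isLogPrim_primitive {f : ℝ → ℝ} (hf : LocallyIntegrableOn (fun x => f x / x) (Ioi 0))
    (c : ℝ) : IsLogPrim (fun x => c + ∫ s in (1 : ℝ)..x, f s / s) f := by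
  refine ⟨hf, fun a ha b hb => ?_⟩
  have h (x : ℝ) (hx : 0 < x) : IntervalIntegrable (fun s => f s / s) volume 1 x :=
    intervalIntegrable_of_mem ordConnected_Ioi hf (mem_Ioi.2 one_pos) hx
  rw [add_sub_add_left_eq_sub, intervalIntegral.integral_interval_sub_left (h b hb) (h a ha)]

theorem IsLogPrim.congr_right {f g g' : ℝ → ℝ} (hf : IsLogPrim f g)
    (h : g =ᵐ[volume.restrict (Ioi 0)] g') : IsLogPrim f g' := by
  have h' : (fun x => g x / x) =ᵐ[volume.restrict (Ioi 0)] fun x => g' x / x :=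
    h.mono fun x hx => by simp only [hx]
  refine ⟨?_, fun a ha b hb => ?_⟩
  · rw [locallyIntegrableOn_iff isOpen_Ioi.isLocallyClosed]
    intro K hK hKc
    exact (hf.1.integrableOn_compact_subset hK hKc).congr (ae_mono (Measure.restrict_mono hK le_rfl) h')
  · rw [hf.2 a ha b hb]
    refine intervalIntegral.integral_congr_ae ?_
    filter_upwards [(ae_restrict_iff' measurableSet_Ioi).1 h'] with x hx hxm
    exact hx (IsLogPrim.uIcc_subset ha hb (uIoc_subset_uIcc hxm))

theorem ae_ae_of_ae_prod {I J : Set ℝ} (hI : MeasurableSet I)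
    {P : ℝ × ℝ → Prop} (h : ∀ᵐ z ∂(volume : Measure (ℝ × ℝ)).restrict (I ×ˢ J), P z) :
    ∀ᵐ t, t ∈ I → ∀ᵐ x ∂volume.restrict J, P (t, x) := by
  rw [Measure.volume_eq_prod, ← Measure.prod_restrict] at h
  exact (ae_restrict_iff' hI).1 (Measure.ae_ae_of_ae_prod h)

namespace IsEnergyChain

variable {I : Set ℝ} {α : ℝ} {r : Module.End ℝ testSpace} {u : ℝ × ℝ → ℝ} {W : ℕ → ℝ × ℝ → ℝ}
  {p q : Quartic}

theorem ae_weightedL2 (hI : IsOpen I) (h : IsEnergyChain I α r u W) {β : ℝ}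
    (hβ : β = α + 1 / 2 ∨ β = α + 1) {j : ℕ} (hj : j ≤ 4) :
    ∀ᵐ t, t ∈ I → WeightedL2 β fun x => W j (t, x) := by
  have hm := h.memLp β hβ j hj
  have hms := hm.1
  have hi := hm.integrable_sq
  rw [Measure.volume_eq_prod, ← Measure.prod_restrict] at hms hi
  rw [← ae_restrict_iff' hI.measurableSet]
  filter_upwards [hms.prodMk_left, hi.prod_right_ae] with t h1 h2
  exact (memLp_two_iff_integrable_sq h1).2 h2

/-- The two-variable primitive lemma with the variables exchanged. Because ∂ψ = -E(x⁻¹ψ), the chain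
relation tested with x⁻¹ψ says that the weak x-derivative of W_j is W_{j+1}/x. -/
theorem ae_eq_primitive_snd (hI : IsOpen I) (h : IsEnergyChain I α r u W) {j : ℕ} (hj : j < 4) :
    ∀ᵐ t, t ∈ I → ∃ c, (fun x => W j (t, x)) =ᵐ[volume.restrict (Ioi 0)]
      fun x => c + ∫ s in (1 : ℝ)..x, W (j + 1) (t, s) / s := by
  have hd := locallyIntegrableOn_snd_mul hI isOpen_Ioi continuousOn_inv_Ioi
    (h.locallyIntegrable (j + 1) hj)
  have hds := locallyIntegrableOn_swap hd
  obtain ⟨c, -, hc⟩ := exists_eq_add_primitive (a := 1) isOpen_Ioi ordConnected_Ioi hI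
    (locallyIntegrableOn_swap (h.locallyIntegrable j hj.le)) hds (fun x hx L hL hL' => by
      refine IntegrableOn.mono_set ?_ (prod_mono uIoc_subset_uIcc Subset.rfl)
      exact hds.integrableOn_compact_subset
        (prod_mono (ordConnected_Ioi.uIcc_subset (mem_Ioi.2 one_pos) hx) hL)
        (isCompact_uIcc.prod hL')) (fun ψ η hψ hη => by
      rw [pair_swap, pair_swap, pair_inv_mul ⟨ψ, hψ⟩, deriv_eq ⟨ψ, hψ⟩]
      have := h.step j hj η hη (invMul ⟨ψ, hψ⟩)
      rw [this]
      exact map_neg (pairHom (h.locallyIntegrable j hj.le) hη) (adjLog (invMul ⟨ψ, hψ⟩)))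
  have hc' := (ae_restrict_iff' (isOpen_Ioi.prod hI).measurableSet).2 hc
  rw [Measure.volume_eq_prod, ← Measure.prod_restrict] at hc'
  have hs := Measure.measurePreserving_swap.quasiMeasurePreserving.ae hc'
  have := Measure.ae_ae_of_ae_prod hs
  filter_upwards [(ae_restrict_iff' hI.measurableSet).1 this] with t ht htI
  refine ⟨c t, ?_⟩
  filter_upwards [ht htI] with x hx
  simpa only [Function.comp, Prod.swap_prod_mk, Prod.swap, inv_mul_eq_div] using hx

theorem ae_integral_nonneg (hI : IsOpen I) (h : IsEnergyChain I α r u W)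
    (H : NonnegOnTests p q α) : ∀ᵐ t, t ∈ I →
      0 ≤ ∫ x in Ioi 0, x ^ (-2 * α) * operatorImage p q W (t, x) * W 0 (t, x) / x := by
  have h1 : ∀ᵐ t, t ∈ I → ∀ j ≤ 4, WeightedL2 (α + 1 / 2) fun x => W j (t, x) := by
    have := (ae_all_iff (ι := Fin 5)).2 fun j =>
      h.ae_weightedL2 hI (Or.inl rfl) (Nat.le_of_lt_succ j.2)
    filter_upwards [this] with t ht htI j hj using ht ⟨j, Nat.lt_succ_of_le hj⟩ htI
  have h2 : ∀ᵐ t, t ∈ I → ∀ j ≤ 4, WeightedL2 (α + 1) fun x => W j (t, x) := by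
    have := (ae_all_iff (ι := Fin 5)).2 fun j =>
      h.ae_weightedL2 hI (Or.inr rfl) (Nat.le_of_lt_succ j.2)
    filter_upwards [this] with t ht htI j hj using ht ⟨j, Nat.lt_succ_of_le hj⟩ htI
  have h3 : ∀ᵐ t, t ∈ I → ∀ j < 4, ∃ c, (fun x => W j (t, x)) =ᵐ[volume.restrict (Ioi 0)]
      fun x => c + ∫ s in (1 : ℝ)..x, W (j + 1) (t, s) / s := by
    have := (ae_all_iff (ι := Fin 4)).2 fun j => h.ae_eq_primitive_snd hI j.2
    filter_upwards [this] with t ht htI j hj using ht ⟨j, hj⟩ htI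
  filter_upwards [h1, h2, h3] with t h1 h2 h3 htI
  choose! c hc using h3 htI
  -- Below order 4 the slices are replaced by their absolutely continuous representatives; the
  -- derivative of top order is kept as it is.
  let w : ℕ → ℝ → ℝ := fun j x =>
    if j < 4 then c j + ∫ s in (1 : ℝ)..x, W (j + 1) (t, s) / s else W j (t, x)
  have hw : ∀ j, (fun x => W j (t, x)) =ᵐ[volume.restrict (Ioi 0)] w j := by
    intro j
    by_cases hj : j < 4
    · simpa only [w, if_pos hj] using hc j hj
    · simp only [w, if_neg hj]; rfl
  have key := H.integral_nonneg (w := w) (fun j hj => ?_) ?_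
  · refine key.trans_eq (integral_congr_ae ?_)
    filter_upwards [ae_all_iff.2 hw] with x hx
    simp only [operatorImage, hx]
  · have := isLogPrim_primitive (h1 htI (j + 1) hj).locallyIntegrableOn_div (c j)
    simp only [w, if_pos hj]
    exact this.congr_right (hw (j + 1))
  · rintro β (rfl | rfl) j hj
    · exact (h1 htI j hj).congr (hw j)
    · exact (h2 htI j hj).congr (hw j)

end IsEnergyChain

end ThinFilm

/-! ### The energy identity and uniqueness -/

namespace ThinFilm

/-- The square of an absolutely continuous function is differentiated almost everywhere; no
continuity of h is required. -/
theorem integral_sq_eq {h : ℝ → ℝ} {a b : ℝ} (hh : IntervalIntegrable h volume a b) :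
    (∫ s in a..b, h s) ^ 2 = 2 * ∫ s in a..b, h s * ∫ τ in a..s, h τ := by
  have h1 := hh.absolutelyContinuousOnInterval_intervalIntegral (c := a) left_mem_uIcc
  have h2 := h1.integral_deriv_mul_eq_sub h1
  rw [intervalIntegral.integral_same] at h2
  have h3 : ∫ s in a..b, 2 * (h s * ∫ τ in a..s, h τ) = _ :=
    (intervalIntegral.integral_congr_ae (by
      filter_upwards [hh.ae_hasDerivAt_integral] with x hx hxm
      rw [(hx (uIoc_subset_uIcc hxm) a left_mem_uIcc).deriv]
      ring)).trans h2
  rw [intervalIntegral.integral_const_mul] at h3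
  rw [h3]
  ring

namespace IsEnergyChain

variable {I : Set ℝ} {α : ℝ} {r : Module.End ℝ testSpace} {u : ℝ × ℝ → ℝ} {W : ℕ → ℝ × ℝ → ℝ}
  {p q : Quartic}

theorem integrableOn_comb_mul (h : IsEnergyChain I α r u W) (p : Quartic) {β : ℝ}
    (hβ : β = α + 1 / 2 ∨ β = α + 1) (hI : IsOpen I) :
    IntegrableOn (fun z : ℝ × ℝ => z.2 ^ (-2 * β - 1) * ((p.comb fun j => W j z) * W 0 z))
      (I ×ˢ Ioi 0) := by
  have e (j : ℕ) (hj : j ≤ 4) := h.memLp β hβ j hj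
  have hm := ((((e 4 le_rfl).add ((e 3 (by norm_num)).const_mul p.a₃)).add
    ((e 2 (by norm_num)).const_mul p.a₂)).add ((e 1 (by norm_num)).const_mul p.a₁)).add
    ((e 0 (by norm_num)).const_mul p.a₀)
  refine (hm.integrable_mul (e 0 (by norm_num))).congr ?_
  filter_upwards [ae_restrict_mem (hI.prod isOpen_Ioi).measurableSet] with z hz
  simp only [Pi.mul_apply, Pi.add_apply, Quartic.comb]
  rw [← rpow_mul_rpow_eq hz.2]
  ring

/-- In each of the two weights a fourth-order combination of the W_j is multiplied by W₀, and both
factors are square integrable in (t, x). -/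
theorem integrableOn_density (hI : IsOpen I) (h : IsEnergyChain I α r u W) :
    IntegrableOn (fun z : ℝ × ℝ => z.2 ^ (-2 * α) * operatorImage p q W z * W 0 z / z.2)
      (I ×ˢ Ioi 0) :=
  ((h.integrableOn_comb_mul p (Or.inl rfl) hI).add
    (h.integrableOn_comb_mul q (Or.inr rfl) hI)).congr_fun
    (fun _ hz => (weight_mul_eq α hz.2 _ _ _).symm) (hI.prod isOpen_Ioi).measurableSet

theorem ae_intervalIntegrable (h : IsEnergyChain I α r u W) {t : ℝ} (ht : uIoc 0 t ⊆ I) :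
    ∀ᵐ x, x ∈ Ioi 0 → IntervalIntegrable (fun s => operatorImage p q W (s, x)) volume 0 t := by
  refine ae_of_locally fun x hx => ?_
  obtain ⟨L, hL, hxL, hLs⟩ := exists_compact_subset isOpen_Ioi hx
  refine ⟨L, mem_interior_iff_mem_nhds.1 hxL, ?_⟩
  have hi := h.integrableOn_operatorImage (p := p) (q := q) measurableSet_uIoc ht
    (by simp [uIoc]) hL hLs
  rw [IntegrableOn, Measure.volume_eq_prod, ← Measure.prod_restrict] at hi
  filter_upwards [(ae_restrict_iff' hL.measurableSet).1 hi.prod_left_ae] with y hy hyL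
  exact intervalIntegrable_iff.2 (hy hyL)

/-- The energy identity at time t. For almost every x, the integral of the density over (0, t) is
-½x^(-2α-1) times the square of the primitive. Integrating in x first gives something nonnegative by
coercivity, integrating in s first something nonpositive, so both vanish. The integrability in x
comes from Fubini and is not presupposed for w(t). The statement concerns the primitive, which makes
sense at every t. -/
theorem ae_primitive_eq_zero (hI : IsOpen I) (hIc : OrdConnected I) (hIs : I ⊆ Ioi 0)
    (hI0 : I ∈ 𝓝[>] (0 : ℝ)) (hu : IsHomSolution I u) (h : IsEnergyChain I α r u W)
    (hr : Intertwines r p q) (H : NonnegOnTests p q α) {t : ℝ} (ht : t ∈ I) :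
    ∀ᵐ x ∂volume.restrict (Ioi 0), ∫ s in (0 : ℝ)..t, -operatorImage p q W (s, x) = 0 := by
  have htI := uIoc_subset hIc hIs hI0 ht
  have ht0 : 0 ≤ t := (hIs ht).le
  rw [uIoc_of_le ht0] at htI
  set G : ℝ × ℝ → ℝ := fun z => z.2 ^ (-2 * α) * operatorImage p q W z * W 0 z / z.2
  have hG : Integrable G ((volume.restrict (Ioc 0 t)).prod (volume.restrict (Ioi 0))) := by
    rw [Measure.prod_restrict]
    exact (h.integrableOn_density hI).mono_set (prod_mono htI Subset.rfl)
  have hGx : ∀ᵐ x ∂volume.restrict (Ioi 0), ∫ s in Ioc 0 t, G (s, x) =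
      -(x ^ (-2 * α) / x / 2 * (∫ s in (0 : ℝ)..t, -operatorImage p q W (s, x)) ^ 2) := by
    have h1 := (ae_restrict_iff' (hI.prod isOpen_Ioi).measurableSet).2
      (h.ae_eq_primitive hI hIc hIs hI0 hu hr)
    rw [Measure.volume_eq_prod, ← Measure.prod_restrict] at h1
    have h2 := Measure.ae_ae_of_ae_prod (Measure.measurePreserving_swap.quasiMeasurePreserving.ae h1)
    have h3 := (ae_restrict_iff' measurableSet_Ioi).2
      (h.ae_intervalIntegrable (p := p) (q := q) (uIoc_subset hIc hIs hI0 ht))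
    filter_upwards [h2, h3] with x hx2 hx3
    have h4 := integral_sq_eq hx3.neg
    simp only [Pi.neg_apply] at h4
    rw [h4, intervalIntegral.integral_of_le ht0, ← integral_const_mul, ← integral_const_mul,
      ← integral_neg]
    refine integral_congr_ae ?_
    filter_upwards [ae_mono (Measure.restrict_mono htI le_rfl) hx2] with s hs
    simp only [Prod.swap_prod_mk] at hs
    simp only [G, hs]
    ring
  have hnn : 0 ≤ ∫ x in Ioi 0, ∫ s in Ioc 0 t, G (s, x) := by
    rw [← integral_integral_swap (f := fun s x => G (s, x)) hG]
    refine integral_nonneg_of_ae ?_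
    filter_upwards [ae_restrict_of_ae (h.ae_integral_nonneg hI H),
      ae_restrict_mem measurableSet_Ioc] with s hs hsm using hs (htI hsm)
  have hw : ∀ x ∈ Ioi (0 : ℝ), 0 < x ^ (-2 * α) / x / 2 := fun x hx =>
    half_pos (div_pos (Real.rpow_pos_of_pos hx _) hx)
  have hle : 0 ≤ᵐ[volume.restrict (Ioi 0)] fun x => -∫ s in Ioc 0 t, G (s, x) := by
    filter_upwards [hGx, ae_restrict_mem measurableSet_Ioi] with x hx hx0
    rw [hx, neg_neg]
    exact mul_nonneg (hw x hx0).le (sq_nonneg _)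
  have hz : ∫ x in Ioi 0, -∫ s in Ioc 0 t, G (s, x) = 0 := by
    refine le_antisymm ?_ (integral_nonneg_of_ae hle)
    rw [integral_neg]
    linarith
  have h0 := (integral_eq_zero_iff_of_nonneg_ae hle hG.integral_prod_right.neg).1 hz
  filter_upwards [h0, hGx, ae_restrict_mem measurableSet_Ioi] with x hx1 hx2 hx0
  simp only [Pi.zero_apply, hx2, neg_neg] at hx1
  exact pow_eq_zero_iff two_ne_zero |>.1 ((mul_eq_zero.1 hx1).resolve_left (hw x hx0).ne')

theorem pair_eq_zero (hI : IsOpen I) (hIc : OrdConnected I) (hIs : I ⊆ Ioi 0)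
    (hI0 : I ∈ 𝓝[>] (0 : ℝ)) (hu : IsHomSolution I u) (h : IsEnergyChain I α r u W)
    (hr : Intertwines r p q) (H : NonnegOnTests p q α) {η : ℝ → ℝ} (hη : IsTestIn I η)
    (ψ : testSpace) : pair (W 0) η ψ.1 = 0 := by
  rw [pair_eq_integral (h.locallyIntegrable 0 zero_le) hη ψ.2]
  refine integral_eq_zero_of_ae ?_
  have h1 := ae_ae_of_ae_prod hI.measurableSet
    ((ae_restrict_iff' (hI.prod isOpen_Ioi).measurableSet).2
      (h.ae_eq_primitive hI hIc hIs hI0 hu hr))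
  filter_upwards [h1] with t ht
  by_cases htI : t ∈ I
  · have : ∫ x, W 0 (t, x) * ψ.1 x = 0 := by
      rw [← IsTestIn.setIntegral_eq ψ.2]
      refine integral_eq_zero_of_ae ?_
      filter_upwards [ht htI, h.ae_primitive_eq_zero hI hIc hIs hI0 hu hr H htI] with x hx1 hx2
      rw [hx1, hx2, zero_mul, Pi.zero_apply]
    rw [this, zero_mul, Pi.zero_apply]
  · rw [image_eq_zero_of_notMem_tsupport fun h' => htI (hη.2.2 h'), mul_zero, Pi.zero_apply]

/-- The operator r(D) need not be inverted: by `factor`, testing 𝒜u amounts to testing w = 0, so u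
has zero weak time derivative and zero initial value. -/
theorem ae_eq_zero (hI : IsOpen I) (hIc : OrdConnected I) (hIs : I ⊆ Ioi 0)
    (hI0 : I ∈ 𝓝[>] (0 : ℝ)) (hu : IsHomSolution I u) (h : IsEnergyChain I α r u W)
    (hr : Intertwines r p q) (H : NonnegOnTests p q α) :
    ∀ᵐ z, z ∈ I ×ˢ Ioi 0 → u z = 0 := by
  have := ThinFilm.ae_eq_primitive (h := fun _ => 0) hI hIc isOpen_Ioi hI0 hu.locallyIntegrable
    (locallyIntegrableOn_const 0) (fun _ _ _ _ _ => integrableOn_zero) (fun η ψ hη hψ => ?_)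
    hu.initial
  · simpa using this
  · obtain ⟨φ, hφ⟩ := hr.factor ⟨ψ, hψ⟩
    rw [hu.equation η hη ⟨ψ, hψ⟩, hφ, ← h.image η hη,
      h.pair_eq_zero hI hIc hIs hI0 hu hr H hη]
    simp [pair]

end IsEnergyChain

theorem wNormSq_nonneg (k : ℕ) (α : ℝ) (w : ℝ → ℝ) : 0 ≤ wNormSq k α w :=
  Finset.sum_nonneg fun j _ => setIntegral_nonneg measurableSet_Ioi fun x hx => by
    rw [mul_assoc]
    exact div_nonneg (mul_nonneg (Real.rpow_nonneg (le_of_lt hx) _) (mul_self_nonneg _)) (le_of_lt hx)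

/-- Uniqueness uses only the sign of the form, not the strength of the lower bound. -/
theorem nonnegOnTests_of_mem_coercivityRange {L : (ℝ → ℝ) → ℝ → ℝ} {p q : Quartic} {α : ℝ}
    (hL : ∀ w, IsTest w → L w = opOf p q w) (hα : α ∈ coercivityRange L) :
    NonnegOnTests p q α := by
  intro w hw
  obtain ⟨c, hc, h⟩ := hα
  rw [← hw.wInner_opOf, ← hL w hw]
  exact (mul_nonneg hc.le (add_nonneg (wNormSq_nonneg _ _ _) (wNormSq_nonneg _ _ _))).trans (h w hw)

theorem IsHomSolution.ae_eq_zero {T : EReal} (hT : 0 < T) {u : ℝ × ℝ → ℝ}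
    (hu : IsHomSolution (timeSet T) u) {α : ℝ} {r : Module.End ℝ testSpace}
    {W : ℕ → ℝ × ℝ → ℝ} {p q : Quartic} (hW : IsEnergyChain (timeSet T) α r u W)
    (hr : Intertwines r p q) (H : NonnegOnTests p q α) :
    u =ᵐ[volume.restrict (domain T)] 0 := by
  rw [domain_eq]
  exact (ae_restrict_iff' ((isOpen_timeSet T).prod isOpen_Ioi).measurableSet).2
    (hW.ae_eq_zero (isOpen_timeSet T) (ordConnected_timeSet T) (timeSet_subset T)
      (timeSet_mem_nhdsGT hT) hu hr H)

/-- By linearity u - v solves the homogeneous problem. Its bounds are obtained by subtracting the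
chains of weak derivatives, which is why both solutions must share the same α. -/
theorem IsSolution.ae_eq {T : EReal} (hT : 0 < T) {f u v : ℝ × ℝ → ℝ} {u₀ : ℝ → ℝ}
    (hu : IsSolution T f u₀ u) (hv : IsSolution T f u₀ v) {α : ℝ} {r : Module.End ℝ testSpace}
    {W V : ℕ → ℝ × ℝ → ℝ} {p q : Quartic} (hW : IsEnergyChain (timeSet T) α r u W)
    (hV : IsEnergyChain (timeSet T) α r v V) (hr : Intertwines r p q)
    (H : NonnegOnTests p q α) : u =ᵐ[volume.restrict (domain T)] v := by
  have hui := hu.locallyIntegrable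
  have hvi := hv.locallyIntegrable
  rw [domain_eq] at hui hvi
  filter_upwards [(hu.sub hT hv).ae_eq_zero hT (hW.sub hui hvi hV) hr H] with z hz
  exact sub_eq_zero.1 hz

end ThinFilm

theorem mainTheorem10 :
    -- uniqueness for homogeneous data
    (∀ (T : EReal) (u : ℝ × ℝ → ℝ), 0 < T →
      IsSolution T (fun _ => 0) (fun _ => 0) u →
      ((∃ α ∈ coercivityRange opTilde, TildeBound T α u) ∨
        (∃ α ∈ coercivityRange opCheck, CheckBound T α u)) →
      u =ᵐ[volume.restrict (domain T)] 0) ∧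
    -- uniqueness for general data in the same classes
    (∀ (T : EReal) (f : ℝ × ℝ → ℝ) (u₀ : ℝ → ℝ) (u v : ℝ × ℝ → ℝ), 0 < T →
      LocallyIntegrableOn f (domain T) → LocallyIntegrableOn u₀ (Ioi 0) →
      IsSolution T f u₀ u → IsSolution T f u₀ v →
      ((∃ α ∈ coercivityRange opTilde, TildeBound T α u ∧ TildeBound T α v) ∨
        (∃ α ∈ coercivityRange opCheck, CheckBound T α u ∧ CheckBound T α v)) →
      u =ᵐ[volume.restrict (domain T)] v) ∧
    -- the explicit weights are admissible
    Ioo (0 : ℝ) 1 ⊆ coercivityRange opTilde ∧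
    Ioo (1 - √(5 / 6 : ℝ)) (3 / 2) ⊆ coercivityRange opCheck := by
  refine ⟨fun T u hT hu h => ?_, fun T f u₀ u v hT _ _ hu hv h => ?_,
    Ioo_subset_coercivityRange_opTilde, Ioo_subset_coercivityRange_opCheck⟩
  · rcases h with ⟨α, hα, h⟩ | ⟨α, hα, h⟩
    · obtain ⟨W, hW⟩ := h.exists_isEnergyChain
      exact (hu.isHomSolution hT).ae_eq_zero hT hW intertwines_tilde
        (nonnegOnTests_of_mem_coercivityRange (fun _ => opTilde_eq) hα)
    · obtain ⟨W, hW⟩ := h.exists_isEnergyChain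
      exact (hu.isHomSolution hT).ae_eq_zero hT hW intertwines_check
        (nonnegOnTests_of_mem_coercivityRange (fun _ => opCheck_eq) hα)
  · rcases h with ⟨α, hα, h, h'⟩ | ⟨α, hα, h, h'⟩
    · obtain ⟨W, hW⟩ := h.exists_isEnergyChain
      obtain ⟨V, hV⟩ := h'.exists_isEnergyChain
      exact hu.ae_eq hT hv hW hV intertwines_tilde
        (nonnegOnTests_of_mem_coercivityRange (fun _ => opTilde_eq) hα)
    · obtain ⟨W, hW⟩ := h.exists_isEnergyChain
      obtain ⟨V, hV⟩ := h'.exists_isEnergyChain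
      exact hu.ae_eq hT hv hW hV intertwines_check
        (nonnegOnTests_of_mem_coercivityRange (fun _ => opCheck_eq) hα)
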